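/- Work with finitary type theories in the style of Haselwarter and Bauer: raw rules $\Xi \Longrightarrow \mathcal{B}[e]$ over a signature generate a deductive system for judgements $\Theta;\Gamma \vdash \mathsf{BB}[e]$ and boundaries $\Theta;\Gamma\vdash\mathsf{BB}$, where $\Theta$ is a metavariable context, $\Gamma$ a variable context, $\mathsf{BB}$ an abstracted boundary $\{x_1{:}A_1\}\cdots\{x_m{:}A_m\}\,\mathcal{B}$ filled with a head $e$. The boundary thesis $\mathcal{B}$ is one of $\Box\ \mathsf{type}$, $\Box : A$ (the object boundaries), $A\equiv B$ by $\Box$, and $s\equiv t:A$ by $\Box$. A theory is *finitary* if every specific rule has a derivably well-formed premise context and conclusion boundary; it is *standard* if moreover its specific object rules are symbol rules (their head is a symbol $\mathsf{S}$ applied generically to the premises) and each symbol has exactly one. A raw rule $\Xi \Longrightarrow \mathcal{J}$ is *deterministic* if every judgement $\Theta;\Gamma\vdash\mathcal{J}'$ admits at most one instantiation $I$ of $\Xi$ over $\Theta;\Gamma$ with $I_*\mathcal{J}=\mathcal{J}'$. A derivable raw rule is *object-invertible* if for every derivably well-formed $\Theta$ and every instantiation $I$ of $\Xi$ over $\Theta;[\,]$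 for which $\Theta;[\,]\vdash I_*\mathcal{J}$ is derivable, the instantiation that agrees with $I$ on the object metavariables of $\Xi$ and is generic on the equational ones is derivable over $\Theta$ extended by the $I$-instances of the equational premises of $\Xi$. A *type computation rule* is a derivable finitary rule $\Xi\Longrightarrow P\equiv B$ with $\Xi\Longrightarrow P\ \mathsf{type}$ deterministic and object-invertible. A *term computation rule* is a derivable finitary rule $\Xi\Longrightarrow p\equiv v:B$ with $p$ a term symbol application and $\Xi\Longrightarrow p:\tau(p)$ deterministic and object-invertible, where $\tau(p)$ is the natural type of $p$, read off from its symbol rule. An *extensionality rule* is a derivable finitary rule $\Xi,\ s{:}(\Box{:}P),\ t{:}(\Box{:}P),\ \Phi \Longrightarrow s\equiv t:P$ with $\Phi$ consisting of equational premises and $\Xi\Longrightarrow P\ \mathsf{type}$ deterministic and object-invertible. Fix a standard type theory, a family $\mathcal{C}$ of computation rules, a family $\mathcal{E}$ of extensionality rules, and for each symbol (and each object metavariable of $\Theta$, treated as a symbol with term arguments) a set of principal arguments. Let the following relations be defined inductively, together with equality checking $\Theta;\Gamma\vdash\mathsf{BB}[e\sim e']$. Equality checking normalizes types and compares them. It compares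 terms by first normalizing their type; if that type matches the type $P$ of a rule in $\mathcal{E}$, by checking the equational premises of such a rule, and otherwise by normalizing both terms and comparing the results. Comparison of normalized expressions is structural, with principal arguments again compared as normalized expressions and the other arguments by $\sim$. All relations pass under abstractions. * $\Theta;\Gamma\vdash\mathcal{B}[s \triangleright_c e']$: some rule $\Xi\Longrightarrow\mathcal{B}'[p\equiv v]$ in $\mathcal{C}$ and some instantiation $I$ of $\Xi$ over $\Theta;\Gamma$ satisfy $I_*p=s$, $e'=I_*v$, and $\Theta;\Gamma\vdash I_*(\mathsf{BB}[d\sim d'])$ for each equational premise $\mathsf{BB}[d\equiv d']$ of $\Xi$. * $\Theta;\Gamma\vdash\mathcal{B}[\mathsf{S}(\vec e)\triangleright_p\mathsf{S}(\vec e')]$: each principal $e_i$ normalizes to $e'_i$ at the boundary which the rule for $\mathsf{S}$ assigns to it (instantiated by $\vec e$), and $e_i=e'_i$ for every other $i$; analogously for metavariable applications. * $\Theta;\Gamma\vdash\mathsf{BB}[e\triangleright e']$ (full normalization): free variables and dummy arguments normalize to themselves; $\{x\}e\triangleright\{x\}e'$ if $e\triangleright e'$ in the context extended by $x$; for an application $e$,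 if $e\triangleright_p e_1$, then $e\triangleright e'$ holds if $e_1\triangleright_c e_2$ and $e_2\triangleright e'$ for some $e_2$, and $e\triangleright e_1$ holds if the left-hand side of no rule in $\mathcal{C}$ matches $e_1$. **Theorem (Soundness of normalization).** Let $\Gamma$ be a derivably well-formed variable context over a derivably well-formed metavariable context $\Theta$, and let $\mathsf{BB}$ be an object boundary (abstracted or not) and $\mathcal{B}$ a non-abstracted object boundary. 1. If $\Theta;\Gamma\vdash\mathsf{BB}[e]$ is derivable and $\Theta;\Gamma\vdash\mathsf{BB}[e\triangleright e']$, then $\Theta;\Gamma\vdash\mathsf{BB}[e\equiv e']$ and $\Theta;\Gamma\vdash\mathsf{BB}[e']$ are derivable. 2. If $\Theta;\Gamma\vdash\mathcal{B}[e]$ is derivable and $\Theta;\Gamma\vdash\mathcal{B}[e\triangleright_p e']$, then $\Theta;\Gamma\vdash\mathcal{B}[e\equiv e']$ and $\Theta;\Gamma\vdash\mathcal{B}[e']$ are derivable. 3. If $\Theta;\Gamma\vdash\mathcal{B}[e]$ is derivable and $\Theta;\Gamma\vdash\mathcal{B}[e\triangleright_c e']$, then $\Theta;\Gamma\vdash\mathcal{B}[e\equiv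 e']$ and $\Theta;\Gamma\vdash\mathcal{B}[e']$ are derivable. -/

import Mathlib

/-!
Finitary type theories in well-scoped form.

Names are replaced by positions.  A variable context with `n` entries declares the variables
`Fin n` (the most recently declared one is `0`); the same de Bruijn indices serve for bound
variables.  A metavariable context with arities `μ` declares the positions `MVar μ` (the most
recently declared one is the head of the list `μ`).  Every expression below is syntactically valid
by construction: symbols and metavariables respect arities, and variables are in scope.
-/

universe u v w x

namespace FTT

/-! ### Syntactic classes, arities, signatures -/

/-- The four syntactic classes: types, terms, type equations, term equations. -/
inductive Cls : Type
  | ty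
  | tm
  | eqTy
  | eqTm

/-- The object classes are those of types and of terms. -/
def Cls.IsObj (c : Cls) : Prop := c = Cls.ty ∨ c = Cls.tm

/-- The class of equations between entities of a given object class
(an equality class is sent to itself; this value is never used). -/
def Cls.eqn : Cls → Cls
  | .ty => .eqTy
  | .tm => .eqTm
  | .eqTy => .eqTy
  | .eqTm => .eqTm

/-- A metavariable arity: a syntactic class and a number of bound variables. -/
structure MArity : Type where
  cls : Cls
  bind : ℕ

/-- `MVar μ α` is the type of positions in the list `μ` which carry the arity `α`. -/
inductive MVar : List MArity → MArity → Type
  | here {α : MArity} {μ : List MArity} : MVar (α :: μ) α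
  | there {α β : MArity} {μ : List MArity} : MVar μ α → MVar (β :: μ) α

/-- A signature: type symbols and term symbols, each with the list of arities of its arguments
(the last argument is the head of the list). -/
structure Signature : Type (u + 1) where
  Sym : Cls → Type u
  isObj : ∀ {c : Cls}, Sym c → c.IsObj
  arity : ∀ {c : Cls}, Sym c → List MArity

/-! ### Expressions -/

/-- `Arg S μ c m n` is the type of arguments of arity `(c, m)`, over metavariables of arities `μ`
and over `n` variables.  For `m = 0` these are the expressions of class `c`. -/
inductive Arg (S : Signature.{u}) (μ : List MArity) : Cls → ℕ → ℕ → Type u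
  | var {n : ℕ} (i : Fin n) : Arg S μ .tm 0 n
  | sym {c : Cls} {n : ℕ} (f : S.Sym c)
      (es : ∀ α : MArity, MVar (S.arity f) α → Arg S μ α.cls α.bind n) : Arg S μ c 0 n
  | mvar {c : Cls} {k n : ℕ} (hc : c.IsObj) (M : MVar μ ⟨c, k⟩)
      (ts : Fin k → Arg S μ .tm 0 n) : Arg S μ c 0 n
  | starTy {n : ℕ} : Arg S μ .eqTy 0 n
  | starTm {n : ℕ} : Arg S μ .eqTm 0 n
  | abs {c : Cls} {m n : ℕ} (e : Arg S μ c m (n + 1)) : Arg S μ c (m + 1) n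

/-- Type expressions. -/
abbrev Ty (S : Signature.{u}) (μ : List MArity) (n : ℕ) : Type u := Arg S μ .ty 0 n

/-- Term expressions. -/
abbrev Tm (S : Signature.{u}) (μ : List MArity) (n : ℕ) : Type u := Arg S μ .tm 0 n

/-- An instantiation of metavariables of arities `ν` by arguments over `μ` and `n` variables. -/
abbrev Inst (S : Signature.{u}) (ν μ : List MArity) (n : ℕ) : Type u :=
  ∀ α : MArity, MVar ν α → Arg S μ α.cls α.bind n

/-- Extension of a renaming of variables under a binder. -/
def liftRen {n k : ℕ} (ρ : Fin n → Fin k) : Fin (n + 1) → Fin (k + 1) :=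
  Fin.cases 0 (fun i => (ρ i).succ)

/-- Renaming of variables. -/
def Arg.rename {S : Signature.{u}} {μ : List MArity} :
    {c : Cls} → {m n k : ℕ} → (Fin n → Fin k) → Arg S μ c m n → Arg S μ c m k
  | _, _, _, _, ρ, .var i => .var (ρ i)
  | _, _, _, _, ρ, .sym f es => .sym f (fun α M => (es α M).rename ρ)
  | _, _, _, _, ρ, .mvar hc M ts => .mvar hc M (fun j => (ts j).rename ρ)
  | _, _, _, _, _, .starTy => .starTy
  | _, _, _, _, _, .starTm => .starTm
  | _, _, _, _, ρ, .abs e => .abs (e.rename (liftRen ρ))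

/-- Extension of a substitution under a binder. -/
def liftSub {S : Signature.{u}} {μ : List MArity} {n k : ℕ} (σ : Fin n → Tm S μ k) :
    Fin (n + 1) → Tm S μ (k + 1) :=
  Fin.cases (.var 0) (fun i => (σ i).rename Fin.succ)

/-- Simultaneous capture-avoiding substitution of terms for variables. -/
def Arg.subst {S : Signature.{u}} {μ : List MArity} :
    {c : Cls} → {m n k : ℕ} → (Fin n → Tm S μ k) → Arg S μ c m n → Arg S μ c m k
  | _, _, _, _, σ, .var i => σ i
  | _, _, _, _, σ, .sym f es => .sym f (fun α M => (es α M).subst σ)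
  | _, _, _, _, σ, .mvar hc M ts => .mvar hc M (fun j => (ts j).subst σ)
  | _, _, _, _, _, .starTy => .starTy
  | _, _, _, _, _, .starTm => .starTm
  | _, _, _, _, σ, .abs e => .abs (e.subst (liftSub σ))

/-- Renaming of metavariables. -/
def Arg.mrename {S : Signature.{u}} {μ ν : List MArity} (ρ : ∀ α : MArity, MVar μ α → MVar ν α) :
    {c : Cls} → {m n : ℕ} → Arg S μ c m n → Arg S ν c m n
  | _, _, _, .var i => .var i
  | _, _, _, .sym f es => .sym f (fun α M => (es α M).mrename ρ)
  | _, _, _, .mvar hc M ts => .mvar hc (ρ _ M) (fun j => (ts j).mrename ρ)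
  | _, _, _, .starTy => .starTy
  | _, _, _, .starTm => .starTm
  | _, _, _, .abs e => .abs (e.mrename ρ)

/-- The body of an abstraction. -/
def Arg.body {S : Signature.{u}} {μ : List MArity} {c : Cls} {m n : ℕ} :
    Arg S μ c (m + 1) n → Arg S μ c m (n + 1)
  | .abs e => e

/-- `e.instAux σ ts` strips the abstractions of `e = {x₁} ⋯ {xₘ} b`, substitutes `ts` for
`x₁, …, xₘ`, and applies `σ` to the remaining variables. -/
def Arg.instAux {S : Signature.{u}} {μ : List MArity} {c : Cls} {k : ℕ} :
    {m n : ℕ} → Arg S μ c m n → (Fin n → Tm S μ k) → (Fin m → Tm S μ k) → Arg S μ c 0 k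
  | 0, _, e, σ, _ => e.subst σ
  | _ + 1, _, e, σ, ts => e.body.instAux (Fin.cases (ts 0) σ) (fun j => ts j.succ)

/-- `b[ts/xs]` for `e = {x₁} ⋯ {xₘ} b`. -/
def Arg.inst {S : Signature.{u}} {μ : List MArity} {c : Cls} {m n : ℕ} (e : Arg S μ c m n)
    (ts : Fin m → Tm S μ n) : Arg S μ c 0 n :=
  e.instAux Arg.var ts

/-- Weakening of an instantiation by one variable. -/
def Inst.wk {S : Signature.{u}} {ν μ : List MArity} {n : ℕ} (I : Inst S ν μ n) :
    Inst S ν μ (n + 1) :=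
  fun α M => (I α M).rename Fin.succ

/-- The action of an instantiation on arguments. -/
def Arg.act {S : Signature.{u}} {ν μ : List MArity} :
    {c : Cls} → {m n : ℕ} → Inst S ν μ n → Arg S ν c m n → Arg S μ c m n
  | _, _, _, _, .var i => .var i
  | _, _, _, I, .sym f es => .sym f (fun α M => (es α M).act I)
  | _, _, _, I, .mvar _ M ts => (I _ M).inst (fun j => (ts j).act I)
  | _, _, _, _, .starTy => .starTy
  | _, _, _, _, .starTm => .starTm
  | _, _, _, I, .abs e => .abs (e.act I.wk)

/-- The action of an instantiation over `n` variables on an argument without free variables. -/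
def Arg.actC {S : Signature.{u}} {ν μ : List MArity} {c : Cls} {m n : ℕ} (I : Inst S ν μ n)
    (e : Arg S ν c m 0) : Arg S μ c m n :=
  (e.rename Fin.elim0).act I

/-- The dummy argument `{x₁} ⋯ {xₘ} ⋆` of the class of equations between entities of class `c`. -/
def Arg.dummy {S : Signature.{u}} {μ : List MArity} (c : Cls) :
    (m : ℕ) → {n : ℕ} → Arg S μ c.eqn m n
  | 0, _ => match c with
    | .ty => .starTy
    | .tm => .starTm
    | .eqTy => .starTy
    | .eqTm => .starTm
  | m + 1, _ => .abs (Arg.dummy c m)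

/-- The head `M(t₁, …, tₖ)`; it is a dummy when `M` is an equality metavariable. -/
def Arg.mapp {S : Signature.{u}} {μ : List MArity} {n k : ℕ} :
    {c : Cls} → MVar μ ⟨c, k⟩ → (Fin k → Tm S μ n) → Arg S μ c 0 n
  | .ty, M, ts => .mvar (Or.inl rfl) M ts
  | .tm, M, ts => .mvar (Or.inr rfl) M ts
  | .eqTy, _, _ => .starTy
  | .eqTm, _, _ => .starTm

/-- Iterated abstraction, given as a function of the abstracted variables and of the renaming
which weakens the outer variables. -/
def Arg.abstract {S : Signature.{u}} {μ : List MArity} {c : Cls} :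
    (m : ℕ) → {n : ℕ} → (∀ k : ℕ, (Fin m → Tm S μ k) → (Fin n → Fin k) → Arg S μ c 0 k) →
      Arg S μ c m n
  | 0, n, F => F n Fin.elim0 id
  | m + 1, _, F => .abs (Arg.abstract m
      (fun k ts ρ => F k (Fin.cases (.var (ρ 0)) ts) (fun i => ρ i.succ)))

/-- The generic application `{x₁} ⋯ {xₖ} M(x₁, …, xₖ)`, respectively `{x₁} ⋯ {xₖ} ⋆` when `M` is an
equality metavariable. -/
def genApp (S : Signature.{u}) {μ : List MArity} {n : ℕ} (α : MArity) (M : MVar μ α) :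
    Arg S μ α.cls α.bind n :=
  Arg.abstract α.bind (fun _ ts _ => Arg.mapp M ts)

/-! ### Boundaries -/

/-- Abstracted boundaries of arity `(c, m)`; those with `m = 0` are the boundary theses. -/
inductive Bdry (S : Signature.{u}) (μ : List MArity) : Cls → ℕ → ℕ → Type u
  | ty {n : ℕ} : Bdry S μ .ty 0 n
  | tm {n : ℕ} (A : Ty S μ n) : Bdry S μ .tm 0 n
  | eqTy {n : ℕ} (A B : Ty S μ n) : Bdry S μ .eqTy 0 n
  | eqTm {n : ℕ} (s t : Tm S μ n) (A : Ty S μ n) : Bdry S μ .eqTm 0 n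
  | abs {c : Cls} {m n : ℕ} (A : Ty S μ n) (BB : Bdry S μ c m (n + 1)) : Bdry S μ c (m + 1) n

/-- Renaming of variables in a boundary. -/
def Bdry.rename {S : Signature.{u}} {μ : List MArity} :
    {c : Cls} → {m n k : ℕ} → (Fin n → Fin k) → Bdry S μ c m n → Bdry S μ c m k
  | _, _, _, _, _, .ty => .ty
  | _, _, _, _, ρ, .tm A => .tm (A.rename ρ)
  | _, _, _, _, ρ, .eqTy A B => .eqTy (A.rename ρ) (B.rename ρ)
  | _, _, _, _, ρ, .eqTm s t A => .eqTm (s.rename ρ) (t.rename ρ) (A.rename ρ)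
  | _, _, _, _, ρ, .abs A BB => .abs (A.rename ρ) (BB.rename (liftRen ρ))

/-- Renaming of metavariables in a boundary. -/
def Bdry.mrename {S : Signature.{u}} {μ ν : List MArity}
    (ρ : ∀ α : MArity, MVar μ α → MVar ν α) :
    {c : Cls} → {m n : ℕ} → Bdry S μ c m n → Bdry S ν c m n
  | _, _, _, .ty => .ty
  | _, _, _, .tm A => .tm (A.mrename ρ)
  | _, _, _, .eqTy A B => .eqTy (A.mrename ρ) (B.mrename ρ)
  | _, _, _, .eqTm s t A => .eqTm (s.mrename ρ) (t.mrename ρ) (A.mrename ρ)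
  | _, _, _, .abs A BB => .abs (A.mrename ρ) (BB.mrename ρ)

/-- The action of an instantiation on boundaries. -/
def Bdry.act {S : Signature.{u}} {ν μ : List MArity} :
    {c : Cls} → {m n : ℕ} → Inst S ν μ n → Bdry S ν c m n → Bdry S μ c m n
  | _, _, _, _, .ty => .ty
  | _, _, _, I, .tm A => .tm (A.act I)
  | _, _, _, I, .eqTy A B => .eqTy (A.act I) (B.act I)
  | _, _, _, I, .eqTm s t A => .eqTm (s.act I) (t.act I) (A.act I)
  | _, _, _, I, .abs A BB => .abs (A.act I) (BB.act I.wk)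

/-- The action of an instantiation over `n` variables on a boundary without free variables. -/
def Bdry.actC {S : Signature.{u}} {ν μ : List MArity} {c : Cls} {m n : ℕ} (I : Inst S ν μ n)
    (BB : Bdry S ν c m 0) : Bdry S μ c m n :=
  (BB.rename Fin.elim0).act I

/-- For `BB = {x₁ : A₁} ⋯ {xₘ : Aₘ} B`, the boundary thesis `B[ts/xs]`, where `σ` is applied to the
remaining variables. -/
def Bdry.instAux {S : Signature.{u}} {μ : List MArity} {k : ℕ} :
    {c : Cls} → {m n : ℕ} → Bdry S μ c m n → (Fin n → Tm S μ k) → (Fin m → Tm S μ k) →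
      Bdry S μ c 0 k
  | _, _, _, .ty, _, _ => .ty
  | _, _, _, .tm A, σ, _ => .tm (A.subst σ)
  | _, _, _, .eqTy A B, σ, _ => .eqTy (A.subst σ) (B.subst σ)
  | _, _, _, .eqTm s t A, σ, _ => .eqTm (s.subst σ) (t.subst σ) (A.subst σ)
  | _, _, _, .abs _ BB, σ, ts => BB.instAux (Fin.cases (ts 0) σ) (fun j => ts j.succ)

/-- For `BB = {x₁ : A₁} ⋯ {xₘ : Aₘ} B`, the types `Aⱼ[t₁/x₁, …, tⱼ₋₁/xⱼ₋₁]`, where `σ` is applied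
to the remaining variables. -/
def Bdry.argTyAux {S : Signature.{u}} {μ : List MArity} {k : ℕ} :
    {c : Cls} → {m n : ℕ} → Bdry S μ c m n → (Fin n → Tm S μ k) → (Fin m → Tm S μ k) →
      Fin m → Ty S μ k
  | _, 0, _, _, _, _ => Fin.elim0
  | _, _ + 1, _, .abs A BB, σ, ts =>
      Fin.cases (A.subst σ) (BB.argTyAux (Fin.cases (ts 0) σ) (fun j => ts j.succ))

/-- `B[ts/xs]` for a boundary `{x₁ : A₁} ⋯ {xₘ : Aₘ} B` without free variables. -/
def Bdry.inst {S : Signature.{u}} {μ : List MArity} {c : Cls} {m n : ℕ} (BB : Bdry S μ c m 0)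
    (ts : Fin m → Tm S μ n) : Bdry S μ c 0 n :=
  BB.instAux Fin.elim0 ts

/-- `Aⱼ[t₁/x₁, …, tⱼ₋₁/xⱼ₋₁]` for a boundary `{x₁ : A₁} ⋯ {xₘ : Aₘ} B` without free variables. -/
def Bdry.argTy {S : Signature.{u}} {μ : List MArity} {c : Cls} {m n : ℕ} (BB : Bdry S μ c m 0)
    (ts : Fin m → Tm S μ n) (j : Fin m) : Ty S μ n :=
  BB.argTyAux Fin.elim0 ts j

/-- The type `A` of a term boundary `□ : A`. -/
def Bdry.type {S : Signature.{u}} {μ : List MArity} {n : ℕ} : Bdry S μ .tm 0 n → Ty S μ n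
  | .tm A => A

/-- The equation boundary `BB[e₁ ≡ e₂ by □]` obtained from an object boundary `BB`
(an equality boundary is returned unchanged; this value is never used). -/
def Bdry.eqn {S : Signature.{u}} {μ : List MArity} :
    {c : Cls} → {m n : ℕ} → Bdry S μ c m n → Arg S μ c m n → Arg S μ c m n → Bdry S μ c.eqn m n
  | _, _, _, .ty, A, B => .eqTy A B
  | _, _, _, .tm A, s, t => .eqTm s t A
  | _, _, _, .eqTy A B, _, _ => .eqTy A B
  | _, _, _, .eqTm s t A, _, _ => .eqTm s t A
  | _, _, _, .abs A BB, e₁, e₂ => .abs A (BB.eqn e₁.body e₂.body)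

/-! ### Contexts -/

/-- Variable contexts. -/
inductive Ctx (S : Signature.{u}) (μ : List MArity) : ℕ → Type u
  | nil : Ctx S μ 0
  | snoc {n : ℕ} (Γ : Ctx S μ n) (A : Ty S μ n) : Ctx S μ (n + 1)

/-- The type of a variable in a variable context. -/
def Ctx.get {S : Signature.{u}} {μ : List MArity} : {n : ℕ} → Ctx S μ n → Fin n → Ty S μ n
  | 0, _ => Fin.elim0
  | _ + 1, .snoc Γ A => Fin.cases (A.rename Fin.succ) (fun i => (Γ.get i).rename Fin.succ)

/-- Metavariable contexts: each boundary is without free variables and refers only to the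
metavariables before it. -/
inductive MCtx (S : Signature.{u}) : List MArity → Type u
  | nil : MCtx S []
  | snoc {μ : List MArity} {α : MArity} (Θ : MCtx S μ) (BB : Bdry S μ α.cls α.bind 0) :
      MCtx S (α :: μ)

/-- The boundary of a metavariable, weakened to the whole metavariable context. -/
def MCtx.get {S : Signature.{u}} : {μ : List MArity} → MCtx S μ → {α : MArity} → MVar μ α →
    Bdry S μ α.cls α.bind 0
  | _, .snoc _ BB, _, .here => BB.mrename (fun _ => MVar.there)
  | _, .snoc Θ _, _, .there M => (Θ.get M).mrename (fun _ => MVar.there)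

/-! ### Judgements, rules, raw type theories -/

/-- Abstracted judgements and abstracted boundaries.  A judgement is a boundary together with
the head which fills it: `judg BB e` is `BB[e]`. -/
inductive Stmt (S : Signature.{u}) (μ : List MArity) (c : Cls) (m n : ℕ) : Type u
  | judg (BB : Bdry S μ c m n) (e : Arg S μ c m n) : Stmt S μ c m n
  | bdry (BB : Bdry S μ c m n) : Stmt S μ c m n

/-- The judgement `BB[e₁ ≡ e₂]`, for an object boundary `BB`. -/
def Stmt.eqn {S : Signature.{u}} {μ : List MArity} {c : Cls} {m n : ℕ} (BB : Bdry S μ c m n)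
    (e₁ e₂ : Arg S μ c m n) : Stmt S μ c.eqn m n :=
  .judg (BB.eqn e₁ e₂) (Arg.dummy c m)

/-- A raw rule `Ξ ⟹ B[e]` whose conclusion is of class `c`. -/
structure RawRule (S : Signature.{u}) (c : Cls) : Type u where
  ar : List MArity
  prem : MCtx S ar
  bdry : Bdry S ar c 0 0
  head : Arg S ar c 0 0

/-- A raw type theory: a family of raw rules, sorted by the class of the conclusion. -/
structure RawTheory (S : Signature.{u}) : Type (max u (v + 1)) where
  Idx : Cls → Type v
  rule : ∀ {c : Cls}, Idx c → RawRule S c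

/-- The deductive system associated with a raw type theory: `T.Derives Θ Γ J` says that `Θ; Γ ⊢ J`
is derivable.  In the rules `I` instantiates all premises `Ξ = [M₁ : BB₁, …]` of a raw rule; since
`BBᵢ` only mentions metavariables before `Mᵢ`, acting on it by `I` and by the initial segment of
`I` before `Mᵢ` is the same. -/
inductive RawTheory.Derives {S : Signature.{u}} (T : RawTheory.{u, v} S) {μ : List MArity}
    (Θ : MCtx S μ) : {n : ℕ} → Ctx S μ n → {c : Cls} → {m : ℕ} → Stmt S μ c m n → Prop
  -- variables, metavariables, abstraction
  | var {n : ℕ} {Γ : Ctx S μ n} (a : Fin n) :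
      T.Derives Θ Γ (.judg (.tm (Γ.get a)) (.var a))
  | mvar {n : ℕ} {Γ : Ctx S μ n} {c : Cls} {k : ℕ} (M : MVar μ ⟨c, k⟩) (ts : Fin k → Tm S μ n) :
      (∀ j, T.Derives Θ Γ (.judg (.tm ((Θ.get M).argTy ts j)) (ts j))) →
      T.Derives Θ Γ (.bdry ((Θ.get M).inst ts)) →
      T.Derives Θ Γ (.judg ((Θ.get M).inst ts) (Arg.mapp M ts))
  | mvarCongrTy {n : ℕ} {Γ : Ctx S μ n} {k : ℕ} (M : MVar μ ⟨.ty, k⟩) (ss ts : Fin k → Tm S μ n) :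
      (∀ j, T.Derives Θ Γ (.judg (.tm ((Θ.get M).argTy ss j)) (ss j))) →
      (∀ j, T.Derives Θ Γ (.judg (.tm ((Θ.get M).argTy ts j)) (ts j))) →
      (∀ j, T.Derives Θ Γ (.judg (.eqTm (ss j) (ts j) ((Θ.get M).argTy ss j)) .starTm)) →
      T.Derives Θ Γ (.judg (.eqTy (Arg.mapp M ss) (Arg.mapp M ts)) .starTy)
  | mvarCongrTm {n : ℕ} {Γ : Ctx S μ n} {k : ℕ} (M : MVar μ ⟨.tm, k⟩) (ss ts : Fin k → Tm S μ n) :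
      (∀ j, T.Derives Θ Γ (.judg (.tm ((Θ.get M).argTy ss j)) (ss j))) →
      (∀ j, T.Derives Θ Γ (.judg (.tm ((Θ.get M).argTy ts j)) (ts j))) →
      (∀ j, T.Derives Θ Γ (.judg (.eqTm (ss j) (ts j) ((Θ.get M).argTy ss j)) .starTm)) →
      T.Derives Θ Γ
        (.judg (.eqTy ((Θ.get M).inst ss).type ((Θ.get M).inst ts).type) .starTy) →
      T.Derives Θ Γ
        (.judg (.eqTm (Arg.mapp M ss) (Arg.mapp M ts) ((Θ.get M).inst ss).type) .starTm)
  | abs {n : ℕ} {Γ : Ctx S μ n} {c : Cls} {m : ℕ} {A : Ty S μ n} {BB : Bdry S μ c m (n + 1)}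
      {e : Arg S μ c m (n + 1)} :
      T.Derives Θ Γ (.judg .ty A) →
      T.Derives Θ (Γ.snoc A) (.judg BB e) →
      T.Derives Θ Γ (.judg (.abs A BB) (.abs e))
  -- equality rules
  | tyRefl {n : ℕ} {Γ : Ctx S μ n} {A : Ty S μ n} :
      T.Derives Θ Γ (.judg .ty A) →
      T.Derives Θ Γ (.judg (.eqTy A A) .starTy)
  | tySym {n : ℕ} {Γ : Ctx S μ n} {A B : Ty S μ n} :
      T.Derives Θ Γ (.judg (.eqTy A B) .starTy) →
      T.Derives Θ Γ (.judg (.eqTy B A) .starTy)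
  | tyTran {n : ℕ} {Γ : Ctx S μ n} {A B C : Ty S μ n} :
      T.Derives Θ Γ (.judg (.eqTy A B) .starTy) →
      T.Derives Θ Γ (.judg (.eqTy B C) .starTy) →
      T.Derives Θ Γ (.judg (.eqTy A C) .starTy)
  | tmRefl {n : ℕ} {Γ : Ctx S μ n} {t : Tm S μ n} {A : Ty S μ n} :
      T.Derives Θ Γ (.judg (.tm A) t) →
      T.Derives Θ Γ (.judg (.eqTm t t A) .starTm)
  | tmSym {n : ℕ} {Γ : Ctx S μ n} {s t : Tm S μ n} {A : Ty S μ n} :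
      T.Derives Θ Γ (.judg (.eqTm s t A) .starTm) →
      T.Derives Θ Γ (.judg (.eqTm t s A) .starTm)
  | tmTran {n : ℕ} {Γ : Ctx S μ n} {s t r : Tm S μ n} {A : Ty S μ n} :
      T.Derives Θ Γ (.judg (.eqTm s t A) .starTm) →
      T.Derives Θ Γ (.judg (.eqTm t r A) .starTm) →
      T.Derives Θ Γ (.judg (.eqTm s r A) .starTm)
  | convTm {n : ℕ} {Γ : Ctx S μ n} {t : Tm S μ n} {A B : Ty S μ n} :
      T.Derives Θ Γ (.judg (.tm A) t) →
      T.Derives Θ Γ (.judg (.eqTy A B) .starTy) →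
      T.Derives Θ Γ (.judg (.tm B) t)
  | convEq {n : ℕ} {Γ : Ctx S μ n} {s t : Tm S μ n} {A B : Ty S μ n} :
      T.Derives Θ Γ (.judg (.eqTm s t A) .starTm) →
      T.Derives Θ Γ (.judg (.eqTy A B) .starTy) →
      T.Derives Θ Γ (.judg (.eqTm s t B) .starTm)
  -- well-formed boundaries
  | bdryTy {n : ℕ} {Γ : Ctx S μ n} :
      T.Derives Θ Γ (.bdry .ty)
  | bdryTm {n : ℕ} {Γ : Ctx S μ n} {A : Ty S μ n} :
      T.Derives Θ Γ (.judg .ty A) →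
      T.Derives Θ Γ (.bdry (.tm A))
  | bdryEqTy {n : ℕ} {Γ : Ctx S μ n} {A B : Ty S μ n} :
      T.Derives Θ Γ (.judg .ty A) →
      T.Derives Θ Γ (.judg .ty B) →
      T.Derives Θ Γ (.bdry (.eqTy A B))
  | bdryEqTm {n : ℕ} {Γ : Ctx S μ n} {s t : Tm S μ n} {A : Ty S μ n} :
      T.Derives Θ Γ (.judg .ty A) →
      T.Derives Θ Γ (.judg (.tm A) s) →
      T.Derives Θ Γ (.judg (.tm A) t) →
      T.Derives Θ Γ (.bdry (.eqTm s t A))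
  | bdryAbs {n : ℕ} {Γ : Ctx S μ n} {c : Cls} {m : ℕ} {A : Ty S μ n}
      {BB : Bdry S μ c m (n + 1)} :
      T.Derives Θ Γ (.judg .ty A) →
      T.Derives Θ (Γ.snoc A) (.bdry BB) →
      T.Derives Θ Γ (.bdry (.abs A BB))
  -- instantiations of the specific rules
  | rule {n : ℕ} {Γ : Ctx S μ n} {c : Cls} (i : T.Idx c) (I : Inst S (T.rule i).ar μ n) :
      (∀ (α : MArity) (M : MVar (T.rule i).ar α),
        T.Derives Θ Γ (.judg (((T.rule i).prem.get M).actC I) (I α M))) →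
      T.Derives Θ Γ (.bdry ((T.rule i).bdry.actC I)) →
      T.Derives Θ Γ (.judg ((T.rule i).bdry.actC I) ((T.rule i).head.actC I))
  -- congruence rules of the specific object rules
  | congrTy {n : ℕ} {Γ : Ctx S μ n} (i : T.Idx .ty) (I J : Inst S (T.rule i).ar μ n) :
      (∀ (α : MArity) (M : MVar (T.rule i).ar α),
        T.Derives Θ Γ (.judg (((T.rule i).prem.get M).actC I) (I α M))) →
      (∀ (α : MArity) (M : MVar (T.rule i).ar α),
        T.Derives Θ Γ (.judg (((T.rule i).prem.get M).actC J) (J α M))) →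
      (∀ (α : MArity) (M : MVar (T.rule i).ar α), α.cls.IsObj →
        T.Derives Θ Γ (.eqn (((T.rule i).prem.get M).actC I) (I α M) (J α M))) →
      T.Derives Θ Γ
        (.judg (.eqTy ((T.rule i).head.actC I) ((T.rule i).head.actC J)) .starTy)
  | congrTm {n : ℕ} {Γ : Ctx S μ n} (i : T.Idx .tm) (I J : Inst S (T.rule i).ar μ n) :
      (∀ (α : MArity) (M : MVar (T.rule i).ar α),
        T.Derives Θ Γ (.judg (((T.rule i).prem.get M).actC I) (I α M))) →
      (∀ (α : MArity) (M : MVar (T.rule i).ar α),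
        T.Derives Θ Γ (.judg (((T.rule i).prem.get M).actC J) (J α M))) →
      (∀ (α : MArity) (M : MVar (T.rule i).ar α), α.cls.IsObj →
        T.Derives Θ Γ (.eqn (((T.rule i).prem.get M).actC I) (I α M) (J α M))) →
      T.Derives Θ Γ
        (.judg (.eqTy ((T.rule i).bdry.actC I).type ((T.rule i).bdry.actC J).type) .starTy) →
      T.Derives Θ Γ
        (.judg (.eqTm ((T.rule i).head.actC I) ((T.rule i).head.actC J)
          ((T.rule i).bdry.actC I).type) .starTm)

/-- Well-formed metavariable contexts: `⊢ Θ mctx`. -/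
inductive RawTheory.WfMCtx {S : Signature.{u}} (T : RawTheory.{u, v} S) :
    {μ : List MArity} → MCtx S μ → Prop
  | nil : T.WfMCtx MCtx.nil
  | snoc {μ : List MArity} {α : MArity} {Θ : MCtx S μ} {BB : Bdry S μ α.cls α.bind 0} :
      T.WfMCtx Θ → T.Derives Θ Ctx.nil (.bdry BB) → T.WfMCtx (Θ.snoc BB)

/-- Well-formed variable contexts over a well-formed metavariable context: `Θ ⊢ Γ vctx`. -/
inductive RawTheory.WfCtx {S : Signature.{u}} (T : RawTheory.{u, v} S) {μ : List MArity}
    (Θ : MCtx S μ) : {n : ℕ} → Ctx S μ n → Prop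
  | nil : T.WfMCtx Θ → T.WfCtx Θ Ctx.nil
  | snoc {n : ℕ} {Γ : Ctx S μ n} {A : Ty S μ n} :
      T.WfCtx Θ Γ → T.Derives Θ Γ (.judg .ty A) → T.WfCtx Θ (Γ.snoc A)

/-- A derivable instantiation of `Ξ` over `Θ; Γ`. -/
def RawTheory.DerivableInst {S : Signature.{u}} (T : RawTheory.{u, v} S) {ν μ : List MArity}
    {n : ℕ} (Ξ : MCtx S ν) (Θ : MCtx S μ) (Γ : Ctx S μ n) (I : Inst S ν μ n) : Prop :=
  ∀ (α : MArity) (M : MVar ν α), T.Derives Θ Γ (.judg ((Ξ.get M).actC I) (I α M))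

/-- A derivable raw rule. -/
def RawTheory.DerivableRule {S : Signature.{u}} (T : RawTheory.{u, v} S) {c : Cls}
    (R : RawRule S c) : Prop :=
  T.Derives R.prem Ctx.nil (.judg R.bdry R.head)

/-- A finitary rule: its premises and the boundary of its conclusion are well-formed. -/
def RawTheory.FinitaryRule {S : Signature.{u}} (T : RawTheory.{u, v} S) {c : Cls}
    (R : RawRule S c) : Prop :=
  T.WfMCtx R.prem ∧ T.Derives R.prem Ctx.nil (.bdry R.bdry)

/-- A finitary type theory. -/
def RawTheory.IsFinitary {S : Signature.{u}} (T : RawTheory.{u, v} S) : Prop :=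
  ∀ (c : Cls) (i : T.Idx c), T.FinitaryRule (T.rule i)

/-- The symbol rule `Ξ ⟹ B[f(M̂₁, …, M̂ₙ)]` of a symbol `f`. -/
def symbolRule {S : Signature.{u}} {c : Cls} (f : S.Sym c) (Ξ : MCtx S (S.arity f))
    (B : Bdry S (S.arity f) c 0 0) : RawRule S c where
  ar := S.arity f
  prem := Ξ
  bdry := B
  head := .sym f (genApp S)

/-- `Ξ ⟹ B[f(M̂₁, …, M̂ₙ)]` is a specific rule of the theory, associated with `f`. -/
def RawTheory.IsRuleFor {S : Signature.{u}} (T : RawTheory.{u, v} S) {c : Cls} (f : S.Sym c)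
    (Ξ : MCtx S (S.arity f)) (B : Bdry S (S.arity f) c 0 0) : Prop :=
  ∃ i : T.Idx c, T.rule i = symbolRule f Ξ B

/-- A standard type theory: a finitary type theory whose specific object rules are symbol rules,
such that each symbol has precisely one associated rule. -/
structure RawTheory.IsStandard {S : Signature.{u}} (T : RawTheory.{u, v} S) : Prop where
  finitary : T.IsFinitary
  isSymbolRule : ∀ (c : Cls) (i : T.Idx c), c.IsObj →
    ∃ (f : S.Sym c) (Ξ : MCtx S (S.arity f)) (B : Bdry S (S.arity f) c 0 0),
      T.rule i = symbolRule f Ξ B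
  existsUnique : ∀ (c : Cls) (f : S.Sym c), ∃! i : T.Idx c,
    ∃ (Ξ : MCtx S (S.arity f)) (B : Bdry S (S.arity f) c 0 0), T.rule i = symbolRule f Ξ B

/-- `A` is the natural type of a term with respect to `Θ; Γ`.  In a standard type theory every term
has precisely one. -/
inductive RawTheory.NaturalType {S : Signature.{u}} (T : RawTheory.{u, v} S) {μ : List MArity}
    (Θ : MCtx S μ) {n : ℕ} (Γ : Ctx S μ n) : Tm S μ n → Ty S μ n → Prop
  | var (a : Fin n) : T.NaturalType Θ Γ (.var a) (Γ.get a)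
  | mvar {k : ℕ} (hc : Cls.tm.IsObj) (M : MVar μ ⟨.tm, k⟩) (ts : Fin k → Tm S μ n) :
      T.NaturalType Θ Γ (.mvar hc M ts) ((Θ.get M).inst ts).type
  | sym (f : S.Sym .tm) (es : Inst S (S.arity f) μ n) (Ξ : MCtx S (S.arity f))
      (B : Bdry S (S.arity f) .tm 0 0) (h : T.IsRuleFor f Ξ B) :
      T.NaturalType Θ Γ (.sym f es) (B.actC es).type

/-! ### Deterministic and object-invertible rules -/

/-- A deterministic rule: every judgement has at most one matching instantiation. -/
def RawRule.Deterministic {S : Signature.{u}} {c : Cls} (R : RawRule S c) : Prop :=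
  ∀ (μ : List MArity) (_ : MCtx S μ) (n : ℕ) (_ : Ctx S μ n)
    (BB : Bdry S μ c 0 n) (e : Arg S μ c 0 n) (I J : Inst S R.ar μ n),
    (R.bdry.actC I = BB ∧ R.head.actC I = e) →
    (R.bdry.actC J = BB ∧ R.head.actC J = e) → I = J

/-- The arities of the equational residue: `μ` extended by the equality arities in `ν`. -/
def resAr (μ : List MArity) : List MArity → List MArity
  | [] => μ
  | ⟨.ty, _⟩ :: ν => resAr μ ν
  | ⟨.tm, _⟩ :: ν => resAr μ ν
  | ⟨.eqTy, k⟩ :: ν => ⟨.eqTy, k⟩ :: resAr μ ν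
  | ⟨.eqTm, k⟩ :: ν => ⟨.eqTm, k⟩ :: resAr μ ν

/-- The inclusion of the metavariables of `μ` in those of the residue. -/
def resIncl {μ : List MArity} : (ν : List MArity) → (α : MArity) → MVar μ α → MVar (resAr μ ν) α
  | [], _, M => M
  | ⟨.ty, _⟩ :: ν, α, M => resIncl ν α M
  | ⟨.tm, _⟩ :: ν, α, M => resIncl ν α M
  | ⟨.eqTy, _⟩ :: ν, α, M => .there (resIncl ν α M)
  | ⟨.eqTm, _⟩ :: ν, α, M => .there (resIncl ν α M)

/-- The equational residue: `Θ` extended by the instantiated equational premises of `Ξ`. -/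
def residue {S : Signature.{u}} {μ : List MArity} (Θ : MCtx S μ) :
    {ν : List MArity} → MCtx S ν → Inst S ν μ 0 → MCtx S (resAr μ ν)
  | _, .nil, _ => Θ
  | ⟨.ty, _⟩ :: ν, .snoc Ξ _, I => residue (ν := ν) Θ Ξ (fun α M => I α M.there)
  | ⟨.tm, _⟩ :: ν, .snoc Ξ _, I => residue (ν := ν) Θ Ξ (fun α M => I α M.there)
  | ⟨.eqTy, k⟩ :: ν, .snoc Ξ BB, I =>
      .snoc (α := ⟨.eqTy, k⟩) (residue (ν := ν) Θ Ξ (fun α M => I α M.there))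
        ((BB.actC (fun α M => I α M.there)).mrename (resIncl ν))
  | ⟨.eqTm, k⟩ :: ν, .snoc Ξ BB, I =>
      .snoc (α := ⟨.eqTm, k⟩) (residue (ν := ν) Θ Ξ (fun α M => I α M.there))
        ((BB.actC (fun α M => I α M.there)).mrename (resIncl ν))

/-- The residual instantiation: `I` on object metavariables, and the generic application on equality
metavariables, which is the dummy argument. -/
def residualInst {S : Signature.{u}} {ν μ : List MArity} (I : Inst S ν μ 0) :
    Inst S ν (resAr μ ν) 0
  | ⟨.ty, k⟩, M => (I ⟨.ty, k⟩ M).mrename (resIncl ν)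
  | ⟨.tm, k⟩, M => (I ⟨.tm, k⟩ M).mrename (resIncl ν)
  | ⟨.eqTy, k⟩, _ => Arg.dummy .ty k
  | ⟨.eqTm, k⟩, _ => Arg.dummy .tm k

/-- An object-invertible rule. -/
def RawTheory.ObjectInvertible {S : Signature.{u}} (T : RawTheory.{u, v} S) {c : Cls}
    (R : RawRule S c) : Prop :=
  T.DerivableRule R ∧
  ∀ (μ : List MArity) (Θ : MCtx S μ) (I : Inst S R.ar μ 0), T.WfMCtx Θ →
    T.Derives Θ Ctx.nil (.judg (R.bdry.actC I) (R.head.actC I)) →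
    T.DerivableInst R.prem (residue Θ R.prem I) Ctx.nil (residualInst I)

/-! ### Computation rules and extensionality rules -/

/-- The data of an equation `Ξ ⟹ B[p ≡ v]`, oriented from left to right. -/
structure Rewrite (S : Signature.{u}) (c : Cls) : Type u where
  ar : List MArity
  prem : MCtx S ar
  bdry : Bdry S ar c 0 0
  lhs : Arg S ar c 0 0
  rhs : Arg S ar c 0 0

/-- The raw rule `Ξ ⟹ B[p ≡ v]`. -/
def Rewrite.rule {S : Signature.{u}} {c : Cls} (R : Rewrite S c) : RawRule S c.eqn where
  ar := R.ar
  prem := R.prem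
  bdry := R.bdry.eqn R.lhs R.rhs
  head := Arg.dummy c 0

/-- Type computation rules and term computation rules. -/
def RawTheory.IsComputationRule {S : Signature.{u}} (T : RawTheory.{u, v} S) :
    {c : Cls} → Rewrite S c → Prop
  | .ty, R =>
      T.DerivableRule R.rule ∧ T.FinitaryRule R.rule ∧
      (RawRule.mk R.ar R.prem .ty R.lhs).Deterministic ∧
      T.ObjectInvertible (RawRule.mk R.ar R.prem .ty R.lhs)
  | .tm, R =>
      T.DerivableRule R.rule ∧ T.FinitaryRule R.rule ∧
      (∃ (f : S.Sym .tm) (es : Inst S (S.arity f) R.ar 0), R.lhs = .sym f es) ∧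
      ∃ A : Ty S R.ar 0, T.NaturalType R.prem Ctx.nil R.lhs A ∧
        (RawRule.mk R.ar R.prem (.tm A) R.lhs).Deterministic ∧
        T.ObjectInvertible (RawRule.mk R.ar R.prem (.tm A) R.lhs)
  | _, _ => False

/-- A sequence of equational premises which extends metavariables of arities `ν` to `ξ`. -/
inductive EqPrem (S : Signature.{u}) (ν : List MArity) : List MArity → Type u
  | nil : EqPrem S ν ν
  | snoc {ξ : List MArity} {α : MArity} (Φ : EqPrem S ν ξ) (hα : ¬ α.cls.IsObj)
      (BB : Bdry S ξ α.cls α.bind 0) : EqPrem S ν (α :: ξ)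

/-- The metavariable context `Ξ, Φ`. -/
def EqPrem.append {S : Signature.{u}} {ν : List MArity} (Ξ : MCtx S ν) :
    {ξ : List MArity} → EqPrem S ν ξ → MCtx S ξ
  | _, .nil => Ξ
  | _, .snoc Φ _ BB => (Φ.append Ξ).snoc BB

/-- The inclusion of the metavariables of `Ξ` in those of `Ξ, Φ`. -/
def EqPrem.incl {S : Signature.{u}} {ν : List MArity} :
    {ξ : List MArity} → EqPrem S ν ξ → (α : MArity) → MVar ν α → MVar ξ α
  | _, .nil, _, M => M
  | _, .snoc Φ _ _, α, M => .there (Φ.incl α M)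

/-- The dummy argument of an equality arity. -/
def dummyArg {S : Signature.{u}} {μ : List MArity} {n : ℕ} :
    (α : MArity) → ¬ α.cls.IsObj → Arg S μ α.cls α.bind n
  | ⟨.ty, _⟩, h => absurd (Or.inl rfl) h
  | ⟨.tm, _⟩, h => absurd (Or.inr rfl) h
  | ⟨.eqTy, k⟩, _ => Arg.dummy .ty k
  | ⟨.eqTm, k⟩, _ => Arg.dummy .tm k

/-- Extension of an instantiation of `Ξ` to `Ξ, Φ` by dummy arguments. -/
def EqPrem.extend {S : Signature.{u}} {ν μ : List MArity} {n : ℕ} (I : Inst S ν μ n) :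
    {ξ : List MArity} → EqPrem S ν ξ → Inst S ξ μ n
  | _, .nil, β, M => I β M
  | _, .snoc (α := α) _ hα _, _, .here => dummyArg α hα
  | _, .snoc Φ _ _, β, .there M => Φ.extend I β M

/-- Extension of an instantiation by a term for one more metavariable of arity `(Tm, 0)`. -/
def Inst.cons {S : Signature.{u}} {ν μ : List MArity} {n : ℕ} (I : Inst S ν μ n) (t : Tm S μ n) :
    Inst S (⟨.tm, 0⟩ :: ν) μ n
  | _, .here => t
  | α, .there M => I α M

/-- The data of a rule `Ξ, s : (□ : P), t : (□ : P), Φ ⟹ s ≡ t : P`, where `Φ` consists of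
equational premises. -/
structure ExtRule (S : Signature.{u}) : Type u where
  ar : List MArity
  prem : MCtx S ar
  type : Ty S ar 0
  arAll : List MArity
  eqs : EqPrem S (⟨.tm, 0⟩ :: ⟨.tm, 0⟩ :: ar) arAll

/-- The metavariable context `Ξ, s : (□ : P), t : (□ : P), Φ`. -/
def ExtRule.premAll {S : Signature.{u}} (R : ExtRule S) : MCtx S R.arAll :=
  R.eqs.append
    (.snoc (α := ⟨.tm, 0⟩) (.snoc (α := ⟨.tm, 0⟩) R.prem (.tm R.type))
      (.tm (R.type.mrename (fun _ => MVar.there))))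

/-- The raw rule `Ξ, s : (□ : P), t : (□ : P), Φ ⟹ s ≡ t : P`. -/
def ExtRule.rule {S : Signature.{u}} (R : ExtRule S) : RawRule S .eqTm where
  ar := R.arAll
  prem := R.premAll
  bdry := .eqTm
    (Arg.mapp (R.eqs.incl ⟨.tm, 0⟩ (.there .here)) Fin.elim0)
    (Arg.mapp (R.eqs.incl ⟨.tm, 0⟩ .here) Fin.elim0)
    (R.type.mrename (fun α M => R.eqs.incl α (.there (.there M))))
  head := .starTm

/-- Extensionality rules. -/
def RawTheory.IsExtensionalityRule {S : Signature.{u}} (T : RawTheory.{u, v} S)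
    (R : ExtRule S) : Prop :=
  T.DerivableRule R.rule ∧ T.FinitaryRule R.rule ∧
  (RawRule.mk R.ar R.prem .ty R.type).Deterministic ∧
  T.ObjectInvertible (RawRule.mk R.ar R.prem .ty R.type)

/-! ### Normalization and equality checking -/

/-- A specification of principal arguments, of symbols and (since these are treated as symbols
taking term arguments) of the metavariables at hand. -/
structure Principal (S : Signature.{u}) (μ : List MArity) : Type u where
  sym : ∀ {c : Cls} (f : S.Sym c) (α : MArity), MVar (S.arity f) α → Prop
  mvar : ∀ {c : Cls} {k : ℕ}, MVar μ ⟨c, k⟩ → Fin k → Prop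

/-- The interdependent phases: normalization `▷`, normalization of principal arguments `▷ₚ`, one use
of a computation rule `▷c`, comparison `∼` of arguments, the type-directed phase `∼ₑ`, and
comparison `∼ₙ` of normalized expressions. -/
inductive Phase : Type
  | norm
  | normP
  | normC
  | check
  | checkE
  | checkN

/-- The relations defined by the normalization and equality checking algorithm, for computation
rules `C`, extensionality rules `E`, and principal arguments `P`.  For instance,
`T.Algo C E P Θ .norm Γ BB e₁ e₂` is `Θ; Γ ⊢ BB[e₁ ▷ e₂]`. -/
inductive RawTheory.Algo {S : Signature.{u}} (T : RawTheory.{u, v} S)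
    {ι : Cls → Type w} (C : ∀ c : Cls, ι c → Rewrite S c)
    {κ : Type x} (E : κ → ExtRule S)
    {μ : List MArity} (P : Principal S μ) (Θ : MCtx S μ) :
    Phase → {n : ℕ} → Ctx S μ n → {c : Cls} → {m : ℕ} → Bdry S μ c m n →
      Arg S μ c m n → Arg S μ c m n → Prop
  -- use of a computation rule
  | compute {n : ℕ} {Γ : Ctx S μ n} {c : Cls} (B : Bdry S μ c 0 n) (i : ι c)
      (I : Inst S (C c i).ar μ n) (s : Arg S μ c 0 n) :
      (C c i).lhs.actC I = s →
      (∀ (d : Cls) (m : ℕ) (M : MVar (C c i).ar ⟨d.eqn, m⟩) (BB : Bdry S (C c i).ar d m 0)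
        (e₁ e₂ : Arg S (C c i).ar d m 0), d.IsObj → (C c i).prem.get M = BB.eqn e₁ e₂ →
        T.Algo C E P Θ .check Γ (BB.actC I) (e₁.actC I) (e₂.actC I)) →
      T.Algo C E P Θ .normC Γ B s ((C c i).rhs.actC I)
  -- normalization of principal arguments
  | principalSym {n : ℕ} {Γ : Ctx S μ n} {c : Cls} (B : Bdry S μ c 0 n) (f : S.Sym c)
      (Ξ : MCtx S (S.arity f)) (B₀ : Bdry S (S.arity f) c 0 0) (es ds : Inst S (S.arity f) μ n) :
      T.IsRuleFor f Ξ B₀ →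
      (∀ (α : MArity) (M : MVar (S.arity f) α), P.sym f α M →
        T.Algo C E P Θ .norm Γ ((Ξ.get M).actC es) (es α M) (ds α M)) →
      (∀ (α : MArity) (M : MVar (S.arity f) α), ¬ P.sym f α M → es α M = ds α M) →
      T.Algo C E P Θ .normP Γ B (.sym f es) (.sym f ds)
  | principalMVar {n : ℕ} {Γ : Ctx S μ n} {c : Cls} (B : Bdry S μ c 0 n) {k : ℕ} (hc : c.IsObj)
      (M : MVar μ ⟨c, k⟩) (ss ts : Fin k → Tm S μ n) :
      (∀ j, P.mvar M j →
        T.Algo C E P Θ .norm Γ (.tm ((Θ.get M).argTy ss j)) (ss j) (ts j)) →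
      (∀ j, ¬ P.mvar M j → ss j = ts j) →
      T.Algo C E P Θ .normP Γ B (.mvar hc M ss) (.mvar hc M ts)
  -- normalization; only symbol and metavariable applications are related by `▷ₚ`
  | normStep {n : ℕ} {Γ : Ctx S μ n} {c : Cls} (B : Bdry S μ c 0 n) (e e₁ e₂ e₃ : Arg S μ c 0 n) :
      T.Algo C E P Θ .normP Γ B e e₁ →
      T.Algo C E P Θ .normC Γ B e₁ e₂ →
      T.Algo C E P Θ .norm Γ B e₂ e₃ →
      T.Algo C E P Θ .norm Γ B e e₃
  | normDone {n : ℕ} {Γ : Ctx S μ n} {c : Cls} (B : Bdry S μ c 0 n) (e e₁ : Arg S μ c 0 n) :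
      T.Algo C E P Θ .normP Γ B e e₁ →
      (∀ (i : ι c) (I : Inst S (C c i).ar μ n), (C c i).lhs.actC I ≠ e₁) →
      T.Algo C E P Θ .norm Γ B e e₁
  | normAbs {n : ℕ} {Γ : Ctx S μ n} {c : Cls} {m : ℕ} (A : Ty S μ n) (BB : Bdry S μ c m (n + 1))
      (e₁ e₂ : Arg S μ c m (n + 1)) :
      T.Algo C E P Θ .norm (Γ.snoc A) BB e₁ e₂ →
      T.Algo C E P Θ .norm Γ (.abs A BB) (.abs e₁) (.abs e₂)
  | normVar {n : ℕ} {Γ : Ctx S μ n} (a : Fin n) (A : Ty S μ n) :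
      T.Algo C E P Θ .norm Γ (.tm A) (.var a) (.var a)
  | normStarTy {n : ℕ} {Γ : Ctx S μ n} (B : Bdry S μ .eqTy 0 n) :
      T.Algo C E P Θ .norm Γ B .starTy .starTy
  | normStarTm {n : ℕ} {Γ : Ctx S μ n} (B : Bdry S μ .eqTm 0 n) :
      T.Algo C E P Θ .norm Γ B .starTm .starTm
  -- comparison of arguments
  | checkTm {n : ℕ} {Γ : Ctx S μ n} (A A₁ : Ty S μ n) (s t : Tm S μ n) :
      T.Algo C E P Θ .norm Γ .ty A A₁ →
      T.Algo C E P Θ .checkE Γ (.tm A₁) s t →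
      T.Algo C E P Θ .check Γ (.tm A) s t
  | checkTy {n : ℕ} {Γ : Ctx S μ n} (A A₁ B B₁ : Ty S μ n) :
      T.Algo C E P Θ .norm Γ .ty A A₁ →
      T.Algo C E P Θ .norm Γ .ty B B₁ →
      T.Algo C E P Θ .checkN Γ .ty A₁ B₁ →
      T.Algo C E P Θ .check Γ .ty A B
  | checkAbs {n : ℕ} {Γ : Ctx S μ n} {c : Cls} {m : ℕ} (A : Ty S μ n) (BB : Bdry S μ c m (n + 1))
      (e₁ e₂ : Arg S μ c m (n + 1)) :
      T.Algo C E P Θ .check (Γ.snoc A) BB e₁ e₂ →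
      T.Algo C E P Θ .check Γ (.abs A BB) (.abs e₁) (.abs e₂)
  -- the type-directed phase; the equational premises of both `Ξ` and `Φ` are compared, after
  -- instantiation by `I` extended by `s` and `t`
  | extApply {n : ℕ} {Γ : Ctx S μ n} (i : κ) (I : Inst S (E i).ar μ n) (A : Ty S μ n)
      (s t : Tm S μ n) :
      (E i).type.actC I = A →
      (∀ (d : Cls) (m : ℕ) (M : MVar (E i).arAll ⟨d.eqn, m⟩) (BB : Bdry S (E i).arAll d m 0)
        (e₁ e₂ : Arg S (E i).arAll d m 0), d.IsObj → (E i).premAll.get M = BB.eqn e₁ e₂ →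
        T.Algo C E P Θ .check Γ (BB.actC ((E i).eqs.extend ((I.cons s).cons t)))
          (e₁.actC ((E i).eqs.extend ((I.cons s).cons t)))
          (e₂.actC ((E i).eqs.extend ((I.cons s).cons t)))) →
      T.Algo C E P Θ .checkE Γ (.tm A) s t
  | extNone {n : ℕ} {Γ : Ctx S μ n} (A : Ty S μ n) (s s₁ t t₁ : Tm S μ n) :
      (∀ (i : κ) (I : Inst S (E i).ar μ n), (E i).type.actC I ≠ A) →
      T.Algo C E P Θ .norm Γ (.tm A) s s₁ →
      T.Algo C E P Θ .norm Γ (.tm A) t t₁ →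
      T.Algo C E P Θ .checkN Γ (.tm A) s₁ t₁ →
      T.Algo C E P Θ .checkE Γ (.tm A) s t
  -- comparison of normalized expressions
  | neutVar {n : ℕ} {Γ : Ctx S μ n} (a : Fin n) (A : Ty S μ n) :
      T.Algo C E P Θ .checkN Γ (.tm A) (.var a) (.var a)
  | neutSym {n : ℕ} {Γ : Ctx S μ n} {c : Cls} (B : Bdry S μ c 0 n) (f : S.Sym c)
      (Ξ : MCtx S (S.arity f)) (B₀ : Bdry S (S.arity f) c 0 0) (es ds : Inst S (S.arity f) μ n) :
      T.IsRuleFor f Ξ B₀ →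
      (∀ (α : MArity) (M : MVar (S.arity f) α), α.cls.IsObj → P.sym f α M →
        T.Algo C E P Θ .checkN Γ ((Ξ.get M).actC es) (es α M) (ds α M)) →
      (∀ (α : MArity) (M : MVar (S.arity f) α), α.cls.IsObj → ¬ P.sym f α M →
        T.Algo C E P Θ .check Γ ((Ξ.get M).actC es) (es α M) (ds α M)) →
      T.Algo C E P Θ .checkN Γ B (.sym f es) (.sym f ds)
  | neutMVar {n : ℕ} {Γ : Ctx S μ n} {c : Cls} (B : Bdry S μ c 0 n) {k : ℕ} (hc : c.IsObj)
      (M : MVar μ ⟨c, k⟩) (ss ts : Fin k → Tm S μ n) :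
      (∀ j, P.mvar M j →
        T.Algo C E P Θ .checkN Γ (.tm ((Θ.get M).argTy ss j)) (ss j) (ts j)) →
      (∀ j, ¬ P.mvar M j →
        T.Algo C E P Θ .check Γ (.tm ((Θ.get M).argTy ss j)) (ss j) (ts j)) →
      T.Algo C E P Θ .checkN Γ B (.mvar hc M ss) (.mvar hc M ts)
  | neutAbs {n : ℕ} {Γ : Ctx S μ n} {c : Cls} {m : ℕ} (A : Ty S μ n) (BB : Bdry S μ c m (n + 1))
      (e₁ e₂ : Arg S μ c m (n + 1)) :
      T.Algo C E P Θ .checkN (Γ.snoc A) BB e₁ e₂ →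
      T.Algo C E P Θ .checkN Γ (.abs A BB) (.abs e₁) (.abs e₂)

end FTT

namespace FTT

/-! ### Renaming and substitution -/

section Expr

variable {S : Signature.{u}} {μ ν ξ : List MArity} {c : Cls} {m n k l : ℕ}

/-! The proof is one induction over all the interdependent relations; the difficulty is to find a
statement that survives a computation rule `Ξ ⟹ p ≡ v`. To use it at `I`, all of `I` must be
derivable. The algorithm has compared the sides of the equational premises, but soundness of a
comparison presupposes that its sides are derivable, and this would itself come from the
derivability of `I`.

Object-invertibility breaks the circle. It makes `I` derivable over `Θ` extended by metavariables
for the instantiated equational premises. These are then replaced by dummies: wherever a derivation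
applies such a metavariable, the application rule carries as a premise that the instantiated
equation boundary is derivable, so both sides of that instance are derivable, and the comparison may
be invoked there. All that is needed of a comparison is thus that each instance of the equation
holds once its sides are derivable (`EqSound`).

This dictates the induction statement `SoundAt`: for any well-formed `Δ` and arbitrary, possibly
ill-typed, terms put for free and abstracted variables, derivability of the instantiated left side
(and of the right side, in the comparison phases) yields the instantiated equation. The original
variable context has disappeared, abstractions cost nothing, and the statement is closed under
substitution. Since object-invertibility speaks of empty variable contexts, the variables are first
promoted to metavariables and afterwards turned back (`IsPromotion`);
`ObjectInvertible.derivableInst` puts these ingredients together.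

The structural steps rest on metatheory: inversion of applications (`Derives.appInv`),
presuppositions (`Derives.presup`), and congruence, where derivability of the changed arguments is
recovered from left to right (`Fits.of_eq`, `EInst.of_eq`). Preservation of derivability and of
equality under substitution and instantiation comes from two generic inductions,
`Transports.derives` and `EqTransports.eqInstances`. They are stated for one operation `ms`, which
instantiates metavariables and substitutes for variables simultaneously and has renaming,
substitution and instantiation as special cases. -/

@[simp] theorem liftRen_zero (ρ : Fin n → Fin k) : liftRen ρ 0 = 0 := rfl

@[simp] theorem liftRen_succ (ρ : Fin n → Fin k) (i : Fin n) :
    liftRen ρ i.succ = (ρ i).succ := rfl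

@[simp] theorem liftSub_zero (σ : Fin n → Tm S μ k) : liftSub σ 0 = .var 0 := rfl

@[simp] theorem liftSub_succ (σ : Fin n → Tm S μ k) (i : Fin n) :
    liftSub σ i.succ = (σ i).rename Fin.succ := rfl

theorem liftRen_comp (ρ : Fin n → Fin k) (θ : Fin k → Fin l) :
    liftRen (fun i => θ (ρ i)) = fun i => liftRen θ (liftRen ρ i) := by
  funext i
  refine Fin.cases ?_ (fun i => ?_) i <;> simp

theorem liftRen_id : liftRen (fun i : Fin n => i) = fun i => i := by
  funext i
  refine Fin.cases ?_ (fun i => ?_) i <;> simp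

theorem liftSub_var : liftSub (Arg.var : Fin n → Tm S μ n) = Arg.var := by
  funext i
  refine Fin.cases ?_ (fun i => ?_) i <;> simp [Arg.rename]

theorem liftSub_comp_liftRen (ρ : Fin n → Fin k) (σ : Fin k → Tm S μ l) :
    (fun i => liftSub σ (liftRen ρ i)) = liftSub (fun i => σ (ρ i)) := by
  funext i
  refine Fin.cases ?_ (fun i => ?_) i <;> simp

theorem Arg.rename_rename (e : Arg S μ c m n) (ρ : Fin n → Fin k) (θ : Fin k → Fin l) :
    (e.rename ρ).rename θ = e.rename (fun i => θ (ρ i)) := by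
  induction e generalizing k l <;> simp [Arg.rename, liftRen_comp, *]

theorem Arg.rename_id (e : Arg S μ c m n) : e.rename (fun i => i) = e := by
  induction e <;> simp [Arg.rename, liftRen_id, *]

theorem Arg.subst_rename (e : Arg S μ c m n) (ρ : Fin n → Fin k) (σ : Fin k → Tm S μ l) :
    (e.rename ρ).subst σ = e.subst (fun i => σ (ρ i)) := by
  induction e generalizing k l <;> simp [Arg.rename, Arg.subst, liftSub_comp_liftRen, *]

theorem rename_liftSub (σ : Fin n → Tm S μ k) (ρ : Fin k → Fin l) :
    (fun i => (liftSub σ i).rename (liftRen ρ)) = liftSub (fun i => (σ i).rename ρ) := by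
  funext i
  refine Fin.cases ?_ (fun i => ?_) i <;> simp [Arg.rename, Arg.rename_rename]

theorem Arg.rename_subst (e : Arg S μ c m n) (σ : Fin n → Tm S μ k) (ρ : Fin k → Fin l) :
    (e.subst σ).rename ρ = e.subst (fun i => (σ i).rename ρ) := by
  induction e generalizing k l <;> simp [Arg.rename, Arg.subst, rename_liftSub, *]

theorem subst_liftSub (σ : Fin n → Tm S μ k) (τ : Fin k → Tm S μ l) :
    (fun i => (liftSub σ i).subst (liftSub τ)) = liftSub (fun i => (σ i).subst τ) := by
  funext i
  refine Fin.cases ?_ (fun i => ?_) i <;>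
    simp [Arg.subst, Arg.subst_rename, Arg.rename_subst]

theorem Arg.subst_subst (e : Arg S μ c m n) (σ : Fin n → Tm S μ k) (τ : Fin k → Tm S μ l) :
    (e.subst σ).subst τ = e.subst (fun i => (σ i).subst τ) := by
  induction e generalizing k l <;> simp [Arg.subst, subst_liftSub, *]

theorem Arg.subst_var (e : Arg S μ c m n) : e.subst Arg.var = e := by
  induction e <;> simp [Arg.subst, liftSub_var, *]

theorem liftSub_ren (ρ : Fin n → Fin k) :
    liftSub (fun i => (Arg.var (ρ i) : Tm S μ k)) = fun i => Arg.var (liftRen ρ i) := by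
  funext i
  refine Fin.cases ?_ (fun i => ?_) i <;> simp [Arg.rename]

theorem Arg.rename_eq_subst (e : Arg S μ c m n) (ρ : Fin n → Fin k) :
    e.rename ρ = e.subst (fun i => .var (ρ i)) := by
  induction e generalizing k <;> simp [Arg.rename, Arg.subst, liftSub_ren, *]

/-- Dummies are the only inhabitants of the equality classes, because symbols and `Arg.mvar` belong
to object classes. Equational components of instantiations can therefore be exchanged freely. -/
theorem Arg.eq_of_not_isObj (hc : ¬ c.IsObj) (e e' : Arg S μ c m n) : e = e' := by
  induction e with
  | var => exact absurd (Or.inr rfl) hc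
  | sym f => exact absurd (S.isObj f) hc
  | mvar h => exact absurd h hc
  | starTy =>
    cases e' with
    | sym f => exact absurd (S.isObj f) hc
    | mvar h => exact absurd h hc
    | starTy => rfl
  | starTm =>
    cases e' with
    | sym f => exact absurd (S.isObj f) hc
    | mvar h => exact absurd h hc
    | starTm => rfl
  | abs e ih =>
    cases e' with
    | abs e' => rw [ih hc e']

theorem Arg.abs_body (e : Arg S μ c (m + 1) n) : Arg.abs e.body = e := by
  cases e; rfl

/-! ### Substitution for abstracted variables -/

theorem cases_comp {α β : Type*} (f : α → β) (a : α) (σ : Fin n → α) :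
    (fun i => f ((Fin.cases a σ : Fin (n + 1) → α) i)) = Fin.cases (f a) (fun i => f (σ i)) := by
  funext i
  refine Fin.cases ?_ (fun i => ?_) i <;> simp

theorem cases_eta {α : Type*} (σ : Fin (n + 1) → α) :
    (Fin.cases (σ 0) (fun i => σ i.succ) : Fin (n + 1) → α) = σ := by
  funext i
  refine Fin.cases ?_ (fun i => ?_) i <;> simp

theorem cases_liftSub_subst (t : Tm S μ l) (τ : Fin k → Tm S μ l) (σ : Fin n → Tm S μ k) :
    (fun i => (liftSub σ i).subst (Fin.cases t τ)) =
      (Fin.cases t (fun i => (σ i).subst τ) : Fin (n + 1) → Tm S μ l) := by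
  funext i
  refine Fin.cases ?_ (fun i => ?_) i <;> simp [Arg.subst, Arg.subst_rename]

theorem Arg.instAux_subst (e : Arg S μ c m n) (σ : Fin n → Tm S μ k) (ts : Fin m → Tm S μ k)
    (τ : Fin k → Tm S μ l) :
    (e.instAux σ ts).subst τ = e.instAux (fun i => (σ i).subst τ) (fun j => (ts j).subst τ) := by
  induction m generalizing n with
  | zero => simp [Arg.instAux, Arg.subst_subst]
  | succ m ih => simp [Arg.instAux, ih, cases_comp (Arg.subst τ)]

theorem Arg.subst_instAux (e : Arg S μ c m n) (σ : Fin n → Tm S μ k) (τ : Fin k → Tm S μ l)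
    (ts : Fin m → Tm S μ l) :
    (e.subst σ).instAux τ ts = e.instAux (fun i => (σ i).subst τ) ts := by
  induction m generalizing n k with
  | zero => simp [Arg.instAux, Arg.subst_subst]
  | succ m ih =>
    cases e
    simp [Arg.instAux, Arg.subst, Arg.body, ih, cases_liftSub_subst]

/-- Opening the binders with distinct variables loses no information. This reduces identities
between abstracted arguments to identities between their instances. -/
theorem Arg.ext_instAux {e e' : Arg S μ c m n}
    (h : ∀ (k : ℕ) (σ : Fin n → Tm S μ k) (ts : Fin m → Tm S μ k),
      e.instAux σ ts = e'.instAux σ ts) : e = e' := by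
  induction m generalizing n with
  | zero => simpa [Arg.instAux, Arg.subst_var] using h n Arg.var Fin.elim0
  | succ m ih =>
    rw [← e.abs_body, ← e'.abs_body]
    refine congrArg _ (ih fun k σ ts => ?_)
    simpa [Arg.instAux, cases_eta] using h k (fun i => σ i.succ) (Fin.cases (σ 0) ts)

/-- The function `F` knows how to act on outer variables only through renamings, whereas an instance
needs substitutions; `G` is its extension to substitutions, and its naturality `hG` performs the
beta step. -/
theorem Arg.abstract_instAux
    (F : ∀ k : ℕ, (Fin m → Tm S μ k) → (Fin n → Fin k) → Arg S μ c 0 k)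
    (G : ∀ k : ℕ, (Fin m → Tm S μ k) → (Fin n → Tm S μ k) → Arg S μ c 0 k)
    (hFG : ∀ k us ρ, F k us ρ = G k us (fun i => .var (ρ i)))
    (hG : ∀ k l us σ (τ : Fin k → Tm S μ l),
      (G k us σ).subst τ = G l (fun j => (us j).subst τ) (fun i => (σ i).subst τ))
    (σ : Fin n → Tm S μ k) (ts : Fin m → Tm S μ k) :
    (Arg.abstract m F).instAux σ ts = G k ts σ := by
  induction m generalizing n with
  | zero =>
    simp only [Arg.abstract, Arg.instAux, hFG, hG]
    congr 1
    exact Subsingleton.elim _ _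
  | succ m ih =>
    simp only [Arg.abstract, Arg.instAux, Arg.body]
    rw [ih _ (fun k us σ => G k (Fin.cases (σ 0) us) (fun i => σ i.succ))]
    · congr 1
      exact cases_eta ts
    · intro k us ρ
      rw [hFG]
    · intro k l us σ τ
      rw [hG, cases_comp (Arg.subst τ)]

theorem Arg.mapp_subst (M : MVar μ ⟨c, m⟩) (ts : Fin m → Tm S μ k) (τ : Fin k → Tm S μ l) :
    (Arg.mapp M ts).subst τ = Arg.mapp M (fun j => (ts j).subst τ) := by
  cases c <;> simp [Arg.mapp, Arg.subst]

theorem genApp_instAux {α : MArity} (M : MVar μ α) (σ : Fin n → Tm S μ k)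
    (ts : Fin α.bind → Tm S μ k) : (genApp S α M).instAux σ ts = Arg.mapp M ts :=
  Arg.abstract_instAux _ (fun _ ts _ => Arg.mapp M ts) (fun _ _ _ => rfl)
    (fun _ _ _ _ _ => Arg.mapp_subst _ _ _) σ ts

/-! ### Simultaneous instantiation and substitution -/

/-- Renaming of variables in an instantiation. -/
def Inst.rename (I : Inst S ν μ n) (ρ : Fin n → Fin k) : Inst S ν μ k :=
  fun α M => (I α M).rename ρ

/-- Substitution in an instantiation. -/
def Inst.subst (I : Inst S ν μ n) (σ : Fin n → Tm S μ k) : Inst S ν μ k :=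
  fun α M => (I α M).subst σ

/-- Simultaneous action of an instantiation on metavariables and of a substitution on variables. -/
def Arg.ms {ν μ : List MArity} :
    {c : Cls} → {m n k : ℕ} → Inst S ν μ k → (Fin n → Tm S μ k) → Arg S ν c m n → Arg S μ c m k
  | _, _, _, _, _, σ, .var i => σ i
  | _, _, _, _, I, σ, .sym f es => .sym f (fun α M => (es α M).ms I σ)
  | _, _, _, _, I, σ, .mvar _ M ts => (I _ M).inst (fun j => (ts j).ms I σ)
  | _, _, _, _, _, _, .starTy => .starTy
  | _, _, _, _, _, _, .starTm => .starTm
  | _, _, _, _, I, σ, .abs e => .abs (e.ms I.wk (liftSub σ))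

theorem Inst.wk_eq_rename (I : Inst S ν μ n) : I.wk = I.rename Fin.succ := rfl

theorem Inst.wk_subst_liftSub (I : Inst S ν μ n) (σ : Fin n → Tm S μ k) :
    I.wk.subst (liftSub σ) = (I.subst σ).wk := by
  funext α M
  simp [Inst.wk, Inst.subst, Arg.subst_rename, Arg.rename_subst]

theorem Inst.subst_var (I : Inst S ν μ n) : I.subst Arg.var = I := by
  funext α M
  exact Arg.subst_var _

theorem Inst.rename_eq_subst (I : Inst S ν μ n) (ρ : Fin n → Fin k) :
    I.rename ρ = I.subst (fun i => .var (ρ i)) := by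
  funext α M
  exact Arg.rename_eq_subst _ _

theorem Inst.wk_subst_cases (I : Inst S ν μ n) (t : Tm S μ k) (σ : Fin n → Tm S μ k) :
    I.wk.subst (Fin.cases t σ) = I.subst σ := by
  funext α M
  simp [Inst.wk, Inst.subst, Arg.subst_rename]

theorem Arg.ms_rename (e : Arg S ν c m n) (ρ : Fin n → Fin k) (I : Inst S ν μ l)
    (σ : Fin k → Tm S μ l) : (e.rename ρ).ms I σ = e.ms I (fun i => σ (ρ i)) := by
  induction e generalizing k l <;> simp [Arg.rename, Arg.ms, liftSub_comp_liftRen, *]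

theorem Arg.inst_subst (e : Arg S μ c m n) (ts : Fin m → Tm S μ n) (τ : Fin n → Tm S μ k) :
    (e.inst ts).subst τ = (e.subst τ).inst (fun j => (ts j).subst τ) := by
  simp [Arg.inst, Arg.instAux_subst, Arg.subst_instAux, Arg.subst, Arg.subst_var]

theorem Arg.subst_ms (e : Arg S ν c m n) (I : Inst S ν μ k) (σ : Fin n → Tm S μ k)
    (τ : Fin k → Tm S μ l) :
    (e.ms I σ).subst τ = e.ms (I.subst τ) (fun i => (σ i).subst τ) := by
  induction e generalizing k l with
  | mvar hc M ts ih => simp [Arg.ms, Arg.inst_subst, ih, Inst.subst]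
  | _ => simp [Arg.subst, Arg.ms, subst_liftSub, Inst.wk_subst_liftSub, *]

theorem Arg.rename_ms (e : Arg S ν c m n) (I : Inst S ν μ k) (σ : Fin n → Tm S μ k)
    (ρ : Fin k → Fin l) :
    (e.ms I σ).rename ρ = e.ms (I.rename ρ) (fun i => (σ i).rename ρ) := by
  simp [Arg.rename_eq_subst, Arg.subst_ms, Inst.rename_eq_subst]

theorem ms_liftSub (τ : Fin n → Tm S ν k) (I : Inst S ν μ l) (σ : Fin k → Tm S μ l) :
    (fun i => (liftSub τ i).ms I.wk (liftSub σ)) = liftSub (fun i => (τ i).ms I σ) := by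
  funext i
  refine Fin.cases ?_ (fun i => ?_) i <;>
    simp [Arg.ms, Arg.ms_rename, Arg.rename_ms, Inst.wk_eq_rename]

theorem Arg.ms_subst (e : Arg S ν c m n) (τ : Fin n → Tm S ν k) (I : Inst S ν μ l)
    (σ : Fin k → Tm S μ l) : (e.subst τ).ms I σ = e.ms I (fun i => (τ i).ms I σ) := by
  induction e generalizing k l <;> simp [Arg.subst, Arg.ms, ms_liftSub, *]

/-- Simultaneous instantiation and substitution in the body of an abstraction. -/
def Arg.msAux {ν μ : List MArity} {c : Cls} {k : ℕ} : {m n : ℕ} → Inst S ν μ k →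
    (Fin n → Tm S μ k) → (Fin m → Tm S μ k) → Arg S ν c m n → Arg S μ c 0 k
  | 0, _, I, σ, _, e => e.ms I σ
  | _ + 1, _, I, σ, ts, e => e.body.msAux I (Fin.cases (ts 0) σ) (fun j => ts j.succ)

theorem Arg.instAux_ms (e : Arg S ν c m n) (σ : Fin n → Tm S ν k) (ts : Fin m → Tm S ν k)
    (I : Inst S ν μ l) (τ : Fin k → Tm S μ l) :
    (e.instAux σ ts).ms I τ = e.msAux I (fun i => (σ i).ms I τ) (fun j => (ts j).ms I τ) := by
  induction m generalizing n with
  | zero => simp [Arg.instAux, Arg.msAux, Arg.ms_subst]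
  | succ m ih => simp [Arg.instAux, Arg.msAux, ih, cases_comp (Arg.ms I τ)]

theorem Arg.ms_instAux (e : Arg S ν c m n) (I : Inst S ν μ k) (σ : Fin n → Tm S μ k)
    (τ : Fin k → Tm S μ l) (ts : Fin m → Tm S μ l) :
    (e.ms I σ).instAux τ ts = e.msAux (I.subst τ) (fun i => (σ i).subst τ) ts := by
  induction m generalizing n k with
  | zero => simp [Arg.instAux, Arg.msAux, Arg.subst_ms]
  | succ m ih =>
    cases e
    simp [Arg.instAux, Arg.ms, Arg.msAux, Arg.body, ih, cases_liftSub_subst, Inst.wk_subst_cases]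

/-- Opening the `m` binders with fresh variables separates the two tasks: first expose the body,
then act on all `m + n` variables at once. It lets `genApp_instAux` compute under `ms`. -/
theorem Arg.msAux_eq (e : Arg S ν c m n) (I : Inst S ν μ k) (σ : Fin n → Tm S μ k)
    (ts : Fin m → Tm S μ k) :
    e.msAux I σ ts =
      (e.instAux (fun i => .var (Fin.natAdd m i)) (fun j => .var (Fin.castAdd n j))).ms I
        (Fin.addCases ts σ) := by
  simp [Arg.instAux_ms, Arg.ms]

/-- Composition of instantiations. -/
def Inst.ms (J : Inst S ξ ν n) (I : Inst S ν μ k) (σ : Fin n → Tm S μ k) : Inst S ξ μ k :=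
  fun α M => (J α M).ms I σ

theorem Inst.wk_ms (J : Inst S ξ ν n) (I : Inst S ν μ k) (σ : Fin n → Tm S μ k) :
    J.wk.ms I.wk (liftSub σ) = (J.ms I σ).wk := by
  funext α M
  simp [Inst.wk, Inst.ms, Arg.ms_rename, Arg.rename_ms, Inst.wk_eq_rename]

/-- The fusion law from which all later commutations are read off. In the metavariable case both
sides become `msAux` of the component of `J`, so only fusion with substitution (`ms_subst`,
`subst_ms`) is used there and there is no circularity. -/
theorem Arg.ms_ms (e : Arg S ξ c m n) (J : Inst S ξ ν k) (τ : Fin n → Tm S ν k)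
    (I : Inst S ν μ l) (σ : Fin k → Tm S μ l) :
    (e.ms J τ).ms I σ = e.ms (J.ms I σ) (fun i => (τ i).ms I σ) := by
  induction e generalizing k l with
  | mvar hc M ts ih =>
    simp [Arg.ms, Arg.inst, Arg.instAux_ms, Arg.ms_instAux, ih, Inst.ms, Inst.subst_var,
      Arg.subst_var]
  | _ => simp [Arg.ms, ms_liftSub, Inst.wk_ms, *]

/-- The generic instantiation along a renaming of metavariables. -/
def Inst.gen (ρ : ∀ α : MArity, MVar ν α → MVar μ α) : Inst S ν μ n :=
  fun α M => genApp S α (ρ α M)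

theorem genApp_subst {α : MArity} (M : MVar μ α) (σ : Fin n → Tm S μ k) :
    (genApp S α M : Arg S μ _ _ n).subst σ = genApp S α M :=
  Arg.ext_instAux fun _ _ _ => by rw [Arg.subst_instAux, genApp_instAux, genApp_instAux]

theorem Inst.gen_subst (ρ : ∀ α : MArity, MVar ν α → MVar μ α) (σ : Fin n → Tm S μ k) :
    (Inst.gen ρ : Inst S ν μ n).subst σ = Inst.gen ρ := by
  funext α M
  exact genApp_subst _ _

theorem Inst.gen_rename (ρ : ∀ α : MArity, MVar ν α → MVar μ α) (θ : Fin n → Fin k) :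
    (Inst.gen ρ : Inst S ν μ n).rename θ = Inst.gen ρ := by
  rw [Inst.rename_eq_subst, Inst.gen_subst]

theorem Inst.gen_wk (ρ : ∀ α : MArity, MVar ν α → MVar μ α) :
    (Inst.gen ρ : Inst S ν μ n).wk = Inst.gen ρ :=
  Inst.gen_rename ρ _

theorem Arg.mapp_ms (M : MVar ν ⟨c, m⟩) (ts : Fin m → Tm S ν n) (I : Inst S ν μ k)
    (σ : Fin n → Tm S μ k) :
    (Arg.mapp M ts).ms I σ = (I _ M).inst (fun j => (ts j).ms I σ) := by
  cases c with
  | ty => rfl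
  | tm => rfl
  | eqTy => exact Arg.eq_of_not_isObj (by rintro (h | h) <;> cases h) _ _
  | eqTm => exact Arg.eq_of_not_isObj (by rintro (h | h) <;> cases h) _ _

theorem genApp_inst {α : MArity} (M : MVar μ α) (ts : Fin α.bind → Tm S μ n) :
    (genApp S α M).inst ts = Arg.mapp M ts :=
  genApp_instAux _ _ _

/-- Generic applications are units for instantiation: by extensionality in instances, an opened
generic application is `M(ts)`, on which `I` acts by `I α M`. -/
theorem genApp_ms {α : MArity} (M : MVar ν α) (I : Inst S ν μ k) (σ : Fin n → Tm S μ k) :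
    (genApp S α M).ms I σ = I α M := by
  refine Arg.ext_instAux fun l τ ts => ?_
  rw [Arg.ms_instAux, Arg.msAux_eq, genApp_instAux, Arg.mapp_ms]
  simp [Arg.ms, Inst.subst, Arg.inst, Arg.subst_instAux, Arg.subst_var]

theorem Inst.gen_ms (ρ : ∀ α : MArity, MVar ξ α → MVar ν α) (I : Inst S ν μ k)
    (σ : Fin n → Tm S μ k) :
    (Inst.gen ρ : Inst S ξ ν n).ms I σ = fun α M => I α (ρ α M) := by
  funext α M
  exact genApp_ms _ _ _

/-- Substitution is `ms` with generic metavariables; similarly for `mrename`, `act` and `actC`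
below. Thus facts on derivability need proof for `ms` only. -/
theorem Arg.subst_eq_ms (e : Arg S μ c m n) (σ : Fin n → Tm S μ k) :
    e.subst σ = e.ms (Inst.gen fun _ M => M) σ := by
  induction e generalizing k with
  | mvar hc M ts ih =>
    simp only [Arg.ms, Inst.gen, genApp_inst, Arg.subst, ih]
    rcases hc with rfl | rfl <;> rfl
  | _ => simp [Arg.ms, Arg.subst, Inst.gen_wk, *]

theorem Arg.mrename_eq_ms (e : Arg S ν c m n) (ρ : ∀ α : MArity, MVar ν α → MVar μ α) :
    e.mrename ρ = e.ms (Inst.gen ρ) Arg.var := by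
  induction e with
  | mvar hc M ts ih =>
    simp only [Arg.ms, Inst.gen, genApp_inst, Arg.mrename, ih]
    rcases hc with rfl | rfl <;> rfl
  | _ => simp [Arg.ms, Arg.mrename, Inst.gen_wk, liftSub_var, *]

theorem Arg.ms_gen_var (e : Arg S μ c m n) : e.ms (Inst.gen fun _ M => M) Arg.var = e := by
  rw [← Arg.subst_eq_ms, Arg.subst_var]

theorem Arg.act_eq_ms (e : Arg S ν c m n) (I : Inst S ν μ n) : e.act I = e.ms I Arg.var := by
  induction e <;> simp [Arg.ms, Arg.act, liftSub_var, *]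

theorem Arg.actC_eq_ms (e : Arg S ν c m 0) (I : Inst S ν μ n) : e.actC I = e.ms I Fin.elim0 := by
  rw [Arg.actC, Arg.act_eq_ms, Arg.ms_rename]
  congr 1
  exact Subsingleton.elim _ _

/-! ### Boundaries -/

/-- Simultaneous action of an instantiation and of a substitution on boundaries. -/
def Bdry.ms {ν μ : List MArity} :
    {c : Cls} → {m n k : ℕ} → Inst S ν μ k → (Fin n → Tm S μ k) → Bdry S ν c m n → Bdry S μ c m k
  | _, _, _, _, _, _, .ty => .ty
  | _, _, _, _, I, σ, .tm A => .tm (A.ms I σ)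
  | _, _, _, _, I, σ, .eqTy A B => .eqTy (A.ms I σ) (B.ms I σ)
  | _, _, _, _, I, σ, .eqTm s t A => .eqTm (s.ms I σ) (t.ms I σ) (A.ms I σ)
  | _, _, _, _, I, σ, .abs A BB => .abs (A.ms I σ) (BB.ms I.wk (liftSub σ))

/-- Simultaneous instantiation and substitution in the body of an abstracted boundary. -/
def Bdry.msAux {ν μ : List MArity} {k : ℕ} : {c : Cls} → {m n : ℕ} → Inst S ν μ k →
    (Fin n → Tm S μ k) → (Fin m → Tm S μ k) → Bdry S ν c m n → Bdry S μ c 0 k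
  | _, _, _, I, σ, ts, .abs _ BB => BB.msAux I (Fin.cases (ts 0) σ) (fun j => ts j.succ)
  | _, _, _, I, σ, _, .ty => Bdry.ms I σ .ty
  | _, _, _, I, σ, _, .tm A => Bdry.ms I σ (.tm A)
  | _, _, _, I, σ, _, .eqTy A B => Bdry.ms I σ (.eqTy A B)
  | _, _, _, I, σ, _, .eqTm s t A => Bdry.ms I σ (.eqTm s t A)

/-- Simultaneous instantiation and substitution in the types of the abstracted variables. -/
def Bdry.msArgTy {ν μ : List MArity} {k : ℕ} : {c : Cls} → {m n : ℕ} → Inst S ν μ k →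
    (Fin n → Tm S μ k) → (Fin m → Tm S μ k) → Bdry S ν c m n → Fin m → Ty S μ k
  | _, 0, _, _, _, _, _ => Fin.elim0
  | _, _ + 1, _, I, σ, ts, .abs A BB =>
      Fin.cases (A.ms I σ) (BB.msArgTy I (Fin.cases (ts 0) σ) (fun j => ts j.succ))

theorem Bdry.instAux_ms (BB : Bdry S ν c m n) (σ : Fin n → Tm S ν k) (ts : Fin m → Tm S ν k)
    (I : Inst S ν μ l) (τ : Fin k → Tm S μ l) :
    (BB.instAux σ ts).ms I τ = BB.msAux I (fun i => (σ i).ms I τ) (fun j => (ts j).ms I τ) := by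
  induction BB <;>
    simp [Bdry.instAux, Bdry.msAux, Bdry.ms, Arg.ms_subst, cases_comp (Arg.ms I τ), *]

theorem Bdry.ms_instAux (BB : Bdry S ν c m n) (I : Inst S ν μ k) (σ : Fin n → Tm S μ k)
    (τ : Fin k → Tm S μ l) (ts : Fin m → Tm S μ l) :
    (BB.ms I σ).instAux τ ts = BB.msAux (I.subst τ) (fun i => (σ i).subst τ) ts := by
  induction BB generalizing k <;>
    simp [Bdry.instAux, Bdry.msAux, Bdry.ms, Arg.subst_ms, cases_liftSub_subst,
      Inst.wk_subst_cases, *]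

theorem Bdry.argTyAux_ms (BB : Bdry S ν c m n) (σ : Fin n → Tm S ν k) (ts : Fin m → Tm S ν k)
    (I : Inst S ν μ l) (τ : Fin k → Tm S μ l) (j : Fin m) :
    (BB.argTyAux σ ts j).ms I τ =
      BB.msArgTy I (fun i => (σ i).ms I τ) (fun j => (ts j).ms I τ) j := by
  induction BB with
  | abs A BB ih =>
    refine Fin.cases ?_ (fun j => ?_) j <;>
      simp [Bdry.argTyAux, Bdry.msArgTy, Arg.ms_subst, cases_comp (Arg.ms I τ), ih]
  | _ => exact j.elim0

theorem Bdry.ms_argTyAux (BB : Bdry S ν c m n) (I : Inst S ν μ k) (σ : Fin n → Tm S μ k)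
    (τ : Fin k → Tm S μ l) (ts : Fin m → Tm S μ l) (j : Fin m) :
    (BB.ms I σ).argTyAux τ ts j =
      BB.msArgTy (I.subst τ) (fun i => (σ i).subst τ) ts j := by
  induction BB generalizing k with
  | abs A BB ih =>
    refine Fin.cases ?_ (fun j => ?_) j <;>
      simp [Bdry.argTyAux, Bdry.msArgTy, Bdry.ms, Arg.subst_ms, cases_liftSub_subst,
        Inst.wk_subst_cases, ih]
  | _ => exact j.elim0

end Expr

/-! ### Boundaries and judgements under simultaneous instantiation and substitution -/

section BoundarySyntax

variable {S : Signature.{u}} {μ ν ξ : List MArity} {c : Cls} {m n k l : ℕ}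

theorem elim0_eq {α : Type*} (f g : Fin 0 → α) : f = g := Subsingleton.elim f g

theorem Bdry.rename_eq_ms (BB : Bdry S μ c m n) (ρ : Fin n → Fin k) :
    BB.rename ρ = BB.ms (Inst.gen fun _ M => M) (fun i => .var (ρ i)) := by
  induction BB generalizing k <;>
    simp [Bdry.rename, Bdry.ms, Arg.rename_eq_subst, Arg.subst_eq_ms, Inst.gen_wk, liftSub_ren, *]

theorem Bdry.mrename_eq_ms (BB : Bdry S ν c m n) (ρ : ∀ α : MArity, MVar ν α → MVar μ α) :
    BB.mrename ρ = BB.ms (Inst.gen ρ) Arg.var := by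
  induction BB <;>
    simp [Bdry.mrename, Bdry.ms, Arg.mrename_eq_ms, Inst.gen_wk, liftSub_var, *]

theorem Bdry.act_eq_ms (BB : Bdry S ν c m n) (I : Inst S ν μ n) :
    BB.act I = BB.ms I Arg.var := by
  induction BB <;> simp [Bdry.ms, Bdry.act, Arg.act_eq_ms, liftSub_var, *]

theorem Bdry.ms_ms (BB : Bdry S ν c m n) (J : Inst S ν μ k) (τ : Fin n → Tm S μ k)
    (I : Inst S μ ξ l) (σ : Fin k → Tm S ξ l) :
    (BB.ms J τ).ms I σ = BB.ms (J.ms I σ) (fun i => (τ i).ms I σ) := by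
  induction BB generalizing k l <;> simp [Bdry.ms, Arg.ms_ms, ms_liftSub, Inst.wk_ms, *]

theorem Bdry.ms_gen_var (BB : Bdry S μ c m n) :
    BB.ms (Inst.gen fun _ M => M) Arg.var = BB := by
  induction BB <;> simp [Bdry.ms, Arg.ms_gen_var, Inst.gen_wk, liftSub_var, *]

theorem Bdry.actC_eq_ms (BB : Bdry S ν c m 0) (I : Inst S ν μ n) :
    BB.actC I = BB.ms I Fin.elim0 := by
  rw [Bdry.actC, Bdry.act_eq_ms, Bdry.rename_eq_ms, Bdry.ms_ms, Inst.gen_ms]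
  congr 1
  exact elim0_eq _ _

theorem Bdry.actC_ms (BB : Bdry S ξ c m 0) (J : Inst S ξ ν n) (I : Inst S ν μ k)
    (σ : Fin n → Tm S μ k) : (BB.actC J).ms I σ = BB.actC (J.ms I σ) := by
  rw [Bdry.actC_eq_ms, Bdry.actC_eq_ms, Bdry.ms_ms]
  congr 1
  exact elim0_eq _ _

theorem Arg.actC_ms (e : Arg S ξ c m 0) (J : Inst S ξ ν n) (I : Inst S ν μ k)
    (σ : Fin n → Tm S μ k) : (e.actC J).ms I σ = e.actC (J.ms I σ) := by
  rw [Arg.actC_eq_ms, Arg.actC_eq_ms, Arg.ms_ms]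
  congr 1
  exact elim0_eq _ _

theorem Bdry.inst_ms (BB : Bdry S ν c m 0) (ts : Fin m → Tm S ν n) (I : Inst S ν μ k)
    (σ : Fin n → Tm S μ k) :
    (BB.inst ts).ms I σ = BB.msAux I Fin.elim0 (fun j => (ts j).ms I σ) := by
  rw [Bdry.inst, Bdry.instAux_ms]
  congr 1
  exact elim0_eq _ _

theorem Bdry.argTy_ms (BB : Bdry S ν c m 0) (ts : Fin m → Tm S ν n) (I : Inst S ν μ k)
    (σ : Fin n → Tm S μ k) (j : Fin m) :
    (BB.argTy ts j).ms I σ = BB.msArgTy I Fin.elim0 (fun j => (ts j).ms I σ) j := by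
  rw [Bdry.argTy, Bdry.argTyAux_ms]
  congr 1
  exact elim0_eq _ _

theorem Bdry.mrename_inst (BB : Bdry S ν c m 0) (ρ : ∀ α : MArity, MVar ν α → MVar μ α)
    (ts : Fin m → Tm S μ n) : (BB.mrename ρ).inst ts = BB.msAux (Inst.gen ρ) Fin.elim0 ts := by
  rw [Bdry.mrename_eq_ms, Bdry.inst, Bdry.ms_instAux, Inst.gen_subst]
  congr 1

theorem Bdry.mrename_argTy (BB : Bdry S ν c m 0) (ρ : ∀ α : MArity, MVar ν α → MVar μ α)
    (ts : Fin m → Tm S μ n) (j : Fin m) :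
    (BB.mrename ρ).argTy ts j = BB.msArgTy (Inst.gen ρ) Fin.elim0 ts j := by
  rw [Bdry.mrename_eq_ms, Bdry.argTy, Bdry.ms_argTyAux, Inst.gen_subst]
  congr 1

theorem Bdry.actC_instAux (BB : Bdry S ν c m 0) (I : Inst S ν μ n) (τ : Fin n → Tm S μ k)
    (ts : Fin m → Tm S μ k) :
    (BB.actC I).instAux τ ts = BB.msAux (I.subst τ) Fin.elim0 ts := by
  rw [Bdry.actC_eq_ms, Bdry.ms_instAux]
  congr 1
  exact elim0_eq _ _

theorem Bdry.actC_argTyAux (BB : Bdry S ν c m 0) (I : Inst S ν μ n) (τ : Fin n → Tm S μ k)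
    (ts : Fin m → Tm S μ k) (j : Fin m) :
    (BB.actC I).argTyAux τ ts j = BB.msArgTy (I.subst τ) Fin.elim0 ts j := by
  rw [Bdry.actC_eq_ms, Bdry.ms_argTyAux]
  congr 1
  exact elim0_eq _ _

theorem Bdry.type_ms (B : Bdry S ν .tm 0 n) (I : Inst S ν μ k) (σ : Fin n → Tm S μ k) :
    (B.ms I σ).type = B.type.ms I σ := by
  cases B; rfl

theorem Cls.eqn_not_isObj (c : Cls) : ¬ c.eqn.IsObj := by
  cases c <;> rintro (h | h) <;> cases h

theorem Arg.body_ms (e : Arg S ν c (m + 1) n) (I : Inst S ν μ k) (σ : Fin n → Tm S μ k) :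
    (e.ms I σ).body = e.body.ms I.wk (liftSub σ) := by
  cases e; rfl

theorem Bdry.eqn_ms (BB : Bdry S ν c m n) (e₁ e₂ : Arg S ν c m n) (I : Inst S ν μ k)
    (σ : Fin n → Tm S μ k) :
    (BB.eqn e₁ e₂).ms I σ = (BB.ms I σ).eqn (e₁.ms I σ) (e₂.ms I σ) := by
  induction BB generalizing k <;> simp [Bdry.eqn, Bdry.ms, Arg.body_ms, *] <;> rfl

theorem Bdry.eqn_instAux (BB : Bdry S μ c m n) (e₁ e₂ : Arg S μ c m n) (σ : Fin n → Tm S μ k)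
    (ts : Fin m → Tm S μ k) :
    (BB.eqn e₁ e₂).instAux σ ts =
      (BB.instAux σ ts).eqn (e₁.instAux σ ts) (e₂.instAux σ ts) := by
  induction BB <;> simp [Bdry.eqn, Bdry.instAux, Arg.instAux, *] <;> rfl

/-- Simultaneous action of an instantiation and of a substitution on judgements and boundaries. -/
def Stmt.ms (I : Inst S ν μ k) (σ : Fin n → Tm S μ k) : Stmt S ν c m n → Stmt S μ c m k
  | .judg BB e => .judg (BB.ms I σ) (e.ms I σ)
  | .bdry BB => .bdry (BB.ms I σ)

theorem Stmt.eqn_ms (BB : Bdry S ν c m n) (e₁ e₂ : Arg S ν c m n) (I : Inst S ν μ k)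
    (σ : Fin n → Tm S μ k) :
    (Stmt.eqn BB e₁ e₂).ms I σ = .eqn (BB.ms I σ) (e₁.ms I σ) (e₂.ms I σ) := by
  simp only [Stmt.eqn, Stmt.ms, Bdry.eqn_ms]
  congr 1
  exact Arg.eq_of_not_isObj c.eqn_not_isObj _ _

end BoundarySyntax

/-! ### Preservation of derivability -/

section Transport

variable {S : Signature.{u}} {T : RawTheory.{u, v} S} {μ ν ξ : List MArity} {c : Cls}
  {m n k l : ℕ}

/-- The instantiation `I` respects the rules for applications of metavariables. -/
structure RawTheory.MVarClosed (T : RawTheory.{u, v} S) (Ξ : MCtx S ν) (Θ : MCtx S μ)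
    (Δ : Ctx S μ k) (I : Inst S ν μ k) : Prop where
  app : ∀ {c : Cls} {m : ℕ} (M : MVar ν ⟨c, m⟩) (ts : Fin m → Tm S μ k),
    (∀ j, T.Derives Θ Δ (.judg (.tm ((Ξ.get M).msArgTy I Fin.elim0 ts j)) (ts j))) →
    T.Derives Θ Δ (.bdry ((Ξ.get M).msAux I Fin.elim0 ts)) →
    T.Derives Θ Δ (.judg ((Ξ.get M).msAux I Fin.elim0 ts) ((I _ M).inst ts))
  congrTy : ∀ {m : ℕ} (M : MVar ν ⟨.ty, m⟩) (ss ts : Fin m → Tm S μ k),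
    (∀ j, T.Derives Θ Δ (.judg (.tm ((Ξ.get M).msArgTy I Fin.elim0 ss j)) (ss j))) →
    (∀ j, T.Derives Θ Δ (.judg (.tm ((Ξ.get M).msArgTy I Fin.elim0 ts j)) (ts j))) →
    (∀ j, T.Derives Θ Δ
      (.judg (.eqTm (ss j) (ts j) ((Ξ.get M).msArgTy I Fin.elim0 ss j)) .starTm)) →
    T.Derives Θ Δ (.judg (.eqTy ((I _ M).inst ss) ((I _ M).inst ts)) .starTy)
  congrTm : ∀ {m : ℕ} (M : MVar ν ⟨.tm, m⟩) (ss ts : Fin m → Tm S μ k),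
    (∀ j, T.Derives Θ Δ (.judg (.tm ((Ξ.get M).msArgTy I Fin.elim0 ss j)) (ss j))) →
    (∀ j, T.Derives Θ Δ (.judg (.tm ((Ξ.get M).msArgTy I Fin.elim0 ts j)) (ts j))) →
    (∀ j, T.Derives Θ Δ
      (.judg (.eqTm (ss j) (ts j) ((Ξ.get M).msArgTy I Fin.elim0 ss j)) .starTm)) →
    T.Derives Θ Δ (.judg (.eqTy ((Ξ.get M).msAux I Fin.elim0 ss).type
      ((Ξ.get M).msAux I Fin.elim0 ts).type) .starTy) →
    T.Derives Θ Δ (.judg (.eqTm ((I _ M).inst ss) ((I _ M).inst ts)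
      ((Ξ.get M).msAux I Fin.elim0 ss).type) .starTm)

/-- A class of pairs of an instantiation and a substitution along which derivability can be
transported. -/
structure RawTheory.Transports (T : RawTheory.{u, v} S) (Ξ : MCtx S ν) (Θ : MCtx S μ)
    (G : ∀ {n k : ℕ}, Ctx S ν n → Ctx S μ k → Inst S ν μ k → (Fin n → Tm S μ k) → Prop) :
    Prop where
  var : ∀ {n k : ℕ} {Γ : Ctx S ν n} {Δ : Ctx S μ k} {I : Inst S ν μ k} {σ : Fin n → Tm S μ k},
    G Γ Δ I σ → ∀ i, T.Derives Θ Δ (.judg (.tm ((Γ.get i).ms I σ)) (σ i))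
  lift : ∀ {n k : ℕ} {Γ : Ctx S ν n} {Δ : Ctx S μ k} {I : Inst S ν μ k} {σ : Fin n → Tm S μ k},
    G Γ Δ I σ → ∀ A : Ty S ν n, T.Derives Θ Δ (.judg .ty (A.ms I σ)) →
    G (Γ.snoc A) (Δ.snoc (A.ms I σ)) I.wk (liftSub σ)
  closed : ∀ {n k : ℕ} {Γ : Ctx S ν n} {Δ : Ctx S μ k} {I : Inst S ν μ k} {σ : Fin n → Tm S μ k},
    G Γ Δ I σ → T.MVarClosed Ξ Θ Δ I

/-- All rules except those for variables and for metavariables are visibly stable under `ms`;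
specific rules are stable because `I` acts on the instantiation used in them. The exceptions and the
passage under a binder are the fields of `Transports`. -/
theorem RawTheory.Transports.derives {Ξ : MCtx S ν} {Θ : MCtx S μ}
    {G : ∀ {n k : ℕ}, Ctx S ν n → Ctx S μ k → Inst S ν μ k → (Fin n → Tm S μ k) → Prop}
    (hG : T.Transports Ξ Θ G) {Γ : Ctx S ν n} {J : Stmt S ν c m n} (h : T.Derives Ξ Γ J)
    {Δ : Ctx S μ k} {I : Inst S ν μ k} {σ : Fin n → Tm S μ k} (hg : G Γ Δ I σ) :
    T.Derives Θ Δ (J.ms I σ) := by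
  induction h generalizing k with
  | var a => exact hG.var hg a
  | mvar M ts _ _ ih₁ ih₂ =>
    simp only [Stmt.ms, Bdry.ms, Bdry.inst_ms, Bdry.argTy_ms, Arg.mapp_ms] at *
    exact (hG.closed hg).app M _ (fun j => ih₁ j hg) (ih₂ hg)
  | mvarCongrTy M ss ts _ _ _ ih₁ ih₂ ih₃ =>
    simp only [Stmt.ms, Bdry.ms, Bdry.argTy_ms, Arg.mapp_ms, Arg.ms] at *
    exact (hG.closed hg).congrTy M _ _ (fun j => ih₁ j hg) (fun j => ih₂ j hg) (fun j => ih₃ j hg)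
  | mvarCongrTm M ss ts _ _ _ _ ih₁ ih₂ ih₃ ih₄ =>
    simp only [Stmt.ms, Bdry.ms, Bdry.argTy_ms, Arg.mapp_ms, Arg.ms, ← Bdry.type_ms,
      Bdry.inst_ms] at *
    exact (hG.closed hg).congrTm M _ _ (fun j => ih₁ j hg) (fun j => ih₂ j hg)
      (fun j => ih₃ j hg) (ih₄ hg)
  | abs _ _ ih₁ ih₂ => exact .abs (ih₁ hg) (ih₂ (hG.lift hg _ (ih₁ hg)))
  | tyRefl _ ih => exact .tyRefl (ih hg)
  | tySym _ ih => exact .tySym (ih hg)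
  | tyTran _ _ ih₁ ih₂ => exact .tyTran (ih₁ hg) (ih₂ hg)
  | tmRefl _ ih => exact .tmRefl (ih hg)
  | tmSym _ ih => exact .tmSym (ih hg)
  | tmTran _ _ ih₁ ih₂ => exact .tmTran (ih₁ hg) (ih₂ hg)
  | convTm _ _ ih₁ ih₂ => exact .convTm (ih₁ hg) (ih₂ hg)
  | convEq _ _ ih₁ ih₂ => exact .convEq (ih₁ hg) (ih₂ hg)
  | bdryTy => exact .bdryTy
  | bdryTm _ ih => exact .bdryTm (ih hg)
  | bdryEqTy _ _ ih₁ ih₂ => exact .bdryEqTy (ih₁ hg) (ih₂ hg)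
  | bdryEqTm _ _ _ ih₁ ih₂ ih₃ => exact .bdryEqTm (ih₁ hg) (ih₂ hg) (ih₃ hg)
  | bdryAbs _ _ ih₁ ih₂ => exact .bdryAbs (ih₁ hg) (ih₂ (hG.lift hg _ (ih₁ hg)))
  | rule i J _ _ ih₁ ih₂ =>
    simp only [Stmt.ms, Bdry.actC_ms, Arg.actC_ms] at *
    exact .rule i _ (fun α M => ih₁ α M hg) (ih₂ hg)
  | congrTy i J K _ _ _ ih₁ ih₂ ih₃ =>
    simp only [Stmt.ms, Bdry.ms, Bdry.actC_ms, Arg.actC_ms, Arg.ms] at ih₁ ih₂ ⊢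
    exact .congrTy i _ _ (fun α M => ih₁ α M hg) (fun α M => ih₂ α M hg)
      (fun α M h => by
        simpa only [Stmt.eqn_ms, Bdry.actC_ms, Inst.ms] using ih₃ α M h hg)
  | congrTm i J K _ _ _ _ ih₁ ih₂ ih₃ ih₄ =>
    simp only [Stmt.ms, Bdry.ms, Bdry.actC_ms, Arg.actC_ms, Arg.ms,
      ← Bdry.type_ms] at ih₁ ih₂ ih₄ ⊢
    exact .congrTm i _ _ (fun α M => ih₁ α M hg) (fun α M => ih₂ α M hg)
      (fun α M h => by
        simpa only [Stmt.eqn_ms, Bdry.actC_ms, Inst.ms] using ih₃ α M h hg) (ih₄ hg)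

/-- The renaming `ρ` of metavariables respects boundaries. -/
def MCtx.Ren (Ξ : MCtx S ν) (Θ : MCtx S μ) (ρ : ∀ α : MArity, MVar ν α → MVar μ α) : Prop :=
  ∀ (α : MArity) (M : MVar ν α), Θ.get (ρ α M) = (Ξ.get M).mrename ρ

theorem MCtx.Ren.mvarClosed {Ξ : MCtx S ν} {Θ : MCtx S μ}
    {ρ : ∀ α : MArity, MVar ν α → MVar μ α} (h : Ξ.Ren Θ ρ) (Δ : Ctx S μ k) :
    T.MVarClosed Ξ Θ Δ (Inst.gen ρ) where
  app M ts h₁ h₂ := by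
    simp only [← Bdry.mrename_inst, ← Bdry.mrename_argTy, ← h _ M, Inst.gen, genApp_inst] at *
    exact .mvar _ ts h₁ h₂
  congrTy M ss ts h₁ h₂ h₃ := by
    simp only [← Bdry.mrename_argTy, ← h _ M, Inst.gen, genApp_inst] at *
    exact .mvarCongrTy _ ss ts h₁ h₂ h₃
  congrTm M ss ts h₁ h₂ h₃ h₄ := by
    simp only [← Bdry.mrename_inst, ← Bdry.mrename_argTy, ← h _ M, Inst.gen, genApp_inst] at *
    exact .mvarCongrTm _ ss ts h₁ h₂ h₃ h₄

theorem MCtx.Ren.id (Θ : MCtx S μ) : Θ.Ren Θ (fun _ M => M) := by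
  intro α M
  rw [Bdry.mrename_eq_ms, Bdry.ms_gen_var]

/-- The pair of an instantiation and a substitution is a renaming. -/
def IsRen (ρm : ∀ α : MArity, MVar ν α → MVar μ α) {n k : ℕ} (Γ : Ctx S ν n) (Δ : Ctx S μ k)
    (I : Inst S ν μ k) (σ : Fin n → Tm S μ k) : Prop :=
  I = Inst.gen ρm ∧ ∃ ρ : Fin n → Fin k, σ = (fun i => .var (ρ i)) ∧
    ∀ i, Δ.get (ρ i) = (Γ.get i).ms I σ

theorem rename_succ_ms (A : Arg S ν c m n) (I : Inst S ν μ k) (σ : Fin n → Tm S μ k) :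
    (A.rename Fin.succ).ms I.wk (liftSub σ) = (A.ms I σ).rename Fin.succ := by
  rw [Arg.ms_rename, Arg.rename_ms]
  rfl

theorem Ctx.get_zero (Γ : Ctx S μ n) (A : Ty S μ n) :
    (Γ.snoc A).get 0 = A.rename Fin.succ := rfl

theorem Ctx.get_succ (Γ : Ctx S μ n) (A : Ty S μ n) (i : Fin n) :
    (Γ.snoc A).get i.succ = (Γ.get i).rename Fin.succ := rfl

/-- Renamings come before substitutions, since extending a well-typed substitution under a binder
already requires weakening. -/
theorem MCtx.Ren.transports_ren {Ξ : MCtx S ν} {Θ : MCtx S μ}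
    {ρm : ∀ α : MArity, MVar ν α → MVar μ α} (h : Ξ.Ren Θ ρm) :
    T.Transports Ξ Θ (IsRen ρm) where
  var := by
    rintro n k Γ Δ _ _ ⟨rfl, ρ, rfl, h⟩ i
    rw [← h]
    exact .var _
  lift := by
    rintro n k Γ Δ I σ ⟨rfl, ρ, rfl, h⟩ A -
    refine ⟨Inst.gen_wk _, liftRen ρ, liftSub_ren ρ, fun i => ?_⟩
    refine Fin.cases ?_ (fun i => ?_) i
    · simp only [liftRen_zero, Ctx.get_zero, rename_succ_ms]
    · simp only [liftRen_succ, Ctx.get_succ, rename_succ_ms, h]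
  closed := by
    rintro n k Γ Δ _ _ ⟨rfl, -⟩
    exact h.mvarClosed Δ

theorem IsRen.succ (Γ : Ctx S μ n) (A : Ty S μ n) :
    IsRen (fun _ M => M) Γ (Γ.snoc A) (Inst.gen fun _ M => M) (fun i => .var i.succ) :=
  ⟨rfl, Fin.succ, rfl, fun i => by rw [Ctx.get_succ, Arg.rename_eq_subst, Arg.subst_eq_ms]⟩

theorem RawTheory.Derives.weaken {Θ : MCtx S μ} {Γ : Ctx S μ n} {BB : Bdry S μ c m n}
    {e : Arg S μ c m n} (h : T.Derives Θ Γ (.judg BB e)) (A : Ty S μ n) :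
    T.Derives Θ (Γ.snoc A) (.judg (BB.rename Fin.succ) (e.rename Fin.succ)) := by
  rw [Bdry.rename_eq_ms, Arg.rename_eq_subst, Arg.subst_eq_ms]
  exact (MCtx.Ren.id Θ).transports_ren.derives h (IsRen.succ Γ A)

/-- The substitution `σ` is well-typed, where metavariables are instantiated by `I`. -/
def RawTheory.WSub (T : RawTheory.{u, v} S) (Θ : MCtx S μ) (Γ : Ctx S ν n) (Δ : Ctx S μ k)
    (I : Inst S ν μ k) (σ : Fin n → Tm S μ k) : Prop :=
  ∀ i, T.Derives Θ Δ (.judg (.tm ((Γ.get i).ms I σ)) (σ i))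

theorem RawTheory.WSub.lift {Θ : MCtx S μ} {Γ : Ctx S ν n} {Δ : Ctx S μ k} {I : Inst S ν μ k}
    {σ : Fin n → Tm S μ k} (h : T.WSub Θ Γ Δ I σ) (A : Ty S ν n) :
    T.WSub Θ (Γ.snoc A) (Δ.snoc (A.ms I σ)) I.wk (liftSub σ) := by
  intro i
  refine Fin.cases ?_ (fun i => ?_) i
  · rw [Ctx.get_zero, rename_succ_ms]
    exact .var 0
  · rw [Ctx.get_succ, rename_succ_ms]
    exact (h i).weaken _

theorem MCtx.Ren.transports {Ξ : MCtx S ν} {Θ : MCtx S μ}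
    {ρm : ∀ α : MArity, MVar ν α → MVar μ α} (h : Ξ.Ren Θ ρm) :
    T.Transports Ξ Θ (fun Γ Δ I σ => I = Inst.gen ρm ∧ T.WSub Θ Γ Δ I σ) where
  var hg := hg.2
  lift := by
    rintro n k Γ Δ I σ ⟨rfl, h⟩ A -
    exact ⟨Inst.gen_wk _, h.lift A⟩
  closed := by
    rintro n k Γ Δ _ _ ⟨rfl, -⟩
    exact h.mvarClosed Δ

/-- The generic instantiation of a metavariable context by itself. -/
abbrev Inst.idn : Inst S μ μ n := Inst.gen fun _ M => M

theorem RawTheory.Derives.ms_gen {Ξ : MCtx S ν} {Θ : MCtx S μ}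
    {ρm : ∀ α : MArity, MVar ν α → MVar μ α} {Γ : Ctx S ν n} {J : Stmt S ν c m n}
    (h : T.Derives Ξ Γ J) (hρ : Ξ.Ren Θ ρm) {Δ : Ctx S μ k} {σ : Fin n → Tm S μ k}
    (hσ : T.WSub Θ Γ Δ (Inst.gen ρm) σ) : T.Derives Θ Δ (J.ms (Inst.gen ρm) σ) :=
  hρ.transports.derives h ⟨rfl, hσ⟩

theorem RawTheory.Derives.ms_idn {Θ : MCtx S μ} {Γ : Ctx S μ n} {J : Stmt S μ c m n}
    (h : T.Derives Θ Γ J) {Δ : Ctx S μ k} {σ : Fin n → Tm S μ k}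
    (hσ : T.WSub Θ Γ Δ Inst.idn σ) : T.Derives Θ Δ (J.ms Inst.idn σ) :=
  h.ms_gen (MCtx.Ren.id Θ) hσ

end Transport

/-! ### Inversion of abstractions and boundaries -/

section Inversion

variable {S : Signature.{u}} {T : RawTheory.{u, v} S} {μ ν ξ : List MArity} {c : Cls}
  {m n k l : ℕ} {Θ : MCtx S μ}

theorem RawTheory.Derives.abs_inv {Γ : Ctx S μ n} {A : Ty S μ n} {BB : Bdry S μ c m (n + 1)}
    {e : Arg S μ c (m + 1) n} (h : T.Derives Θ Γ (.judg (.abs A BB) e)) :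
    T.Derives Θ Γ (.judg .ty A) ∧ T.Derives Θ (Γ.snoc A) (.judg BB e.body) := by
  cases h with
  | abs h₁ h₂ => exact ⟨h₁, h₂⟩

theorem RawTheory.Derives.bdryAbs_inv {Γ : Ctx S μ n} {A : Ty S μ n}
    {BB : Bdry S μ c m (n + 1)} (h : T.Derives Θ Γ (.bdry (.abs A BB))) :
    T.Derives Θ Γ (.judg .ty A) ∧ T.Derives Θ (Γ.snoc A) (.bdry BB) := by
  cases h with
  | bdryAbs h₁ h₂ => exact ⟨h₁, h₂⟩

theorem RawTheory.Derives.bdryTm_inv {Γ : Ctx S μ n} {A : Ty S μ n}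
    (h : T.Derives Θ Γ (.bdry (.tm A))) : T.Derives Θ Γ (.judg .ty A) := by
  cases h with
  | bdryTm h => exact h

theorem RawTheory.Derives.bdryEqTy_inv {Γ : Ctx S μ n} {A B : Ty S μ n}
    (h : T.Derives Θ Γ (.bdry (.eqTy A B))) :
    T.Derives Θ Γ (.judg .ty A) ∧ T.Derives Θ Γ (.judg .ty B) := by
  cases h with
  | bdryEqTy h₁ h₂ => exact ⟨h₁, h₂⟩

theorem RawTheory.Derives.bdryEqTm_inv {Γ : Ctx S μ n} {s t : Tm S μ n} {A : Ty S μ n}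
    (h : T.Derives Θ Γ (.bdry (.eqTm s t A))) :
    T.Derives Θ Γ (.judg .ty A) ∧ T.Derives Θ Γ (.judg (.tm A) s) ∧
      T.Derives Θ Γ (.judg (.tm A) t) := by
  cases h with
  | bdryEqTm h₁ h₂ h₃ => exact ⟨h₁, h₂, h₃⟩

/-- A boundary has a unique last rule, so the sides of a well-formed equation boundary can be read
off, also under abstractions. Every presupposition of an equation is used through this. -/
theorem RawTheory.Derives.eqn_bdry_inv (hc : c.IsObj) {Γ : Ctx S μ n} {BB : Bdry S μ c m n}
    {e₁ e₂ : Arg S μ c m n} (h : T.Derives Θ Γ (.bdry (BB.eqn e₁ e₂))) :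
    T.Derives Θ Γ (.judg BB e₁) ∧ T.Derives Θ Γ (.judg BB e₂) := by
  induction BB with
  | ty => exact h.bdryEqTy_inv
  | tm A => exact h.bdryEqTm_inv.2
  | eqTy A B => rcases hc with h | h <;> cases h
  | eqTm s t A => rcases hc with h | h <;> cases h
  | abs A BB ih =>
    obtain ⟨h₁, h₂⟩ := h.bdryAbs_inv
    obtain ⟨h₃, h₄⟩ := ih hc h₂
    rw [← e₁.abs_body, ← e₂.abs_body]
    exact ⟨.abs h₁ h₃, .abs h₁ h₄⟩

theorem Bdry.eq_ty (B : Bdry S μ .ty 0 n) : B = .ty := by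
  cases B; rfl

theorem Bdry.eq_tm (B : Bdry S μ .tm 0 n) : B = .tm B.type := by
  cases B; rfl

theorem Stmt.eqn_ty (B : Bdry S μ .ty 0 n) (A A' : Ty S μ n) :
    Stmt.eqn B A A' = .judg (.eqTy A A') .starTy := by
  cases B; rfl

theorem Stmt.eqn_tm (B : Bdry S μ .tm 0 n) (s t : Tm S μ n) :
    Stmt.eqn B s t = .judg (.eqTm s t B.type) .starTm := by
  cases B; rfl

theorem Stmt.eqn_abs (A : Ty S μ n) (BB : Bdry S μ c m (n + 1)) (e₁ e₂ : Arg S μ c (m + 1) n) :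
    Stmt.eqn (.abs A BB) e₁ e₂ =
      .judg (.abs A (BB.eqn e₁.body e₂.body)) (.abs (Arg.dummy c m)) := rfl

theorem RawTheory.Derives.eqn_abs_inv {Γ : Ctx S μ n} {A : Ty S μ n}
    {BB : Bdry S μ c m (n + 1)} {e₁ e₂ : Arg S μ c (m + 1) n}
    (h : T.Derives Θ Γ (.eqn (.abs A BB) e₁ e₂)) :
    T.Derives Θ Γ (.judg .ty A) ∧ T.Derives Θ (Γ.snoc A) (.eqn BB e₁.body e₂.body) := by
  rw [Stmt.eqn_abs] at h
  exact h.abs_inv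

theorem RawTheory.Derives.eqn_trans (hc : c.IsObj) {Γ : Ctx S μ n} {BB : Bdry S μ c m n}
    {e₁ e₂ e₃ : Arg S μ c m n} (h₁ : T.Derives Θ Γ (.eqn BB e₁ e₂))
    (h₂ : T.Derives Θ Γ (.eqn BB e₂ e₃)) : T.Derives Θ Γ (.eqn BB e₁ e₃) := by
  induction BB with
  | ty => exact h₁.tyTran h₂
  | tm A => exact h₁.tmTran h₂
  | eqTy A B => rcases hc with h | h <;> cases h
  | eqTm s t A => rcases hc with h | h <;> cases h
  | abs A BB ih =>
    exact .abs h₁.eqn_abs_inv.1 (ih hc h₁.eqn_abs_inv.2 h₂.eqn_abs_inv.2)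

theorem RawTheory.Derives.eqn_refl (hc : c.IsObj) {Γ : Ctx S μ n} {BB : Bdry S μ c m n}
    {e : Arg S μ c m n} (h : T.Derives Θ Γ (.judg BB e)) : T.Derives Θ Γ (.eqn BB e e) := by
  induction BB with
  | ty => exact .tyRefl h
  | tm A => exact .tmRefl h
  | eqTy A B => rcases hc with h | h <;> cases h
  | eqTm s t A => rcases hc with h | h <;> cases h
  | abs A BB ih => exact .abs h.abs_inv.1 (ih hc h.abs_inv.2)

end Inversion

/-! ### Convertible boundaries -/

section Conv

variable {S : Signature.{u}} {T : RawTheory.{u, v} S} {μ ν ξ : List MArity} {c : Cls}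
  {m n k l : ℕ} {Θ : MCtx S μ}

/-- Judgementally equal boundaries. -/
inductive RawTheory.BdryConv (T : RawTheory.{u, v} S) (Θ : MCtx S μ) :
    {n : ℕ} → Ctx S μ n → {c : Cls} → {m : ℕ} → Bdry S μ c m n → Bdry S μ c m n → Prop
  | ty {n : ℕ} {Γ : Ctx S μ n} : T.BdryConv Θ Γ .ty .ty
  | tm {n : ℕ} {Γ : Ctx S μ n} {A A' : Ty S μ n} :
      T.Derives Θ Γ (.judg (.eqTy A A') .starTy) → T.BdryConv Θ Γ (.tm A) (.tm A')
  | eqTy {n : ℕ} {Γ : Ctx S μ n} {A A' B B' : Ty S μ n} :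
      T.Derives Θ Γ (.judg (.eqTy A A') .starTy) → T.Derives Θ Γ (.judg (.eqTy B B') .starTy) →
      T.BdryConv Θ Γ (.eqTy A B) (.eqTy A' B')
  | eqTm {n : ℕ} {Γ : Ctx S μ n} {s s' t t' : Tm S μ n} {A A' : Ty S μ n} :
      T.Derives Θ Γ (.judg (.eqTm s s' A) .starTm) →
      T.Derives Θ Γ (.judg (.eqTm t t' A) .starTm) →
      T.Derives Θ Γ (.judg (.eqTy A A') .starTy) →
      T.BdryConv Θ Γ (.eqTm s t A) (.eqTm s' t' A')
  | abs {n : ℕ} {Γ : Ctx S μ n} {c : Cls} {m : ℕ} {A A' : Ty S μ n}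
      {BB BB' : Bdry S μ c m (n + 1)} :
      T.Derives Θ Γ (.judg (.eqTy A A') .starTy) → T.BdryConv Θ (Γ.snoc A) BB BB' →
      T.BdryConv Θ Γ (.abs A BB) (.abs A' BB')

theorem RawTheory.BdryConv.type {Γ : Ctx S μ n} {B B' : Bdry S μ .tm 0 n}
    (h : T.BdryConv Θ Γ B B') : T.Derives Θ Γ (.judg (.eqTy B.type B'.type) .starTy) := by
  cases h with
  | tm h => exact h

/-- Conversion of the type of the last variable of a context. -/
theorem RawTheory.Derives.snoc_conv {Γ : Ctx S μ n} {A A' : Ty S μ n}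
    {J : Stmt S μ c m (n + 1)} (h : T.Derives Θ (Γ.snoc A) J)
    (hA : T.Derives Θ Γ (.judg (.eqTy A' A) .starTy)) : T.Derives Θ (Γ.snoc A') J := by
  -- The identity substitution remains well typed, the last variable being retyped by conversion.
  have hσ : T.WSub Θ (Γ.snoc A) (Γ.snoc A') Inst.idn Arg.var := by
    intro i
    rw [Arg.ms_gen_var]
    refine Fin.cases ?_ (fun i => ?_) i
    · exact .convTm (.var 0) (hA.weaken A')
    · exact .var (Γ := Γ.snoc A') i.succ
  have := h.ms_idn hσ
  cases J <;> simpa only [Stmt.ms, Bdry.ms_gen_var, Arg.ms_gen_var] using this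

/-- Well-formedness of `BB'` is assumed because the abstraction rule asks for `A'` to be a type, and
no well-formed context is at hand to extract this from the equation. -/
theorem RawTheory.BdryConv.judg {Γ : Ctx S μ n} {BB BB' : Bdry S μ c m n}
    (h : T.BdryConv Θ Γ BB BB') {e : Arg S μ c m n} (he : T.Derives Θ Γ (.judg BB e))
    (hBB' : T.Derives Θ Γ (.bdry BB')) : T.Derives Θ Γ (.judg BB' e) := by
  induction h with
  | ty => exact he
  | tm h => exact .convTm he h
  | eqTy h₁ h₂ =>
    rw [Arg.eq_of_not_isObj (Cls.eqn_not_isObj .ty) e .starTy] at he ⊢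
    exact (h₁.tySym.tyTran he).tyTran h₂
  | eqTm h₁ h₂ h₃ =>
    rw [Arg.eq_of_not_isObj (Cls.eqn_not_isObj .tm) e .starTm] at he ⊢
    exact .convEq ((h₁.tmSym.tmTran he).tmTran h₂) h₃
  | abs h₁ _ ih =>
    obtain ⟨-, h₄⟩ := he.abs_inv
    obtain ⟨h₅, h₆⟩ := hBB'.bdryAbs_inv
    rw [← e.abs_body]
    -- Convertibility of the bodies is known over `A`, so the boundary is moved from `A'` to `A`
    -- before the induction hypothesis and the result is moved back.
    exact .abs h₅ ((ih h₄ (h₆.snoc_conv h₁)).snoc_conv h₁.tySym)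

theorem RawTheory.BdryConv.refl {Γ : Ctx S μ n} {BB : Bdry S μ c m n}
    (h : T.Derives Θ Γ (.bdry BB)) : T.BdryConv Θ Γ BB BB := by
  induction BB with
  | ty => exact .ty
  | tm A => exact .tm h.bdryTm_inv.tyRefl
  | eqTy A B => exact .eqTy h.bdryEqTy_inv.1.tyRefl h.bdryEqTy_inv.2.tyRefl
  | eqTm s t A =>
    exact .eqTm h.bdryEqTm_inv.2.1.tmRefl h.bdryEqTm_inv.2.2.tmRefl h.bdryEqTm_inv.1.tyRefl
  | abs A BB ih => exact .abs h.bdryAbs_inv.1.tyRefl (ih h.bdryAbs_inv.2)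

/-! ### Preservation of equality -/

/-- A class of pairs of equal instantiations and substitutions along which object judgements give
equations. -/
structure RawTheory.EqTransports (T : RawTheory.{u, v} S) (Ξ : MCtx S ν) (Θ : MCtx S μ)
    (G : ∀ {n k : ℕ}, Ctx S ν n → Ctx S μ k → Inst S ν μ k → (Fin n → Tm S μ k) →
      Inst S ν μ k → (Fin n → Tm S μ k) → Prop) : Prop where
  left : ∀ {n k : ℕ} {Γ : Ctx S ν n} {Δ : Ctx S μ k} {I I' : Inst S ν μ k}
    {σ σ' : Fin n → Tm S μ k}, G Γ Δ I σ I' σ' → ∀ {c : Cls} {m : ℕ} {J : Stmt S ν c m n},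
    T.Derives Ξ Γ J → T.Derives Θ Δ (J.ms I σ)
  right : ∀ {n k : ℕ} {Γ : Ctx S ν n} {Δ : Ctx S μ k} {I I' : Inst S ν μ k}
    {σ σ' : Fin n → Tm S μ k}, G Γ Δ I σ I' σ' → ∀ {c : Cls} {m : ℕ} {J : Stmt S ν c m n},
    T.Derives Ξ Γ J → T.Derives Θ Δ (J.ms I' σ')
  var : ∀ {n k : ℕ} {Γ : Ctx S ν n} {Δ : Ctx S μ k} {I I' : Inst S ν μ k}
    {σ σ' : Fin n → Tm S μ k}, G Γ Δ I σ I' σ' → ∀ i,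
    T.Derives Θ Δ (.judg (.eqTm (σ i) (σ' i) ((Γ.get i).ms I σ)) .starTm)
  lift : ∀ {n k : ℕ} {Γ : Ctx S ν n} {Δ : Ctx S μ k} {I I' : Inst S ν μ k}
    {σ σ' : Fin n → Tm S μ k}, G Γ Δ I σ I' σ' → ∀ {A : Ty S ν n},
    T.Derives Ξ Γ (.judg .ty A) →
    T.Derives Θ Δ (.judg (.eqTy (A.ms I σ) (A.ms I' σ')) .starTy) →
    G (Γ.snoc A) (Δ.snoc (A.ms I σ)) I.wk (liftSub σ) I'.wk (liftSub σ')
  congr : ∀ {n k : ℕ} {Γ : Ctx S ν n} {Δ : Ctx S μ k} {I I' : Inst S ν μ k}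
    {σ σ' : Fin n → Tm S μ k}, G Γ Δ I σ I' σ' → ∀ {c : Cls} {m : ℕ} (_ : c.IsObj)
    (M : MVar ν ⟨c, m⟩) {ss ts : Fin m → Tm S μ k},
    (∀ j, T.Derives Θ Δ (.judg (.tm ((Ξ.get M).msArgTy I Fin.elim0 ss j)) (ss j))) →
    (∀ j, T.Derives Θ Δ (.judg (.tm ((Ξ.get M).msArgTy I' Fin.elim0 ts j)) (ts j))) →
    (∀ j, T.Derives Θ Δ
      (.judg (.eqTm (ss j) (ts j) ((Ξ.get M).msArgTy I Fin.elim0 ss j)) .starTm)) →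
    T.BdryConv Θ Δ ((Ξ.get M).msAux I Fin.elim0 ss) ((Ξ.get M).msAux I' Fin.elim0 ts) →
    T.Derives Θ Δ (.eqn ((Ξ.get M).msAux I Fin.elim0 ss) ((I _ M).inst ss) ((I' _ M).inst ts))

/-- The equation between two instances of an object judgement or of a boundary. -/
def RawTheory.EqInstances (T : RawTheory.{u, v} S) (Θ : MCtx S μ) (Δ : Ctx S μ k)
    (I : Inst S ν μ k) (σ : Fin n → Tm S μ k) (I' : Inst S ν μ k) (σ' : Fin n → Tm S μ k) :
    Stmt S ν c m n → Prop
  | .judg BB e => c.IsObj → T.Derives Θ Δ (.eqn (BB.ms I σ) (e.ms I σ) (e.ms I' σ'))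
  | .bdry BB => T.BdryConv Θ Δ (BB.ms I σ) (BB.ms I' σ')

theorem Cls.not_isObj_eqTy : ¬ Cls.eqTy.IsObj := Cls.eqn_not_isObj .ty

theorem Cls.not_isObj_eqTm : ¬ Cls.eqTm.IsObj := Cls.eqn_not_isObj .tm

/-- Object judgements and boundaries must be treated together: the congruence rules for term heads
require equality of the two instantiated types, and this comes from the boundary premise of the
metavariable rule or of the specific rule. Equations need no statement. -/
theorem RawTheory.EqTransports.eqInstances {Ξ : MCtx S ν}
    {G : ∀ {n k : ℕ}, Ctx S ν n → Ctx S μ k → Inst S ν μ k → (Fin n → Tm S μ k) →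
      Inst S ν μ k → (Fin n → Tm S μ k) → Prop}
    (hG : T.EqTransports Ξ Θ G) {Γ : Ctx S ν n} {J : Stmt S ν c m n} (h : T.Derives Ξ Γ J)
    {Δ : Ctx S μ k} {I I' : Inst S ν μ k} {σ σ' : Fin n → Tm S μ k} (hg : G Γ Δ I σ I' σ') :
    T.EqInstances Θ Δ I σ I' σ' J := by
  induction h generalizing k with
  | var a => exact fun _ => hG.var hg a
  | mvar M ts h₁ h₂ ih₁ ih₂ =>
    intro hc
    have l₁ := fun j => hG.left hg (h₁ j)
    have r₁ := fun j => hG.right hg (h₁ j)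
    have e₁ := fun j => ih₁ j hg (Or.inr rfl)
    have e₂ := ih₂ hg
    simp only [EqInstances, Stmt.ms, Bdry.ms, Bdry.inst_ms, Bdry.argTy_ms, Arg.mapp_ms] at *
    exact hG.congr hg hc M l₁ r₁ e₁ e₂
  | mvarCongrTy => exact fun h => absurd h Cls.not_isObj_eqTy
  | mvarCongrTm => exact fun h => absurd h Cls.not_isObj_eqTm
  | abs h₁ _ ih₁ ih₂ =>
    intro hc
    exact .abs (hG.left hg h₁) (ih₂ (hG.lift hg h₁ (ih₁ hg (Or.inl rfl))) hc)
  | tyRefl => exact fun h => absurd h Cls.not_isObj_eqTy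
  | tySym => exact fun h => absurd h Cls.not_isObj_eqTy
  | tyTran => exact fun h => absurd h Cls.not_isObj_eqTy
  | tmRefl => exact fun h => absurd h Cls.not_isObj_eqTm
  | tmSym => exact fun h => absurd h Cls.not_isObj_eqTm
  | tmTran => exact fun h => absurd h Cls.not_isObj_eqTm
  | convTm _ h₂ ih₁ _ => exact fun hc => .convEq (ih₁ hg hc) (hG.left hg h₂)
  | convEq => exact fun h => absurd h Cls.not_isObj_eqTm
  | bdryTy => exact .ty
  | bdryTm _ ih => exact .tm (ih hg (Or.inl rfl))
  | bdryEqTy _ _ ih₁ ih₂ => exact .eqTy (ih₁ hg (Or.inl rfl)) (ih₂ hg (Or.inl rfl))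
  | bdryEqTm _ _ _ ih₁ ih₂ ih₃ =>
    exact .eqTm (ih₂ hg (Or.inr rfl)) (ih₃ hg (Or.inr rfl)) (ih₁ hg (Or.inl rfl))
  | bdryAbs h₁ _ ih₁ ih₂ =>
    exact .abs (ih₁ hg (Or.inl rfl)) (ih₂ (hG.lift hg h₁ (ih₁ hg (Or.inl rfl))))
  | rule i J h₁ h₂ ih₁ ih₂ =>
    intro hc
    have l₁ := fun α M => hG.left hg (h₁ α M)
    have r₁ := fun α M => hG.right hg (h₁ α M)
    have e₁ := fun α M => ih₁ α M hg
    have e₂ := ih₂ hg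
    simp only [EqInstances, Stmt.ms, Bdry.actC_ms, Arg.actC_ms] at l₁ r₁ e₁ e₂ ⊢
    rcases hc with rfl | rfl
    · rw [Stmt.eqn_ty]
      exact .congrTy i _ _ l₁ r₁ e₁
    · rw [Stmt.eqn_tm]
      exact .congrTm i _ _ l₁ r₁ e₁ e₂.type
  | congrTy => exact fun h => absurd h Cls.not_isObj_eqTy
  | congrTm => exact fun h => absurd h Cls.not_isObj_eqTm

/-- Pairs of equal substitutions. -/
structure RawTheory.ESub (T : RawTheory.{u, v} S) (Θ : MCtx S μ) (Γ : Ctx S μ n) (Δ : Ctx S μ k)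
    (σ σ' : Fin n → Tm S μ k) : Prop where
  left : T.WSub Θ Γ Δ Inst.idn σ
  right : T.WSub Θ Γ Δ Inst.idn σ'
  eq : ∀ i, T.Derives Θ Δ (.judg (.eqTm (σ i) (σ' i) ((Γ.get i).ms Inst.idn σ)) .starTm)

/-- Two equal substitutions are lifted into the same context, whose new entry is typed according to
the left one; the right one has to convert its new variable. -/
theorem RawTheory.WSub.lift_conv {Γ : Ctx S ν n} {Δ : Ctx S μ k} {I : Inst S ν μ k}
    {σ : Fin n → Tm S μ k} (h : T.WSub Θ Γ Δ I σ) {A : Ty S ν n} {A' : Ty S μ k}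
    (hA : T.Derives Θ Δ (.judg (.eqTy A' (A.ms I σ)) .starTy)) :
    T.WSub Θ (Γ.snoc A) (Δ.snoc A') I.wk (liftSub σ) := by
  intro i
  refine Fin.cases ?_ (fun i => ?_) i
  · rw [Ctx.get_zero, rename_succ_ms]
    exact .convTm (.var 0) (hA.weaken _)
  · rw [Ctx.get_succ, rename_succ_ms]
    exact (h i).weaken _

theorem RawTheory.ESub.transports :
    T.EqTransports Θ Θ (fun Γ Δ I σ I' σ' => I = Inst.idn ∧ I' = Inst.idn ∧
      T.ESub Θ Γ Δ σ σ') where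
  left := by
    rintro n k Γ Δ I I' σ σ' ⟨rfl, rfl, h⟩ c m J hJ
    exact hJ.ms_idn h.left
  right := by
    rintro n k Γ Δ I I' σ σ' ⟨rfl, rfl, h⟩ c m J hJ
    exact hJ.ms_idn h.right
  var := by
    rintro n k Γ Δ I I' σ σ' ⟨rfl, rfl, h⟩ i
    exact h.eq i
  lift := by
    rintro n k Γ Δ I I' σ σ' ⟨rfl, rfl, h⟩ A h₁ h₂
    refine ⟨Inst.gen_wk _, Inst.gen_wk _, ?_, ?_, ?_⟩
    · have := h.left.lift A
      rwa [Inst.gen_wk] at this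
    · have := h.right.lift_conv h₂
      rwa [Inst.gen_wk] at this
    · intro i
      have := rename_succ_ms (m := 0) (c := .ty) (k := k) (n := n) (ν := μ) (μ := μ) (S := S)
        (I := Inst.idn) (σ := σ)
      rw [Inst.gen_wk] at this
      refine Fin.cases ?_ (fun i => ?_) i
      · rw [Ctx.get_zero, this]
        exact .tmRefl (.var 0)
      · rw [Ctx.get_succ, this]
        exact (h.eq i).weaken _
  congr := by
    rintro n k Γ Δ I I' σ σ' ⟨rfl, rfl, h⟩ c m hc M ss ts h₁ h₂ h₃ h₄
    have hM := (MCtx.Ren.id Θ).mvarClosed (T := T) Δ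
    rcases hc with rfl | rfl
    · rw [Stmt.eqn_ty]
      exact hM.congrTy M ss ts h₁ h₂ h₃
    · rw [Stmt.eqn_tm]
      exact hM.congrTm M ss ts h₁ h₂ h₃ h₄.type

theorem RawTheory.Derives.eqn_ms {Γ : Ctx S μ n} {BB : Bdry S μ c m n} {e : Arg S μ c m n}
    (hc : c.IsObj) (h : T.Derives Θ Γ (.judg BB e)) {Δ : Ctx S μ k} {σ σ' : Fin n → Tm S μ k}
    (hσ : T.ESub Θ Γ Δ σ σ') :
    T.Derives Θ Δ (.eqn (BB.ms Inst.idn σ) (e.ms Inst.idn σ) (e.ms Inst.idn σ')) :=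
  RawTheory.ESub.transports.eqInstances h ⟨rfl, rfl, hσ⟩ hc

theorem RawTheory.Derives.bdryConv_ms {Γ : Ctx S μ n} {BB : Bdry S μ c m n}
    (h : T.Derives Θ Γ (.bdry BB)) {Δ : Ctx S μ k} {σ σ' : Fin n → Tm S μ k}
    (hσ : T.ESub Θ Γ Δ σ σ') :
    T.BdryConv Θ Δ (BB.ms Inst.idn σ) (BB.ms Inst.idn σ') :=
  RawTheory.ESub.transports.eqInstances h ⟨rfl, rfl, hσ⟩

end Conv

/-! ### Presuppositions -/

section Presup

variable {S : Signature.{u}} {T : RawTheory.{u, v} S} {μ ν ξ : List MArity} {c : Cls}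
  {m n k l : ℕ} {Θ : MCtx S μ}

theorem RawTheory.WfCtx.get {Γ : Ctx S μ n} (h : T.WfCtx Θ Γ) (i : Fin n) :
    T.Derives Θ Γ (.judg .ty (Γ.get i)) := by
  induction h with
  | nil => exact i.elim0
  | snoc _ hA ih =>
    refine Fin.cases ?_ (fun i => ?_) i
    · exact hA.weaken _
    · exact (ih i).weaken _

theorem RawTheory.Derives.mvarTy {Γ : Ctx S μ n} (M : MVar μ ⟨.ty, k⟩) (ts : Fin k → Tm S μ n)
    (h : ∀ j, T.Derives Θ Γ (.judg (.tm ((Θ.get M).argTy ts j)) (ts j))) :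
    T.Derives Θ Γ (.judg .ty (Arg.mapp M ts)) := by
  have := RawTheory.Derives.mvar M ts h (by rw [Bdry.eq_ty ((Θ.get M).inst ts)]; exact .bdryTy)
  rwa [Bdry.eq_ty ((Θ.get M).inst ts)] at this

theorem RawTheory.Derives.mvarTm {Γ : Ctx S μ n} (M : MVar μ ⟨.tm, k⟩) (ts : Fin k → Tm S μ n)
    (h : ∀ j, T.Derives Θ Γ (.judg (.tm ((Θ.get M).argTy ts j)) (ts j)))
    (h' : T.Derives Θ Γ (.judg .ty ((Θ.get M).inst ts).type)) :
    T.Derives Θ Γ (.judg (.tm ((Θ.get M).inst ts).type) (Arg.mapp M ts)) := by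
  have := RawTheory.Derives.mvar M ts h
    (by rw [Bdry.eq_tm ((Θ.get M).inst ts)]; exact .bdryTm h')
  rwa [Bdry.eq_tm ((Θ.get M).inst ts)] at this

theorem RawTheory.Derives.ruleTy {Γ : Ctx S μ n} (i : T.Idx .ty) (I : Inst S (T.rule i).ar μ n)
    (h : T.DerivableInst (T.rule i).prem Θ Γ I) :
    T.Derives Θ Γ (.judg .ty ((T.rule i).head.actC I)) := by
  have := RawTheory.Derives.rule i I h
    (by rw [Bdry.eq_ty ((T.rule i).bdry.actC I)]; exact .bdryTy)
  rwa [Bdry.eq_ty ((T.rule i).bdry.actC I)] at this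

theorem RawTheory.Derives.ruleTm {Γ : Ctx S μ n} (i : T.Idx .tm) (I : Inst S (T.rule i).ar μ n)
    (h : T.DerivableInst (T.rule i).prem Θ Γ I)
    (h' : T.Derives Θ Γ (.judg .ty ((T.rule i).bdry.actC I).type)) :
    T.Derives Θ Γ (.judg (.tm ((T.rule i).bdry.actC I).type) ((T.rule i).head.actC I)) := by
  have := RawTheory.Derives.rule i I h
    (by rw [Bdry.eq_tm ((T.rule i).bdry.actC I)]; exact .bdryTm h')
  rwa [Bdry.eq_tm ((T.rule i).bdry.actC I)] at this

/-- The boundary presupposed by a judgement. -/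
def Stmt.presup : Stmt S μ c m n → Stmt S μ c m n
  | .judg BB _ => .bdry BB
  | .bdry BB => .bdry BB

/-- The metavariable and specific rules carry the boundary of their conclusion as a premise, and the
term congruence rules carry an equation of types which retypes the right-hand side. Well-formedness
of `Γ` is what the variable rule needs. -/
theorem RawTheory.Derives.presup_aux {Γ : Ctx S μ n} {J : Stmt S μ c m n}
    (h : T.Derives Θ Γ J) (hΓ : T.WfCtx Θ Γ) : T.Derives Θ Γ J.presup := by
  induction h with
  | var a => exact .bdryTm (hΓ.get a)
  | mvar M ts _ h₂ => exact h₂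
  | mvarCongrTy M ss ts h₁ h₂ => exact .bdryEqTy (.mvarTy M ss h₁) (.mvarTy M ts h₂)
  | mvarCongrTm M ss ts h₁ h₂ _ h₄ _ _ _ ih₄ =>
    obtain ⟨h₅, h₆⟩ := (ih₄ hΓ).bdryEqTy_inv
    exact .bdryEqTm h₅ (.mvarTm M ss h₁ h₅) ((mvarTm M ts h₂ h₆).convTm h₄.tySym)
  | abs h₁ _ _ ih => exact .bdryAbs h₁ (ih (hΓ.snoc h₁))
  | tyRefl h => exact .bdryEqTy h h
  | tySym _ ih => exact .bdryEqTy (ih hΓ).bdryEqTy_inv.2 (ih hΓ).bdryEqTy_inv.1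
  | tyTran _ _ ih₁ ih₂ => exact .bdryEqTy (ih₁ hΓ).bdryEqTy_inv.1 (ih₂ hΓ).bdryEqTy_inv.2
  | tmRefl h ih => exact .bdryEqTm (ih hΓ).bdryTm_inv h h
  | tmSym _ ih =>
    obtain ⟨h₁, h₂, h₃⟩ := (ih hΓ).bdryEqTm_inv
    exact .bdryEqTm h₁ h₃ h₂
  | tmTran _ _ ih₁ ih₂ =>
    obtain ⟨h₁, h₂, -⟩ := (ih₁ hΓ).bdryEqTm_inv
    obtain ⟨-, -, h₃⟩ := (ih₂ hΓ).bdryEqTm_inv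
    exact .bdryEqTm h₁ h₂ h₃
  | convTm _ _ _ ih₂ => exact .bdryTm (ih₂ hΓ).bdryEqTy_inv.2
  | convEq _ h ih₁ ih₂ =>
    obtain ⟨h₁, h₂, h₃⟩ := (ih₁ hΓ).bdryEqTm_inv
    exact .bdryEqTm (ih₂ hΓ).bdryEqTy_inv.2 (h₂.convTm h) (h₃.convTm h)
  | bdryTy => exact .bdryTy
  | bdryTm h => exact .bdryTm h
  | bdryEqTy h₁ h₂ => exact .bdryEqTy h₁ h₂
  | bdryEqTm h₁ h₂ h₃ => exact .bdryEqTm h₁ h₂ h₃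
  | bdryAbs h₁ h₂ => exact .bdryAbs h₁ h₂
  | rule i I _ h₂ => exact h₂
  | congrTy i I J h₁ h₂ => exact .bdryEqTy (.ruleTy i I h₁) (.ruleTy i J h₂)
  | congrTm i I J h₁ h₂ _ h₄ _ _ _ ih₄ =>
    obtain ⟨h₅, h₆⟩ := (ih₄ hΓ).bdryEqTy_inv
    exact .bdryEqTm h₅ (.ruleTm i I h₁ h₅) ((ruleTm i J h₂ h₆).convTm h₄.tySym)

theorem RawTheory.Derives.presup {Γ : Ctx S μ n} {BB : Bdry S μ c m n} {e : Arg S μ c m n}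
    (h : T.Derives Θ Γ (.judg BB e)) (hΓ : T.WfCtx Θ Γ) : T.Derives Θ Γ (.bdry BB) :=
  h.presup_aux hΓ

theorem RawTheory.Derives.eqn_left (hc : c.IsObj) {Γ : Ctx S μ n} {BB : Bdry S μ c m n}
    {e₁ e₂ : Arg S μ c m n} (h : T.Derives Θ Γ (.eqn BB e₁ e₂)) (hΓ : T.WfCtx Θ Γ) :
    T.Derives Θ Γ (.judg BB e₁) :=
  ((presup h hΓ).eqn_bdry_inv hc).1

theorem RawTheory.Derives.eqn_right (hc : c.IsObj) {Γ : Ctx S μ n} {BB : Bdry S μ c m n}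
    {e₁ e₂ : Arg S μ c m n} (h : T.Derives Θ Γ (.eqn BB e₁ e₂)) (hΓ : T.WfCtx Θ Γ) :
    T.Derives Θ Γ (.judg BB e₂) :=
  ((presup h hΓ).eqn_bdry_inv hc).2

end Presup

/-! ### Substitution for abstracted variables preserves derivability -/

section Instances

variable {S : Signature.{u}} {T : RawTheory.{u, v} S} {μ ν ξ : List MArity} {c : Cls}
  {m n k l : ℕ} {Θ : MCtx S μ}

theorem Bdry.instAux_zero (B : Bdry S μ c 0 n) (σ : Fin n → Tm S μ k) (ts : Fin 0 → Tm S μ k) :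
    B.instAux σ ts = B.ms Inst.idn σ := by
  cases B <;> simp [Bdry.instAux, Bdry.ms, Arg.subst_eq_ms]

theorem Arg.instAux_zero (e : Arg S μ c 0 n) (σ : Fin n → Tm S μ k) (ts : Fin 0 → Tm S μ k) :
    e.instAux σ ts = e.ms Inst.idn σ := by
  simp [Arg.instAux, Arg.subst_eq_ms]

theorem rename_succ_ms_cases (A : Arg S ν c m n) (I : Inst S ν μ k) (t : Tm S μ k)
    (σ : Fin n → Tm S μ k) :
    (A.rename Fin.succ).ms I (Fin.cases t σ) = A.ms I σ := by
  simp [Arg.ms_rename]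

theorem RawTheory.WSub.cons {Γ : Ctx S ν n} {Δ : Ctx S μ k} {I : Inst S ν μ k}
    {σ : Fin n → Tm S μ k} (h : T.WSub Θ Γ Δ I σ) {A : Ty S ν n} {t : Tm S μ k}
    (ht : T.Derives Θ Δ (.judg (.tm (A.ms I σ)) t)) :
    T.WSub Θ (Γ.snoc A) Δ I (Fin.cases t σ) := by
  intro i
  refine Fin.cases ?_ (fun i => ?_) i
  · rw [Ctx.get_zero, rename_succ_ms_cases]
    exact ht
  · rw [Ctx.get_succ, rename_succ_ms_cases]
    exact h i

theorem RawTheory.ESub.cons {Γ : Ctx S μ n} {Δ : Ctx S μ k} {σ σ' : Fin n → Tm S μ k}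
    (h : T.ESub Θ Γ Δ σ σ') {A : Ty S μ n} {s t : Tm S μ k}
    (hs : T.Derives Θ Δ (.judg (.tm (A.ms Inst.idn σ)) s))
    (ht : T.Derives Θ Δ (.judg (.tm (A.ms Inst.idn σ')) t))
    (hst : T.Derives Θ Δ (.judg (.eqTm s t (A.ms Inst.idn σ)) .starTm)) :
    T.ESub Θ (Γ.snoc A) Δ (Fin.cases s σ) (Fin.cases t σ') where
  left := h.left.cons hs
  right := h.right.cons ht
  eq i := by
    refine Fin.cases ?_ (fun i => ?_) i
    · rw [Ctx.get_zero, rename_succ_ms_cases]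
      exact hst
    · rw [Ctx.get_succ, rename_succ_ms_cases]
      exact h.eq i

theorem RawTheory.WSub.refl {Γ : Ctx S μ n} {Δ : Ctx S μ k} {σ : Fin n → Tm S μ k}
    (h : T.WSub Θ Γ Δ Inst.idn σ) : T.ESub Θ Γ Δ σ σ :=
  ⟨h, h, fun i => .tmRefl (h i)⟩

/-- The terms `ts` fit the abstracted variables of a boundary. -/
def RawTheory.Fits (T : RawTheory.{u, v} S) (Θ : MCtx S μ) (Δ : Ctx S μ k)
    (BB : Bdry S μ c m n) (σ : Fin n → Tm S μ k) (ts : Fin m → Tm S μ k) : Prop :=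
  ∀ j, T.Derives Θ Δ (.judg (.tm (BB.argTyAux σ ts j)) (ts j))

theorem RawTheory.Fits.zero {Δ : Ctx S μ k} {A : Ty S μ n} {BB : Bdry S μ c m (n + 1)}
    {σ : Fin n → Tm S μ k} {ts : Fin (m + 1) → Tm S μ k}
    (h : T.Fits Θ Δ (.abs A BB) σ ts) :
    T.Derives Θ Δ (.judg (.tm (A.ms Inst.idn σ)) (ts 0)) := by
  have := h 0
  rwa [← Arg.subst_eq_ms]

theorem RawTheory.Fits.succ {Δ : Ctx S μ k} {A : Ty S μ n} {BB : Bdry S μ c m (n + 1)}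
    {σ : Fin n → Tm S μ k} {ts : Fin (m + 1) → Tm S μ k}
    (h : T.Fits Θ Δ (.abs A BB) σ ts) :
    T.Fits Θ Δ BB (Fin.cases (ts 0) σ) (fun j => ts j.succ) :=
  fun j => h j.succ

/-- Peeling off one abstraction moves the first term from `ts` into the substitution, where fitting
makes it well typed; when none is left, this is the substitution theorem. -/
theorem RawTheory.Derives.inst_judg {Γ : Ctx S μ n} {BB : Bdry S μ c m n} {e : Arg S μ c m n}
    (h : T.Derives Θ Γ (.judg BB e)) {Δ : Ctx S μ k} {σ : Fin n → Tm S μ k}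
    (hσ : T.WSub Θ Γ Δ Inst.idn σ) {ts : Fin m → Tm S μ k} (hts : T.Fits Θ Δ BB σ ts) :
    T.Derives Θ Δ (.judg (BB.instAux σ ts) (e.instAux σ ts)) := by
  induction m generalizing n with
  | zero =>
    rw [Bdry.instAux_zero, Arg.instAux_zero]
    exact h.ms_idn hσ
  | succ m ih =>
    cases BB with
    | abs A BB => exact ih h.abs_inv.2 (hσ.cons hts.zero) hts.succ

theorem RawTheory.Derives.inst_eqn (hc : c.IsObj) {Γ : Ctx S μ n} {BB : Bdry S μ c m n}
    {e : Arg S μ c m n} (h : T.Derives Θ Γ (.judg BB e)) {Δ : Ctx S μ k}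
    {σ σ' : Fin n → Tm S μ k} (hσ : T.ESub Θ Γ Δ σ σ') {ss ts : Fin m → Tm S μ k}
    (hss : T.Fits Θ Δ BB σ ss) (hts : T.Fits Θ Δ BB σ' ts)
    (hst : ∀ j, T.Derives Θ Δ (.judg (.eqTm (ss j) (ts j) (BB.argTyAux σ ss j)) .starTm)) :
    T.Derives Θ Δ (.eqn (BB.instAux σ ss) (e.instAux σ ss) (e.instAux σ' ts)) := by
  induction m generalizing n with
  | zero =>
    rw [Bdry.instAux_zero, Arg.instAux_zero, Arg.instAux_zero]
    exact h.eqn_ms hc hσ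
  | succ m ih =>
    cases BB with
    | abs A BB =>
      refine ih h.abs_inv.2 (hσ.cons hss.zero hts.zero ?_) hss.succ hts.succ
        (fun j => hst j.succ)
      have := hst 0
      rwa [← Arg.subst_eq_ms]

theorem RawTheory.Derives.inst_bdryConv {Γ : Ctx S μ n} {BB : Bdry S μ c m n}
    (h : T.Derives Θ Γ (.bdry BB)) {Δ : Ctx S μ k}
    {σ σ' : Fin n → Tm S μ k} (hσ : T.ESub Θ Γ Δ σ σ') {ss ts : Fin m → Tm S μ k}
    (hss : T.Fits Θ Δ BB σ ss) (hts : T.Fits Θ Δ BB σ' ts)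
    (hst : ∀ j, T.Derives Θ Δ (.judg (.eqTm (ss j) (ts j) (BB.argTyAux σ ss j)) .starTm)) :
    T.BdryConv Θ Δ (BB.instAux σ ss) (BB.instAux σ' ts) := by
  induction m generalizing n with
  | zero =>
    rw [Bdry.instAux_zero, Bdry.instAux_zero]
    exact h.bdryConv_ms hσ
  | succ m ih =>
    cases BB with
    | abs A BB =>
      refine ih h.bdryAbs_inv.2 (hσ.cons hss.zero hts.zero ?_) hss.succ hts.succ
        (fun j => hst j.succ)
      have := hst 0
      rwa [← Arg.subst_eq_ms]

/-- The types of later arguments depend on earlier ones. Working from left to right, equality of the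
earlier terms makes the two types of the `j`-th position equal, which discharges the implication
offered to `hst`; the presupposition of the resulting equation then types `ts j`. Thus a comparison
whose right-hand side is typed only at its own type can be used. -/
theorem RawTheory.Fits.of_eq {Γ : Ctx S μ n} {BB : Bdry S μ c m n}
    (h : T.Derives Θ Γ (.bdry BB)) {Δ : Ctx S μ k} (hΔ : T.WfCtx Θ Δ)
    {σ σ' : Fin n → Tm S μ k} (hσ : T.ESub Θ Γ Δ σ σ') {ss ts : Fin m → Tm S μ k}
    (hss : T.Fits Θ Δ BB σ ss)
    (hst : ∀ j, (T.Derives Θ Δ (.judg (.tm (BB.argTyAux σ' ts j)) (ts j)) →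
        T.Derives Θ Δ (.judg (.tm (BB.argTyAux σ ss j)) (ts j))) →
      T.Derives Θ Δ (.judg (.eqTm (ss j) (ts j) (BB.argTyAux σ ss j)) .starTm)) :
    T.Fits Θ Δ BB σ' ts ∧
      ∀ j, T.Derives Θ Δ (.judg (.eqTm (ss j) (ts j) (BB.argTyAux σ ss j)) .starTm) := by
  induction m generalizing n with
  | zero => exact ⟨fun j => j.elim0, fun j => j.elim0⟩
  | succ m ih =>
    cases BB with
    | abs A BB =>
      have hA : T.Derives Θ Δ (.judg (.eqTy (A.subst σ) (A.subst σ')) .starTy) := by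
        have := h.bdryAbs_inv.1.eqn_ms (Or.inl rfl) hσ
        rwa [Arg.subst_eq_ms, Arg.subst_eq_ms]
      -- Only `σ` and `σ'` occur in the type of the first argument, so the implication is an
      -- instance of conversion.
      have h₀ : T.Derives Θ Δ (.judg (.eqTm (ss 0) (ts 0) (A.subst σ)) .starTm) :=
        hst 0 fun h => .convTm h hA.tySym
      have h₁ : T.Derives Θ Δ (.judg (.tm (A.subst σ')) (ts 0)) :=
        (h₀.presup hΔ).bdryEqTm_inv.2.2.convTm hA
      obtain ⟨h₂, h₃⟩ := ih (ts := fun j => ts j.succ) h.bdryAbs_inv.2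
        (hσ.cons hss.zero (by rwa [← Arg.subst_eq_ms]) (by rwa [← Arg.subst_eq_ms])) hss.succ
        (fun j => hst j.succ)
      exact ⟨fun j => Fin.cases h₁ h₂ j, fun j => Fin.cases h₀ h₃ j⟩

theorem instAux_cons_ren (ρ : Fin (n + 1) → Fin k) :
    (Fin.cases (Arg.var (ρ 0)) (fun i => .var (ρ i.succ)) : Fin (n + 1) → Tm S μ k) =
      fun i => .var (ρ i) :=
  cases_eta fun i => (Arg.var (ρ i) : Tm S μ k)

/-- An equation between abstractions follows from its instances. -/
theorem RawTheory.Derives.eqn_of_instances (hc : c.IsObj) {Γ : Ctx S μ n} (hΓ : T.WfCtx Θ Γ)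
    {BB : Bdry S μ c m n} {e₁ e₂ : Arg S μ c m n} (b : Prop) (h₁ : T.Derives Θ Γ (.judg BB e₁))
    (h₂ : b → T.Derives Θ Γ (.judg BB e₂))
    (H : ∀ (k : ℕ) (Δ : Ctx S μ k) (σ : Fin n → Tm S μ k) (ts : Fin m → Tm S μ k),
      T.WfCtx Θ Δ → T.Derives Θ Δ (.judg (BB.instAux σ ts) (e₁.instAux σ ts)) →
      (b → T.Derives Θ Δ (.judg (BB.instAux σ ts) (e₂.instAux σ ts))) →
      T.Derives Θ Δ (.eqn (BB.instAux σ ts) (e₁.instAux σ ts) (e₂.instAux σ ts))) :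
    T.Derives Θ Γ (.eqn BB e₁ e₂) := by
  induction m generalizing n with
  | zero =>
    -- Without abstractions the identity instance is the equation itself.
    have := H n Γ Arg.var Fin.elim0 hΓ
    simp only [Bdry.instAux_zero, Arg.instAux_zero, Bdry.ms_gen_var, Arg.ms_gen_var] at this
    exact this h₁ h₂
  | succ m ih =>
    cases BB with
    | abs A BB =>
      refine .abs h₁.abs_inv.1 (ih (hΓ.snoc h₁.abs_inv.1) h₁.abs_inv.2 (fun hb => (h₂ hb).abs_inv.2)
        fun k Δ σ ts => ?_)
      -- The value of the variable just opened is the head of `σ`; it is passed back to `H` as the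
      -- first term for an abstracted variable.
      simpa [Bdry.instAux, Arg.instAux, cases_eta] using
        H k Δ (fun i => σ i.succ) (Fin.cases (σ 0) ts)

/-- The renaming `ρ` of variables respects types. -/
def Ctx.Ren (Γ : Ctx S μ n) (Δ : Ctx S μ k) (ρ : Fin n → Fin k) : Prop :=
  ∀ i, Δ.get (ρ i) = (Γ.get i).rename ρ

theorem Ctx.Ren.succ {Γ : Ctx S μ n} {Δ : Ctx S μ k} {ρ : Fin n → Fin k} (h : Γ.Ren Δ ρ)
    (A : Ty S μ k) : Γ.Ren (Δ.snoc A) (fun i => (ρ i).succ) := by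
  intro i
  rw [Ctx.get_succ, h, Arg.rename_rename]

theorem Ctx.Ren.id (Γ : Ctx S μ n) : Γ.Ren Γ (fun i => i) := by
  intro i
  rw [Arg.rename_id]

theorem Ctx.Ren.wSub {Γ : Ctx S μ n} {Δ : Ctx S μ k} {ρ : Fin n → Fin k} (h : Γ.Ren Δ ρ) :
    T.WSub Θ Γ Δ Inst.idn (fun i => .var (ρ i)) := by
  intro i
  rw [← Arg.subst_eq_ms, ← Arg.rename_eq_subst, ← h]
  exact .var _

/-- An object or equation judgement follows from its generic instances. -/
theorem RawTheory.Derives.judg_of_instances {Γ : Ctx S μ n} {BB : Bdry S μ c m n}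
    {e : Arg S μ c m n} (hΓ : T.WfCtx Θ Γ) (h : T.Derives Θ Γ (.bdry BB))
    (H : ∀ (k : ℕ) (Δ : Ctx S μ k) (ρ : Fin n → Fin k) (ts : Fin m → Tm S μ k),
      T.WfCtx Θ Δ → Γ.Ren Δ ρ → T.Fits Θ Δ BB (fun i => .var (ρ i)) ts →
      T.Derives Θ Δ (.bdry (BB.instAux (fun i => .var (ρ i)) ts)) →
      T.Derives Θ Δ (.judg (BB.instAux (fun i => .var (ρ i)) ts)
        (e.instAux (fun i => .var (ρ i)) ts))) :
    T.Derives Θ Γ (.judg BB e) := by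
  -- The claim is generalized to renamed judgements, so that the induction can pass under a binder
  -- by lifting the renaming.
  suffices ∀ (k : ℕ) (Δ : Ctx S μ k) (ρ : Fin n → Fin k), T.WfCtx Θ Δ → Γ.Ren Δ ρ →
      T.Derives Θ Δ (.judg (BB.rename ρ) (e.rename ρ)) by
    have := this n Γ (fun i => i) hΓ (Ctx.Ren.id Γ)
    simpa only [Bdry.rename_eq_ms, Arg.rename_eq_subst, Arg.subst_eq_ms, Arg.ms_gen_var,
      Bdry.ms_gen_var] using this
  intro k Δ ρ hΔ hρ
  induction m generalizing n k with
  | zero =>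
    have h' := h.ms_idn (T := T) hρ.wSub
    have := H k Δ ρ Fin.elim0 hΔ hρ (fun j => j.elim0)
    rw [Bdry.instAux_zero, Arg.instAux_zero, ← Arg.subst_eq_ms, ← Arg.rename_eq_subst,
      ← Bdry.rename_eq_ms] at this
    rw [Stmt.ms, ← Bdry.rename_eq_ms] at h'
    exact this h'
  | succ m ih =>
    cases BB with
    | abs A BB =>
      have hA := (h.bdryAbs_inv.1.ms_idn (T := T) hρ.wSub)
      rw [Stmt.ms, ← Arg.subst_eq_ms, ← Arg.rename_eq_subst] at hA
      rw [← e.abs_body]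
      have hρ' : (Γ.snoc A).Ren (Δ.snoc (A.rename ρ)) (liftRen ρ) := by
        intro i
        refine Fin.cases ?_ (fun i => ?_) i
        · simp [Ctx.get_zero, Arg.rename_rename]
        · simp [Ctx.get_succ, Arg.rename_rename, hρ i]
      refine .abs hA (ih (hΓ.snoc h.bdryAbs_inv.1) h.bdryAbs_inv.2 ?_ _ _ _ (hΔ.snoc hA) hρ')
      intro k Δ ρ ts hΔ hρ hts hb
      have h₀ : (A.rename Fin.succ).rename ρ = A.rename (fun i => ρ i.succ) :=
        Arg.rename_rename _ _ _
      have := H k Δ (fun i => ρ i.succ) (Fin.cases (.var (ρ 0)) ts) hΔ fun i => by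
        rw [hρ, Ctx.get_succ, Arg.rename_rename]
      simp only [Bdry.instAux, Arg.instAux, Fin.cases_zero, Fin.cases_succ,
        instAux_cons_ren] at this
      -- The newly opened variable is the first term, and it fits because its type in `Δ` is the
      -- renamed `A`.
      refine this (fun j => ?_) hb
      refine Fin.cases ?_ (fun j => ?_) j
      · simp only [Bdry.argTyAux, Fin.cases_zero]
        rw [← Arg.rename_eq_subst, ← h₀, ← Ctx.get_zero Γ A, ← hρ]
        exact .var _
      · simpa only [Bdry.argTyAux, Fin.cases_zero, Fin.cases_succ, instAux_cons_ren] using hts j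

end Instances

/-! ### Instantiation preserves derivability -/

section Instantiation

variable {S : Signature.{u}} {T : RawTheory.{u, v} S} {μ ν ξ : List MArity} {c : Cls}
  {m n k l : ℕ} {Ξ : MCtx S ν} {Θ : MCtx S μ}

/-- All weakenings of `I` respect the rules for applications of metavariables. -/
def RawTheory.Admissible (T : RawTheory.{u, v} S) (Ξ : MCtx S ν) (Θ : MCtx S μ) (Γ : Ctx S μ n)
    (I : Inst S ν μ n) : Prop :=
  ∀ (k : ℕ) (Δ : Ctx S μ k) (ρ : Fin n → Fin k), T.WfCtx Θ Δ → Γ.Ren Δ ρ →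
    T.MVarClosed Ξ Θ Δ (I.rename ρ)

theorem Inst.rename_wk (I : Inst S ν μ n) (ρ : Fin n → Fin k) :
    (I.rename ρ).wk = I.rename (fun i => (ρ i).succ) := by
  funext α M
  simp [Inst.wk, Inst.rename, Arg.rename_rename]

/-- Under binders the instantiation is only ever weakened along a renaming into a well-formed
context. Admissibility asks nothing of the components of `I` outside applications, where boundaries
are known to be derivable; this is why it also covers dummies for unproved equations. -/
theorem RawTheory.Admissible.transports {Γ₀ : Ctx S μ l} {I₀ : Inst S ν μ l}
    (h : T.Admissible Ξ Θ Γ₀ I₀) :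
    T.Transports Ξ Θ (fun {_ _} Γ Δ I σ => T.WfCtx Θ Δ ∧ T.WSub Θ Γ Δ I σ ∧
      ∃ ρ, Γ₀.Ren Δ ρ ∧ I = I₀.rename ρ) where
  var hg := hg.2.1
  lift := by
    rintro n k Γ Δ I σ ⟨hΔ, hσ, ρ, hρ, rfl⟩ A hA
    exact ⟨hΔ.snoc hA, hσ.lift A, _, hρ.succ _, Inst.rename_wk _ _⟩
  closed := by
    rintro n k Γ Δ I σ ⟨hΔ, hσ, ρ, hρ, rfl⟩
    exact h _ Δ ρ hΔ hρ

theorem Inst.rename_id (I : Inst S ν μ n) : I.rename (fun i => i) = I := by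
  funext α M
  exact Arg.rename_id _

theorem RawTheory.Admissible.derives {Γ : Ctx S μ n} {I : Inst S ν μ n}
    (h : T.Admissible Ξ Θ Γ I) (hΓ : T.WfCtx Θ Γ) {J : Stmt S ν c m 0}
    (hJ : T.Derives Ξ Ctx.nil J) : T.Derives Θ Γ (J.ms I Fin.elim0) :=
  h.transports.derives hJ ⟨hΓ, fun i => i.elim0, _, Ctx.Ren.id Γ, (Inst.rename_id I).symm⟩

theorem Inst.rename_inst (I : Inst S ν μ n) (ρ : Fin n → Fin k) {α : MArity} (M : MVar ν α)
    (ts : Fin α.bind → Tm S μ k) :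
    ((I.rename ρ) α M).inst ts = (I α M).instAux (fun i => .var (ρ i)) ts := by
  simp [Inst.rename, Arg.inst, Arg.rename_eq_subst, Arg.subst_instAux, Arg.subst]

theorem Bdry.actC_instAux_ren (BB : Bdry S ν c m 0) (I : Inst S ν μ n) (ρ : Fin n → Fin k)
    (ts : Fin m → Tm S μ k) :
    BB.msAux (I.rename ρ) Fin.elim0 ts = (BB.actC I).instAux (fun i => .var (ρ i)) ts := by
  rw [Bdry.actC_instAux, Inst.rename_eq_subst]

theorem Bdry.actC_argTyAux_ren (BB : Bdry S ν c m 0) (I : Inst S ν μ n) (ρ : Fin n → Fin k)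
    (ts : Fin m → Tm S μ k) (j : Fin m) :
    BB.msArgTy (I.rename ρ) Fin.elim0 ts j =
      (BB.actC I).argTyAux (fun i => .var (ρ i)) ts j := by
  rw [Bdry.actC_argTyAux, Inst.rename_eq_subst]

theorem RawTheory.DerivableInst.admissible {Γ : Ctx S μ n} {I : Inst S ν μ n}
    (h : T.DerivableInst Ξ Θ Γ I) : T.Admissible Ξ Θ Γ I := by
  intro k Δ ρ _ hρ
  constructor
  · intro c m M ts h₁ _
    simp only [Inst.rename_inst, Bdry.actC_instAux_ren, Bdry.actC_argTyAux_ren] at *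
    exact (h _ M).inst_judg hρ.wSub h₁
  · intro m M ss ts h₁ h₂ h₃
    simp only [Inst.rename_inst, Bdry.actC_argTyAux_ren] at *
    have := (h _ M).inst_eqn (Or.inl rfl) hρ.wSub.refl h₁ h₂ h₃
    rwa [Stmt.eqn_ty] at this
  · intro m M ss ts h₁ h₂ h₃ h₄
    simp only [Inst.rename_inst, Bdry.actC_instAux_ren, Bdry.actC_argTyAux_ren] at *
    have := (h _ M).inst_eqn (Or.inr rfl) hρ.wSub.refl h₁ h₂ h₃
    rwa [Stmt.eqn_tm] at this

theorem RawTheory.DerivableInst.derives_judg {Γ : Ctx S μ n} {I : Inst S ν μ n}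
    (h : T.DerivableInst Ξ Θ Γ I) (hΓ : T.WfCtx Θ Γ) {BB : Bdry S ν c m 0} {e : Arg S ν c m 0}
    (hJ : T.Derives Ξ Ctx.nil (.judg BB e)) :
    T.Derives Θ Γ (.judg (BB.actC I) (e.actC I)) := by
  rw [Bdry.actC_eq_ms, Arg.actC_eq_ms]
  exact h.admissible.derives hΓ hJ

theorem RawTheory.DerivableInst.derives_bdry {Γ : Ctx S μ n} {I : Inst S ν μ n}
    (h : T.DerivableInst Ξ Θ Γ I) (hΓ : T.WfCtx Θ Γ) {BB : Bdry S ν c m 0}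
    (hJ : T.Derives Ξ Ctx.nil (.bdry BB)) :
    T.Derives Θ Γ (.bdry (BB.actC I)) := by
  rw [Bdry.actC_eq_ms]
  exact h.admissible.derives hΓ hJ

theorem Bdry.eqn_argTyAux (BB : Bdry S μ c m n) (e₁ e₂ : Arg S μ c m n) (σ : Fin n → Tm S μ k)
    (ts : Fin m → Tm S μ k) : (BB.eqn e₁ e₂).argTyAux σ ts = BB.argTyAux σ ts := by
  induction BB <;> simp [Bdry.eqn, Bdry.argTyAux, *]

/-- Pairs of equal derivable instantiations. -/
structure RawTheory.EInst (T : RawTheory.{u, v} S) (Ξ : MCtx S ν) (Θ : MCtx S μ) (Γ : Ctx S μ n)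
    (I I' : Inst S ν μ n) : Prop where
  left : T.DerivableInst Ξ Θ Γ I
  right : T.DerivableInst Ξ Θ Γ I'
  eq : ∀ (α : MArity) (M : MVar ν α), α.cls.IsObj →
    T.Derives Θ Γ (.eqn ((Ξ.get M).actC I) (I α M) (I' α M))

theorem RawTheory.BdryConv.eqn_left (hc : c.IsObj) {Γ : Ctx S μ n} {B B' : Bdry S μ c 0 n}
    (h : T.BdryConv Θ Γ B B') {e e' : Arg S μ c 0 n} (he : T.Derives Θ Γ (.eqn B' e e')) :
    T.Derives Θ Γ (.eqn B e e') := by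
  cases h with
  | ty => exact he
  | tm h => exact .convEq he h.tySym
  | eqTy => exact absurd hc Cls.not_isObj_eqTy
  | eqTm => exact absurd hc Cls.not_isObj_eqTm

theorem RawTheory.BdryConv.eqn_right (hc : c.IsObj) {Γ : Ctx S μ n} {B B' : Bdry S μ c 0 n}
    (h : T.BdryConv Θ Γ B B') {e e' : Arg S μ c 0 n} (he : T.Derives Θ Γ (.eqn B e e')) :
    T.Derives Θ Γ (.eqn B' e e') := by
  cases h with
  | ty => exact he
  | tm h => exact .convEq he h
  | eqTy => exact absurd hc Cls.not_isObj_eqTy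
  | eqTm => exact absurd hc Cls.not_isObj_eqTm

/-- Two moves: replace `ss` by `ts` within the component of `I₀`, then `I₀` by `I₀'` at fixed `ts`.
The second equation lives at the boundary for `ts` and is converted back to the one for `ss`. -/
theorem RawTheory.EInst.inst_eqn {Γ₀ : Ctx S μ l} {I₀ I₀' : Inst S ν μ l}
    (h : T.EInst Ξ Θ Γ₀ I₀ I₀') (hΓ₀ : T.WfCtx Θ Γ₀) {Δ : Ctx S μ k} (hΔ : T.WfCtx Θ Δ)
    {ρ : Fin l → Fin k} (hρ : Γ₀.Ren Δ ρ) (hc : c.IsObj) (M : MVar ν ⟨c, m⟩)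
    {ss ts : Fin m → Tm S μ k}
    (hss : T.Fits Θ Δ ((Ξ.get M).actC I₀) (fun i => .var (ρ i)) ss)
    (hst : ∀ j, T.Derives Θ Δ (.judg (.eqTm (ss j) (ts j)
      (((Ξ.get M).actC I₀).argTyAux (fun i => .var (ρ i)) ss j)) .starTm)) :
    T.Derives Θ Δ (.eqn (((Ξ.get M).actC I₀).instAux (fun i => .var (ρ i)) ss)
      ((I₀ _ M).instAux (fun i => .var (ρ i)) ss)
      ((I₀' _ M).instAux (fun i => .var (ρ i)) ts)) := by
  have hM := h.left _ M
  have hB := hM.presup hΓ₀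
  have hts := (RawTheory.Fits.of_eq hB hΔ hρ.wSub.refl hss (fun j _ => hst j)).1
  have h₁ := hM.inst_eqn hc hρ.wSub.refl hss hts hst
  have h₂ := (h.eq _ M hc).inst_judg hρ.wSub (ts := ts)
    (fun j => by rw [Bdry.eqn_argTyAux]; exact hts j)
  rw [Bdry.eqn_instAux, Arg.eq_of_not_isObj c.eqn_not_isObj (Arg.instAux _ _ _)
    (Arg.dummy c 0)] at h₂
  exact h₁.eqn_trans hc ((hB.inst_bdryConv hρ.wSub.refl hss hts hst).eqn_left hc h₂)

theorem RawTheory.EInst.transports {Γ₀ : Ctx S μ l} {I₀ I₀' : Inst S ν μ l}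
    (h : T.EInst Ξ Θ Γ₀ I₀ I₀') (hΓ₀ : T.WfCtx Θ Γ₀) :
    T.EqTransports Ξ Θ (fun {_ _} Γ Δ I σ I' σ' => T.WfCtx Θ Δ ∧ T.WSub Θ Γ Δ I σ ∧
      T.WSub Θ Γ Δ I' σ' ∧ σ = σ' ∧ ∃ ρ, Γ₀.Ren Δ ρ ∧ I = I₀.rename ρ ∧ I' = I₀'.rename ρ) where
  left := by
    rintro n k Γ Δ I I' σ σ' ⟨hΔ, hσ, -, -, ρ, hρ, hI, -⟩ c m J hJ
    exact h.left.admissible.transports.derives hJ ⟨hΔ, hσ, ρ, hρ, hI⟩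
  right := by
    rintro n k Γ Δ I I' σ σ' ⟨hΔ, -, hσ, -, ρ, hρ, -, hI⟩ c m J hJ
    exact h.right.admissible.transports.derives hJ ⟨hΔ, hσ, ρ, hρ, hI⟩
  var := by
    rintro n k Γ Δ I I' σ σ' ⟨hΔ, hσ, -, rfl, -⟩ i
    exact .tmRefl (hσ i)
  lift := by
    rintro n k Γ Δ I I' σ σ' ⟨hΔ, hσ, hσ', rfl, ρ, hρ, rfl, rfl⟩ A - hA
    exact ⟨hΔ.snoc (hA.presup hΔ).bdryEqTy_inv.1, hσ.lift A, hσ'.lift_conv hA, rfl, _, hρ.succ _,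
      Inst.rename_wk _ _, Inst.rename_wk _ _⟩
  congr := by
    rintro n k Γ Δ I I' σ σ' ⟨hΔ, -, -, -, ρ, hρ, rfl, rfl⟩ c m hc M ss ts h₁ - h₃ -
    simp only [Inst.rename_inst, Bdry.actC_instAux_ren, Bdry.actC_argTyAux_ren] at *
    exact h.inst_eqn hΓ₀ hΔ hρ hc M h₁ h₃

theorem RawTheory.EInst.bdryConv {Γ : Ctx S μ n} {I I' : Inst S ν μ n} (h : T.EInst Ξ Θ Γ I I')
    (hΓ : T.WfCtx Θ Γ) {BB : Bdry S ν c m 0} (hJ : T.Derives Ξ Ctx.nil (.bdry BB)) :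
    T.BdryConv Θ Γ (BB.actC I) (BB.actC I') := by
  simp only [Bdry.actC_eq_ms]
  exact (h.transports hΓ).eqInstances hJ ⟨hΓ, fun i => i.elim0, fun i => i.elim0, rfl, _,
    Ctx.Ren.id Γ, (Inst.rename_id I).symm, (Inst.rename_id I').symm⟩

/-- The abstraction clause of `BdryConv` is biased to the left type, so this converse direction is
proved directly instead of through symmetry. -/
theorem RawTheory.BdryConv.judg_left {Γ : Ctx S μ n} {BB BB' : Bdry S μ c m n}
    (h : T.BdryConv Θ Γ BB BB') {e : Arg S μ c m n} (he : T.Derives Θ Γ (.judg BB' e))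
    (hBB : T.Derives Θ Γ (.bdry BB)) : T.Derives Θ Γ (.judg BB e) := by
  induction h with
  | ty => exact he
  | tm h => exact .convTm he h.tySym
  | eqTy h₁ h₂ =>
    rw [Arg.eq_of_not_isObj (Cls.eqn_not_isObj .ty) e .starTy] at he ⊢
    exact (h₁.tyTran he).tyTran h₂.tySym
  | eqTm h₁ h₂ h₃ =>
    rw [Arg.eq_of_not_isObj (Cls.eqn_not_isObj .tm) e .starTm] at he ⊢
    exact (h₁.tmTran (he.convEq h₃.tySym)).tmTran h₂.tmSym
  | abs h₁ _ ih =>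
    obtain ⟨-, h₄⟩ := he.abs_inv
    obtain ⟨h₅, h₆⟩ := hBB.bdryAbs_inv
    rw [← e.abs_body]
    exact .abs h₅ (ih (h₄.snoc_conv h₁) h₆)

theorem Arg.mrename_ms (e : Arg S ξ c m n) (ρ : ∀ α : MArity, MVar ξ α → MVar ν α)
    (I : Inst S ν μ k) (σ : Fin n → Tm S μ k) :
    (e.mrename ρ).ms I σ = e.ms (fun α M => I α (ρ α M)) σ := by
  rw [Arg.mrename_eq_ms, Arg.ms_ms, Inst.gen_ms]
  rfl

theorem Bdry.mrename_ms (BB : Bdry S ξ c m n) (ρ : ∀ α : MArity, MVar ξ α → MVar ν α)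
    (I : Inst S ν μ k) (σ : Fin n → Tm S μ k) :
    (BB.mrename ρ).ms I σ = BB.ms (fun α M => I α (ρ α M)) σ := by
  rw [Bdry.mrename_eq_ms, Bdry.ms_ms, Inst.gen_ms]
  rfl

theorem MCtx.get_there_actC {α β : MArity} (BB : Bdry S ν α.cls α.bind 0) (M : MVar ν β)
    (I : Inst S (α :: ν) μ n) :
    ((Ξ.snoc BB).get M.there).actC I = (Ξ.get M).actC (fun γ N => I γ N.there) := by
  rw [Bdry.actC_eq_ms, Bdry.actC_eq_ms, MCtx.get, Bdry.mrename_ms]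

theorem MCtx.get_here_actC {α : MArity} (BB : Bdry S ν α.cls α.bind 0)
    (I : Inst S (α :: ν) μ n) :
    ((Ξ.snoc BB).get MVar.here).actC I = BB.actC (fun γ N => I γ N.there) := by
  rw [Bdry.actC_eq_ms, Bdry.actC_eq_ms, MCtx.get, Bdry.mrename_ms]

/-- The analogue of `Fits.of_eq` for premises: equality of the earlier components makes the
boundaries of the next premise under `I` and `I'` convertible. This allows the conditional
hypothesis to be used and then places the new component at its own boundary. -/
theorem RawTheory.EInst.of_eq (hΞ : T.WfMCtx Ξ) {Γ : Ctx S μ n} (hΓ : T.WfCtx Θ Γ)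
    {I I' : Inst S ν μ n} (hI : T.DerivableInst Ξ Θ Γ I)
    (h : ∀ (α : MArity) (M : MVar ν α), α.cls.IsObj →
      (T.Derives Θ Γ (.judg ((Ξ.get M).actC I') (I' α M)) →
        T.Derives Θ Γ (.judg ((Ξ.get M).actC I) (I' α M))) →
      T.Derives Θ Γ (.eqn ((Ξ.get M).actC I) (I α M) (I' α M))) :
    T.EInst Ξ Θ Γ I I' := by
  induction hΞ with
  | nil => exact ⟨hI, fun _ M => (nomatch M), fun _ M => (nomatch M)⟩
  | @snoc ν α Ξ BB hΞ hBB ih =>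
    have ih := ih (I := fun γ N => I γ N.there) (I' := fun γ N => I' γ N.there)
      (fun β M => by rw [← MCtx.get_there_actC BB]; exact hI β M.there)
      (fun β M hβ => by
        have := h β M.there hβ
        rwa [MCtx.get_there_actC, MCtx.get_there_actC] at this)
    have hc := ih.bdryConv hΓ hBB
    have hb := ih.left.derives_bdry hΓ hBB
    have hb' := ih.right.derives_bdry hΓ hBB
    have hI₀ := hI α .here
    have h₀ := h α .here
    rw [MCtx.get_here_actC] at hI₀ h₀
    rw [MCtx.get_here_actC] at h₀
    have h₁ : T.Derives Θ Γ (.judg (BB.actC fun γ N => I' γ N.there) (I' α .here)) := by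
      by_cases hα : α.cls.IsObj
      · exact hc.judg ((h₀ hα fun h => hc.judg_left h hb).eqn_right hα hΓ) hb'
      -- An equational component is the same dummy on both sides, so converting the boundary
      -- suffices.
      · rw [Arg.eq_of_not_isObj hα (I' α .here) (I α .here)]
        exact hc.judg hI₀ hb'
    refine ⟨hI, ?_, ?_⟩
    · rintro β (_ | M)
      · rw [MCtx.get_here_actC]
        exact h₁
      · rw [MCtx.get_there_actC]
        exact ih.right β M
    · rintro β (_ | M) hβ
      · rw [MCtx.get_here_actC]
        exact h₀ hβ fun h => hc.judg_left h hb
      · rw [MCtx.get_there_actC]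
        exact ih.eq β M hβ

end Instantiation

/-! ### Inversion of applications -/

section AppInversion

variable {S : Signature.{u}} {T : RawTheory.{u, v} S} {μ ν ξ : List MArity} {c : Cls}
  {m n k l : ℕ} {Θ : MCtx S μ}

/-- What the derivability of an application at a boundary yields: the arguments are derivable and
the boundary is equal to the natural one. -/
def RawTheory.AppInv (T : RawTheory.{u, v} S) (Θ : MCtx S μ) :
    {c : Cls} → {m n : ℕ} → Ctx S μ n → Bdry S μ c m n → Arg S μ c m n → Prop
  | _, _, _, Γ, B, .sym f es => ∀ (Ξ : MCtx S (S.arity f)) (B₀ : Bdry S (S.arity f) _ 0 0),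
      T.IsRuleFor f Ξ B₀ → T.DerivableInst Ξ Θ Γ es ∧ T.BdryConv Θ Γ (B₀.actC es) B
  | _, _, _, Γ, B, .mvar _ M ts =>
      (∀ j, T.Derives Θ Γ (.judg (.tm ((Θ.get M).argTy ts j)) (ts j))) ∧
        T.BdryConv Θ Γ ((Θ.get M).inst ts) B
  | _, _, _, _, _, .var _ => True
  | _, _, _, _, _, .starTy => True
  | _, _, _, _, _, .starTm => True
  | _, _, _, _, _, .abs _ => True

/-- `AppInv` for judgements. -/
def RawTheory.AppInvStmt (T : RawTheory.{u, v} S) (Θ : MCtx S μ) (Γ : Ctx S μ n) :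
    Stmt S μ c m n → Prop
  | .judg BB e => T.AppInv Θ Γ BB e
  | .bdry _ => True

theorem RawTheory.AppInv.of_not_isObj (hc : ¬ c.IsObj) (Γ : Ctx S μ n) (BB : Bdry S μ c m n)
    (e : Arg S μ c m n) : T.AppInv Θ Γ BB e := by
  cases e with
  | var => trivial
  | sym f => exact absurd (S.isObj f) hc
  | mvar h => exact absurd h hc
  | starTy => trivial
  | starTm => trivial
  | abs => trivial

theorem RawTheory.BdryConv.trans_tm {Γ : Ctx S μ n} {B : Bdry S μ .tm 0 n} {A A' : Ty S μ n}
    (h : T.BdryConv Θ Γ B (.tm A)) (h' : T.Derives Θ Γ (.judg (.eqTy A A') .starTy)) :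
    T.BdryConv Θ Γ B (.tm A') := by
  cases h with
  | tm h => exact .tm (h.tyTran h')

theorem sym_genApp_actC (f : S.Sym c) (I : Inst S (S.arity f) μ n) :
    (Arg.sym f (genApp S) : Arg S (S.arity f) c 0 0).actC I = .sym f I := by
  rw [Arg.actC_eq_ms]
  simp only [Arg.ms, genApp_ms]

theorem RawTheory.IsStandard.isRuleFor_unique (hT : T.IsStandard) {f : S.Sym c}
    {Ξ Ξ' : MCtx S (S.arity f)} {B B' : Bdry S (S.arity f) c 0 0} (h : T.IsRuleFor f Ξ B)
    (h' : T.IsRuleFor f Ξ' B') : Ξ' = Ξ ∧ B' = B := by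
  obtain ⟨i, hi⟩ := h
  obtain ⟨j, hj⟩ := h'
  have : i = j := (hT.existsUnique c f).unique ⟨Ξ, B, hi⟩ ⟨Ξ', B', hj⟩
  subst this
  rw [hi] at hj
  simp only [symbolRule, RawRule.mk.injEq, heq_eq_eq, true_and, and_true] at hj
  exact ⟨hj.1.symm, hj.2.symm⟩

/-- An application can be introduced only by its own rule, followed by conversions, which accumulate
into a single equation of boundaries. Standardness enters because every object rule is a symbol rule
and each symbol has a single one. -/
theorem RawTheory.Derives.appInv_aux (hT : T.IsStandard) {Γ : Ctx S μ n} {J : Stmt S μ c m n}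
    (h : T.Derives Θ Γ J) : T.AppInvStmt Θ Γ J := by
  induction h with
  | @mvar n Γ c k M ts h₁ h₂ =>
    cases c with
    | ty => exact ⟨h₁, .refl h₂⟩
    | tm => exact ⟨h₁, .refl h₂⟩
    | eqTy => trivial
    | eqTm => trivial
  | @convTm n Γ t A B _ h ih =>
    cases t with
    | var => trivial
    | sym f es => exact fun Ξ B₀ hf => ⟨(ih Ξ B₀ hf).1, (ih Ξ B₀ hf).2.trans_tm h⟩
    | mvar hc M ts => exact ⟨ih.1, ih.2.trans_tm h⟩
  | @rule n Γ c i I h₁ h₂ =>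
    by_cases hc : c.IsObj
    · obtain ⟨f, Ξ, B, hi⟩ := hT.isSymbolRule c i hc
      have hf : T.IsRuleFor f Ξ B := ⟨i, hi⟩
      -- The type of `I` depends on the rule; the claim is therefore proved for `symbolRule` first,
      -- and afterwards `T.rule i` is generalized so that the equation can be substituted.
      have key : ∀ I : Inst S (S.arity f) μ n, T.DerivableInst Ξ Θ Γ I →
          T.Derives Θ Γ (.bdry (B.actC I)) →
          T.AppInv Θ Γ (B.actC I) (Arg.actC I (.sym f (genApp S))) := by
        intro I h₁ h₂
        rw [sym_genApp_actC]
        intro Ξ' B' hf'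
        obtain ⟨rfl, rfl⟩ := hT.isRuleFor_unique hf hf'
        exact ⟨h₁, .refl h₂⟩
      generalize T.rule i = R at *
      subst hi
      exact key I h₁ h₂
    · exact RawTheory.AppInv.of_not_isObj hc _ _ _
  | _ => trivial

theorem RawTheory.Derives.appInv (hT : T.IsStandard) {Γ : Ctx S μ n} {BB : Bdry S μ c m n}
    {e : Arg S μ c m n} (h : T.Derives Θ Γ (.judg BB e)) : T.AppInv Θ Γ BB e :=
  h.appInv_aux hT

theorem RawTheory.IsRuleFor.finitary (hT : T.IsStandard) {f : S.Sym c}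
    {Ξ : MCtx S (S.arity f)} {B : Bdry S (S.arity f) c 0 0} (h : T.IsRuleFor f Ξ B) :
    T.WfMCtx Ξ ∧ T.Derives Ξ Ctx.nil (.bdry B) := by
  obtain ⟨i, hi⟩ := h
  have := hT.finitary c i
  rw [hi] at this
  exact this

/-- For a term symbol the congruence rule also demands that the two instantiated types be equal; as
the conclusion boundary of a finitary rule is well formed, this follows from preservation of
equality. -/
theorem RawTheory.IsRuleFor.congr (hT : T.IsStandard) {f : S.Sym c}
    {Ξ : MCtx S (S.arity f)} {B : Bdry S (S.arity f) c 0 0} (h : T.IsRuleFor f Ξ B)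
    {Γ : Ctx S μ n} (hΓ : T.WfCtx Θ Γ) {es ds : Inst S (S.arity f) μ n}
    (he : T.EInst Ξ Θ Γ es ds) : T.Derives Θ Γ (.eqn (B.actC es) (.sym f es) (.sym f ds)) := by
  have hB := he.bdryConv hΓ (h.finitary hT).2
  obtain ⟨i, hi⟩ := h
  rcases S.isObj f with rfl | rfl
  · rw [Stmt.eqn_ty]
    have key := RawTheory.Derives.congrTy (T := T) (Θ := Θ) (Γ := Γ) i
    rw [hi] at key
    rw [← sym_genApp_actC f es, ← sym_genApp_actC f ds]
    exact key es ds he.left he.right he.eq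
  · rw [Stmt.eqn_tm]
    have key := RawTheory.Derives.congrTm (T := T) (Θ := Θ) (Γ := Γ) i
    rw [hi] at key
    rw [← sym_genApp_actC f es, ← sym_genApp_actC f ds]
    exact key es ds he.left he.right he.eq hB.type

end AppInversion

/-! ### Promotion of variables to metavariables -/

section Promotion

variable {S : Signature.{u}} {T : RawTheory.{u, v} S} {μ ν ξ : List MArity} {c : Cls}
  {m n k l : ℕ} {Θ : MCtx S μ}

theorem RawTheory.WfCtx.wfMCtx {Γ : Ctx S μ n} (h : T.WfCtx Θ Γ) : T.WfMCtx Θ := by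
  induction h with
  | nil h => exact h
  | snoc _ _ ih => exact ih

theorem Bdry.mrename_mrename (BB : Bdry S ξ c m n) (ρ : ∀ α : MArity, MVar ξ α → MVar ν α)
    (θ : ∀ α : MArity, MVar ν α → MVar μ α) :
    (BB.mrename ρ).mrename θ = BB.mrename (fun α M => θ α (ρ α M)) := by
  rw [Bdry.mrename_eq_ms, Bdry.mrename_ms, Bdry.mrename_eq_ms]
  rfl

theorem MCtx.Ren.there {α : MArity} (Θ : MCtx S μ) (BB : Bdry S μ α.cls α.bind 0) :
    Θ.Ren (Θ.snoc BB) (fun _ => MVar.there) := fun _ _ => rfl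

theorem MCtx.Ren.comp {Ξ : MCtx S ξ} {Φ : MCtx S ν} {ρ : ∀ α : MArity, MVar ξ α → MVar ν α}
    {θ : ∀ α : MArity, MVar ν α → MVar μ α} (h : Ξ.Ren Φ ρ) (h' : Φ.Ren Θ θ) :
    Ξ.Ren Θ (fun α M => θ α (ρ α M)) := by
  intro α M
  rw [h', h, Bdry.mrename_mrename]

theorem RawTheory.Derives.mrename {Ξ : MCtx S ν} {ρ : ∀ α : MArity, MVar ν α → MVar μ α}
    (hρ : Ξ.Ren Θ ρ) {BB : Bdry S ν c m 0} {e : Arg S ν c m 0}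
    (h : T.Derives Ξ Ctx.nil (.judg BB e)) :
    T.Derives Θ Ctx.nil (.judg (BB.mrename ρ) (e.mrename ρ)) := by
  rw [Bdry.mrename_eq_ms, Arg.mrename_eq_ms]
  exact h.ms_gen hρ fun i => i.elim0

theorem RawTheory.Derives.mrename_bdry {Ξ : MCtx S ν} {ρ : ∀ α : MArity, MVar ν α → MVar μ α}
    (hρ : Ξ.Ren Θ ρ) {BB : Bdry S ν c m 0} (h : T.Derives Ξ Ctx.nil (.bdry BB)) :
    T.Derives Θ Ctx.nil (.bdry (BB.mrename ρ)) := by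
  rw [Bdry.mrename_eq_ms]
  exact h.ms_gen hρ fun i => i.elim0

theorem RawTheory.WfMCtx.get (h : T.WfMCtx Θ) {α : MArity} (M : MVar μ α) :
    T.Derives Θ Ctx.nil (.bdry (Θ.get M)) := by
  induction h with
  | nil => exact nomatch M
  | snoc _ h ih =>
    cases M with
    | here => exact h.mrename_bdry (MCtx.Ren.there _ _)
    | there M => exact (ih M).mrename_bdry (MCtx.Ren.there _ _)

theorem Arg.ms_closed (e : Arg S μ c m 0) (σ : Fin 0 → Tm S μ 0) : e.ms Inst.idn σ = e := by
  rw [elim0_eq σ Arg.var, Arg.ms_gen_var]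

theorem Arg.ms_mrename (e : Arg S ξ c m n) (I : Inst S ξ ν 0) (σ : Fin n → Tm S ν 0)
    (ρ : ∀ α : MArity, MVar ν α → MVar μ α) :
    (e.ms I σ).mrename ρ =
      e.ms (fun α M => (I α M).mrename ρ) (fun i => (σ i).mrename ρ) := by
  simp only [Arg.mrename_eq_ms, Arg.ms_ms]
  rfl

theorem genApp_mrename {α : MArity} (M : MVar ν α) (ρ : ∀ α : MArity, MVar ν α → MVar μ α) :
    (genApp S α M : Arg S ν _ _ n).mrename ρ = genApp S α (ρ α M) := by
  rw [Arg.mrename_eq_ms, genApp_ms]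
  rfl

/-- Under its binders a generic application is an instance of the metavariable rule, whose premises
are what `judg_of_instances` supplies. It is the promotion of the empty variable context. -/
theorem derivableInst_idn (h : T.WfMCtx Θ) : T.DerivableInst Θ Θ Ctx.nil Inst.idn := by
  intro α M
  have h' : (Θ.get M).actC Inst.idn = Θ.get M := by
    rw [Bdry.actC_eq_ms, elim0_eq Fin.elim0 Arg.var, Bdry.ms_gen_var]
  rw [h']
  refine RawTheory.Derives.judg_of_instances (.nil h) (h.get M) fun k Δ ρ ts _ _ hts hb => ?_
  rw [elim0_eq (fun i => Arg.var (ρ i)) Fin.elim0] at hts hb ⊢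
  have h₀ : (Inst.idn α M : Arg S μ _ _ 0).instAux Fin.elim0 ts = Arg.mapp M ts :=
    genApp_instAux _ _ _
  rw [h₀]
  exact .mvar M ts hts hb

/-- `Θ'` extends `Θ` by metavariables which stand for the variables of `Γ`: the inclusion is `ρ`,
the metavariables are applied in `τ`, and `D` turns them back into variables. -/
structure RawTheory.IsPromotion (T : RawTheory.{u, v} S) (Θ : MCtx S μ) (Γ : Ctx S μ k)
    (Θ' : MCtx S ν) (ρ : ∀ α : MArity, MVar μ α → MVar ν α) (τ : Fin k → Tm S ν 0)
    (D : Inst S ν μ k) : Prop where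
  wf : T.WfMCtx Θ'
  ren : Θ.Ren Θ' ρ
  wSub : T.WSub Θ' Γ Ctx.nil (Inst.gen ρ) τ
  derivable : T.DerivableInst Θ' Θ Γ D
  incl : ∀ (α : MArity) (M : MVar μ α), D α (ρ α M) = genApp S α M
  vars : ∀ i, (τ i).ms D Fin.elim0 = .var i

/-- Promoting and then demoting is the identity, so nothing is lost by working over an empty
variable context. -/
theorem RawTheory.IsPromotion.ms_ms {Γ : Ctx S μ k} {Θ' : MCtx S ν}
    {ρ : ∀ α : MArity, MVar μ α → MVar ν α} {τ : Fin k → Tm S ν 0} {D : Inst S ν μ k}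
    (h : T.IsPromotion Θ Γ Θ' ρ τ D) (e : Arg S μ c m k) :
    (e.ms (Inst.gen ρ) τ).ms D Fin.elim0 = e := by
  rw [Arg.ms_ms, Inst.gen_ms, funext h.vars, funext fun α => funext (h.incl α)]
  exact e.ms_gen_var

/-- The new variable becomes a metavariable without arguments, whose type is `A` with the earlier
variables already promoted; the old demotion is weakened and sends it to variable `0`. -/
theorem RawTheory.IsPromotion.snoc {Γ : Ctx S μ k} {Θ' : MCtx S ν}
    {ρ : ∀ α : MArity, MVar μ α → MVar ν α} {τ : Fin k → Tm S ν 0} {D : Inst S ν μ k}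
    (h : T.IsPromotion Θ Γ Θ' ρ τ D) {A : Ty S μ k} (hA : T.Derives Θ Γ (.judg .ty A)) :
    T.IsPromotion Θ (Γ.snoc A) (Θ'.snoc (α := ⟨.tm, 0⟩) (.tm (A.ms (Inst.gen ρ) τ)))
      (fun α M => (ρ α M).there)
      (Fin.cases (Arg.mapp .here Fin.elim0) (fun i => (τ i).mrename (fun _ => MVar.there)))
      (D.wk.cons (.var 0)) := by
  set A' := A.ms (Inst.gen ρ) τ with hA'
  have dA' : T.Derives Θ' Ctx.nil (.judg .ty A') := hA.ms_gen h.ren h.wSub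
  have hthere := MCtx.Ren.there Θ' (α := ⟨.tm, 0⟩) (.tm A')
  have hτ : ∀ (B : Ty S μ k), (B.rename Fin.succ).ms
      (Inst.gen fun α M => MVar.there (β := ⟨.tm, 0⟩) (ρ α M))
      (Fin.cases (Arg.mapp .here Fin.elim0) (fun i => (τ i).mrename (fun _ => MVar.there))) =
      (B.ms (Inst.gen ρ) τ).mrename (fun _ => MVar.there) := by
    intro B
    rw [rename_succ_ms_cases, Arg.ms_mrename]
    congr 1
    funext α M
    exact (genApp_mrename (ρ α M) fun _ => MVar.there).symm
  refine ⟨.snoc h.wf (.bdryTm dA'), h.ren.comp hthere, fun i => ?_, ?_, fun α M => ?_, fun i => ?_⟩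
  · refine Fin.cases ?_ (fun i => ?_) i
    · rw [Ctx.get_zero, hτ]
      have h₀ : ((Θ'.snoc (α := ⟨.tm, 0⟩) (.tm A')).get MVar.here).inst
          (Fin.elim0 : Fin 0 → Tm S _ 0) = .tm (A'.mrename (fun _ => MVar.there)) := by
        rw [Bdry.inst, Bdry.instAux_zero]
        exact congrArg Bdry.tm (Arg.ms_closed _ _)
      have := RawTheory.Derives.mvar (T := T) (Θ := Θ'.snoc (α := ⟨.tm, 0⟩) (.tm A'))
        (Γ := Ctx.nil) MVar.here Fin.elim0 (fun j => j.elim0)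
        (by rw [h₀]; exact .bdryTm (dA'.mrename hthere))
      rwa [h₀] at this
    · rw [Ctx.get_succ, hτ]
      exact (h.wSub i).mrename hthere
  · rintro α (_ | M)
    · rw [MCtx.get_here_actC, Bdry.actC_eq_ms]
      have h₀ := congrArg (Arg.rename Fin.succ) (h.ms_ms A)
      rw [Arg.rename_ms, elim0_eq (fun i => _) Fin.elim0] at h₀
      have := RawTheory.Derives.var (T := T) (Θ := Θ) (Γ := Γ.snoc A) 0
      rw [Ctx.get_zero, ← h₀] at this
      exact this
    · have := (h.derivable α M).weaken A
      rw [Bdry.rename_eq_ms, Bdry.actC_ms] at this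
      rw [MCtx.get_there_actC]
      convert this using 3
      · funext β N
        exact (Arg.rename_eq_subst _ _).trans (Arg.subst_eq_ms _ _)
      · rfl
  · change (D α (ρ α M)).rename Fin.succ = _
    rw [h.incl, Arg.rename_eq_subst, genApp_subst]
  · refine Fin.cases ?_ (fun i => ?_) i
    · simp only [Fin.cases_zero, Arg.mapp_ms]
      rfl
    · simp only [Fin.cases_succ, Arg.mrename_ms]
      have := congrArg (Arg.rename Fin.succ) (h.vars i)
      rw [Arg.rename_ms, elim0_eq (fun i => _) Fin.elim0] at this
      exact this

theorem RawTheory.WfCtx.exists_promotion {Γ : Ctx S μ k} (hΓ : T.WfCtx Θ Γ) :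
    ∃ (ν : List MArity) (Θ' : MCtx S ν) (ρ : ∀ α : MArity, MVar μ α → MVar ν α)
      (τ : Fin k → Tm S ν 0) (D : Inst S ν μ k), T.IsPromotion Θ Γ Θ' ρ τ D := by
  induction hΓ with
  | nil h =>
    exact ⟨μ, Θ, fun _ M => M, Fin.elim0, Inst.idn, h, MCtx.Ren.id Θ, fun i => i.elim0,
      derivableInst_idn h, fun _ _ => rfl, fun i => i.elim0⟩
  | snoc _ hA ih =>
    obtain ⟨ν, Θ', ρ, τ, D, h⟩ := ih
    exact ⟨_, _, _, _, _, h.snoc hA⟩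

end Promotion

/-! ### The equational residue -/

section Residue

variable {S : Signature.{u}} {T : RawTheory.{u, v} S} {μ ν ξ : List MArity} {c : Cls}
  {m n k l : ℕ} {Θ : MCtx S μ}

/-- Extension of an instantiation to the metavariables of the residue by dummy arguments. -/
def resInst (K : Inst S μ ξ k) : (ν : List MArity) → Inst S (resAr μ ν) ξ k
  | [], α, M => K α M
  | ⟨.ty, _⟩ :: ν, α, M => resInst K ν α M
  | ⟨.tm, _⟩ :: ν, α, M => resInst K ν α M
  | ⟨.eqTy, m⟩ :: _, _, .here => Arg.dummy .ty m
  | ⟨.eqTy, _⟩ :: ν, α, .there M => resInst K ν α M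
  | ⟨.eqTm, m⟩ :: _, _, .here => Arg.dummy .tm m
  | ⟨.eqTm, _⟩ :: ν, α, .there M => resInst K ν α M

theorem resInst_resIncl (K : Inst S μ ξ k) (ν : List MArity) {α : MArity} (M : MVar μ α) :
    resInst K ν α (resIncl ν α M) = K α M := by
  induction ν with
  | nil => rfl
  | cons β ν ih =>
    obtain ⟨_ | _, k⟩ := β <;> exact ih

/-- In the second alternative only the boundary is recorded: the metavariable is equational, so its
instantiation is a dummy in any case. -/
theorem residue_cases (Θ : MCtx S μ) {ν : List MArity} (Ξ : MCtx S ν) (I : Inst S ν μ 0)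
    {α : MArity} (M : MVar (resAr μ ν) α) :
    (∃ N : MVar μ α, M = resIncl ν α N ∧
      (residue Θ Ξ I).get M = (Θ.get N).mrename (resIncl ν)) ∨
    (∃ N : MVar ν α, ¬ α.cls.IsObj ∧
      (residue Θ Ξ I).get M = ((Ξ.get N).actC I).mrename (resIncl ν)) := by
  induction Ξ with
  | nil =>
    exact Or.inl ⟨M, rfl, MCtx.Ren.id Θ α M⟩
  | @snoc ν β Ξ BB ih =>
    obtain ⟨_ | _, k⟩ := β
    · rcases ih (fun α M => I α M.there) M with h | ⟨N, hα, h⟩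
      · exact Or.inl h
      · refine Or.inr ⟨N.there, hα, ?_⟩
        rw [MCtx.get_there_actC]
        exact h
    · rcases ih (fun α M => I α M.there) M with h | ⟨N, hα, h⟩
      · exact Or.inl h
      · refine Or.inr ⟨N.there, hα, ?_⟩
        rw [MCtx.get_there_actC]
        exact h
    all_goals
      rcases M with _ | M
      · refine Or.inr ⟨.here, (by rintro (h | h) <;> cases h), ?_⟩
        rw [MCtx.get_here_actC]
        exact Bdry.mrename_mrename _ _ _
      · rcases ih (fun α M => I α M.there) M with ⟨N, rfl, h⟩ | ⟨N, hα, h⟩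
        · exact Or.inl ⟨N, rfl, (congrArg (Bdry.mrename fun _ => MVar.there) h).trans
            (Bdry.mrename_mrename _ _ _)⟩
        · refine Or.inr ⟨N.there, hα, ?_⟩
          rw [MCtx.get_there_actC]
          exact (congrArg (Bdry.mrename fun _ => MVar.there) h).trans (Bdry.mrename_mrename _ _ _)

end Residue

/-! ### Use of object-invertible rules -/

section ObjectInvertible

variable {S : Signature.{u}} {T : RawTheory.{u, v} S} {μ ν ξ : List MArity} {c : Cls}
  {m n k l : ℕ} {Θ : MCtx S μ}

/-- Every instance of an equational premise of `Ξ`, instantiated by `I`, is derivable as soon as its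
boundary is. -/
def RawTheory.EqSound (T : RawTheory.{u, v} S) (Ξ : MCtx S ν) (Θ : MCtx S μ) (I : Inst S ν μ n) :
    Prop :=
  ∀ (α : MArity) (N : MVar ν α), ¬ α.cls.IsObj → ∀ (l : ℕ) (Δ : Ctx S μ l) (τ : Fin n → Tm S μ l)
    (ts : Fin α.bind → Tm S μ l) (e : Arg S μ α.cls 0 l), T.WfCtx Θ Δ →
    T.Derives Θ Δ (.bdry (((Ξ.get N).actC I).instAux τ ts)) →
    T.Derives Θ Δ (.judg (((Ξ.get N).actC I).instAux τ ts) e)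

theorem Inst.subst_subst (I : Inst S ν μ n) (σ : Fin n → Tm S μ k) (τ : Fin k → Tm S μ l) :
    (I.subst σ).subst τ = I.subst (fun i => (σ i).subst τ) := by
  funext α M
  exact Arg.subst_subst _ _ _

theorem Bdry.actC_subst_instAux (BB : Bdry S ν c m 0) (I : Inst S ν μ n) (σ : Fin n → Tm S μ k)
    (τ : Fin k → Tm S μ l) (ts : Fin m → Tm S μ l) :
    (BB.actC (I.subst σ)).instAux τ ts =
      (BB.actC I).instAux (fun i => (σ i).subst τ) ts := by
  rw [Bdry.actC_instAux, Bdry.actC_instAux, Inst.subst_subst]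

theorem RawTheory.EqSound.subst {Ξ : MCtx S ν} {I : Inst S ν μ n} (h : T.EqSound Ξ Θ I)
    (σ : Fin n → Tm S μ k) : T.EqSound Ξ Θ (I.subst σ) := by
  intro α N hα l Δ τ ts e hΔ
  rw [Bdry.actC_subst_instAux]
  exact h α N hα l Δ _ ts e hΔ

theorem Bdry.mrename_actC (BB : Bdry S ξ c m 0) (ρ : ∀ α : MArity, MVar ξ α → MVar ν α)
    (I : Inst S ν μ n) : (BB.mrename ρ).actC I = BB.actC (fun α M => I α (ρ α M)) := by
  rw [Bdry.actC_eq_ms, Bdry.actC_eq_ms, Bdry.mrename_ms]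

theorem Arg.mrename_actC (e : Arg S ξ c m 0) (ρ : ∀ α : MArity, MVar ξ α → MVar ν α)
    (I : Inst S ν μ n) : (e.mrename ρ).actC I = e.actC (fun α M => I α (ρ α M)) := by
  rw [Arg.actC_eq_ms, Arg.actC_eq_ms, Arg.mrename_ms]

theorem Bdry.actC_actC (BB : Bdry S ξ c m 0) (J : Inst S ξ ν 0) (I : Inst S ν μ n) :
    (BB.actC J).actC I = BB.actC (J.ms I Fin.elim0) := by
  rw [Bdry.actC_eq_ms (BB.actC J), Bdry.actC_ms]

theorem resInst_comp_resIncl (K : Inst S μ ξ k) (ν : List MArity) :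
    (fun α M => resInst K ν α (resIncl ν α M)) = K := by
  funext α M
  exact resInst_resIncl K ν M

/-- This eliminates the postulated equations. The application rule for a residual metavariable
supplies its instantiated boundary, which is exactly what `EqSound` needs; the congruence rules
concern object metavariables, and those all come from `Θ'`. -/
theorem residue_admissible {Θ' : MCtx S ξ} (Ξ : MCtx S ν) (J : Inst S ν ξ 0) {Γ : Ctx S μ n}
    {K : Inst S ξ μ n} (hK : T.Admissible Θ' Θ Γ K) (hE : T.EqSound Ξ Θ (J.ms K Fin.elim0)) :
    T.Admissible (residue Θ' Ξ J) Θ Γ (resInst K ν) := by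
  intro k Δ ρ hΔ hρ
  obtain ⟨h₁, h₂, h₃⟩ := hK k Δ ρ hΔ hρ
  simp only [Inst.rename_inst, Bdry.actC_instAux_ren, Bdry.actC_argTyAux_ren] at h₁ h₂ h₃
  constructor
  · intro c m M ts
    simp only [Inst.rename_inst, Bdry.actC_instAux_ren, Bdry.actC_argTyAux_ren]
    rcases residue_cases Θ' Ξ J M with ⟨N, rfl, hN⟩ | ⟨N, hα, hN⟩
    · rw [hN, Bdry.mrename_actC, resInst_comp_resIncl, resInst_resIncl]
      exact h₁ N ts
    · rw [hN, Bdry.mrename_actC, resInst_comp_resIncl, Bdry.actC_actC]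
      exact fun _ h => hE _ N hα k Δ _ ts _ hΔ h
  · intro m M ss ts
    simp only [Inst.rename_inst, Bdry.actC_argTyAux_ren]
    rcases residue_cases Θ' Ξ J M with ⟨N, rfl, hN⟩ | ⟨N, hα, hN⟩
    · rw [hN, Bdry.mrename_actC, resInst_comp_resIncl, resInst_resIncl]
      exact h₂ N ss ts
    · exact absurd (Or.inl rfl) hα
  · intro m M ss ts
    simp only [Inst.rename_inst, Bdry.actC_instAux_ren, Bdry.actC_argTyAux_ren]
    rcases residue_cases Θ' Ξ J M with ⟨N, rfl, hN⟩ | ⟨N, hα, hN⟩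
    · rw [hN, Bdry.mrename_actC, resInst_comp_resIncl, resInst_resIncl]
      exact h₃ N ss ts
    · exact absurd (Or.inr rfl) hα

/-- Promote the variables, invert over the residue, then demote while filling the residue with
dummies. No equational premise is assumed derivable in advance; only its instances with derivable
boundary are required to hold. -/
theorem RawTheory.ObjectInvertible.derivableInst {R : RawRule S c} (hR : T.ObjectInvertible R)
    {Γ : Ctx S μ n} (hΓ : T.WfCtx Θ Γ) {I : Inst S R.ar μ n}
    (h : T.Derives Θ Γ (.judg (R.bdry.actC I) (R.head.actC I))) (hE : T.EqSound R.prem Θ I) :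
    T.DerivableInst R.prem Θ Γ I := by
  obtain ⟨ξ, Θ', ρ, τ, K, hp⟩ := hΓ.exists_promotion
  have hI : (I.ms (Inst.gen ρ) τ).ms K Fin.elim0 = I := by
    funext α M
    exact hp.ms_ms (I α M)
  have h' := h.ms_gen hp.ren hp.wSub
  rw [Stmt.ms, Bdry.actC_ms, Arg.actC_ms] at h'
  have hD := hR.2 ξ Θ' _ hp.wf h'
  have hA := residue_admissible (T := T) R.prem (I.ms (Inst.gen ρ) τ) hp.derivable.admissible
    (by rwa [hI])
  -- The residual instantiation returns to `I`: on object premises by the round trip of the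
  -- promotion, on equational ones because their arguments are unique.
  have hres : (residualInst (I.ms (Inst.gen ρ) τ)).ms (resInst K R.ar) Fin.elim0 = I := by
    have hobj : ∀ (α : MArity) (M : MVar R.ar α),
        ((I.ms (Inst.gen ρ) τ α M).mrename (resIncl R.ar)).ms (resInst K R.ar) Fin.elim0 =
          I α M := by
      intro α M
      rw [Arg.mrename_ms, resInst_comp_resIncl]
      exact hp.ms_ms (I α M)
    funext α M
    obtain ⟨_ | _, k⟩ := α
    · exact hobj _ M
    · exact hobj _ M
    · exact Arg.eq_of_not_isObj Cls.not_isObj_eqTy _ _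
    · exact Arg.eq_of_not_isObj Cls.not_isObj_eqTm _ _
  intro α M
  have := hA.derives hΓ (hD α M)
  rw [Stmt.ms, Bdry.actC_ms, hres] at this
  rwa [← congrFun (congrFun hres α) M]

end ObjectInvertible

/-! ### Computation rules and extensionality rules are sound -/

section Rules

variable {S : Signature.{u}} {T : RawTheory.{u, v} S} {μ ν ξ : List MArity} {c : Cls}
  {m n k l : ℕ} {Θ : MCtx S μ}

theorem Bdry.eqn_actC (BB : Bdry S ν c m 0) (e₁ e₂ : Arg S ν c m 0) (I : Inst S ν μ n) :
    (BB.eqn e₁ e₂).actC I = (BB.actC I).eqn (e₁.actC I) (e₂.actC I) := by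
  simp only [Bdry.actC_eq_ms, Arg.actC_eq_ms, Bdry.eqn_ms]

theorem RawTheory.DerivableInst.derives_eqn {Ξ : MCtx S ν} {Γ : Ctx S μ n} {I : Inst S ν μ n}
    (h : T.DerivableInst Ξ Θ Γ I) (hΓ : T.WfCtx Θ Γ) {BB : Bdry S ν c m 0}
    {e₁ e₂ : Arg S ν c m 0} (hJ : T.Derives Ξ Ctx.nil (.eqn BB e₁ e₂)) :
    T.Derives Θ Γ (.eqn (BB.actC I) (e₁.actC I) (e₂.actC I)) := by
  have := h.derives_judg hΓ hJ
  rwa [Bdry.eqn_actC, Arg.eq_of_not_isObj c.eqn_not_isObj (Arg.actC _ _) (Arg.dummy c m)] at this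

theorem Arg.sym_actC (f : S.Sym c) (es : Inst S (S.arity f) ν 0) (I : Inst S ν μ n) :
    (Arg.sym f es).actC I = .sym f (es.ms I Fin.elim0) := by
  rw [Arg.actC_eq_ms]
  rfl

/-- For terms three types are in play: the one in `B`, the natural type of `p`, at which
invertibility is formulated, and the type in `R.bdry`. Inversion over `Γ` compares the first two,
inversion over the premises of the rule compares the last two. -/
theorem RawTheory.IsComputationRule.sound (hT : T.IsStandard) (hc : c.IsObj) {R : Rewrite S c}
    (hR : T.IsComputationRule R) {Γ : Ctx S μ n} (hΓ : T.WfCtx Θ Γ) {I : Inst S R.ar μ n}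
    (hE : T.EqSound R.prem Θ I) {B : Bdry S μ c 0 n}
    (h : T.Derives Θ Γ (.judg B (R.lhs.actC I))) :
    T.Derives Θ Γ (.eqn B (R.lhs.actC I) (R.rhs.actC I)) := by
  rcases hc with rfl | rfl
  · obtain ⟨h₁, -, -, h₂⟩ := hR
    rw [Bdry.eq_ty B] at h ⊢
    have hI := h₂.derivableInst hΓ h hE
    have := hI.derives_eqn hΓ (BB := R.bdry) h₁
    rwa [Bdry.eq_ty (R.bdry.actC I)] at this
  · obtain ⟨h₁, ⟨hprem, -⟩, ⟨f, es, hlhs⟩, A, hA, -, h₂⟩ := hR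
    rw [hlhs] at hA
    cases hA with
    | sym f es Ξ B₀ hf =>
    have hconv : T.BdryConv Θ Γ ((B₀.actC es).actC I) B := by
      rw [hlhs, Arg.sym_actC] at h
      rw [Bdry.actC_actC]
      exact (h.appInv hT Ξ B₀ hf).2
    have hB : (B₀.actC es).actC I = (Bdry.tm (B₀.actC es).type).actC I := by
      conv_lhs => rw [Bdry.eq_tm (B₀.actC es)]
    have hbdry : T.Derives Θ Γ (.bdry ((B₀.actC es).actC I)) := by
      rw [Bdry.eq_tm ((B₀.actC es).actC I)]
      exact .bdryTm (hconv.type.presup hΓ).bdryEqTy_inv.1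
    have h' := hconv.judg_left h hbdry
    rw [hB] at h'
    have hI := h₂.derivableInst hΓ h' hE
    have h₃ := hI.derives_eqn hΓ (BB := R.bdry) h₁
    -- Derivability of the rule presupposes `p` at `R.bdry`; inverting this judgement equates the
    -- natural type with `R.bdry.type` before instantiation by `I`.
    have h₄ := RawTheory.Derives.eqn_left (Or.inr rfl) (BB := R.bdry) h₁ (.nil hprem)
    rw [hlhs] at h₄
    have h₅ := (h₄.appInv hT Ξ B₀ hf).2.type
    have h₆ : T.BdryConv Θ Γ ((B₀.actC es).actC I) (R.bdry.actC I) := by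
      rw [hB, Bdry.eq_tm R.bdry]
      exact .tm (hI.derives_judg hΓ h₅)
    exact hconv.eqn_right (Or.inr rfl) (h₆.eqn_left (Or.inr rfl) h₃)

theorem EqPrem.extend_incl (Φ : EqPrem S ν ξ) (I : Inst S ν μ n) {α : MArity} (M : MVar ν α) :
    Φ.extend I α (Φ.incl α M) = I α M := by
  induction Φ with
  | nil => rfl
  | snoc Φ _ _ ih => exact ih

theorem EqPrem.append_get_incl (Ξ : MCtx S ν) (Φ : EqPrem S ν ξ) {α : MArity} (M : MVar ν α) :
    (Φ.append Ξ).get (Φ.incl α M) = (Ξ.get M).mrename Φ.incl := by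
  induction Φ with
  | nil => exact MCtx.Ren.id Ξ α M
  | snoc Φ _ _ ih =>
    exact (congrArg (Bdry.mrename fun _ => MVar.there) ih).trans (Bdry.mrename_mrename _ _ _)

theorem EqPrem.extend_subst (Φ : EqPrem S ν ξ) (I : Inst S ν μ n) (σ : Fin n → Tm S μ k) :
    (Φ.extend I).subst σ = Φ.extend (I.subst σ) := by
  induction Φ with
  | nil => rfl
  | snoc Φ hα _ ih =>
    funext β M
    cases M with
    | here => exact Arg.eq_of_not_isObj hα _ _
    | there M => exact congrFun (congrFun ih β) M

theorem Inst.cons_subst (I : Inst S ν μ n) (t : Tm S μ n) (σ : Fin n → Tm S μ k) :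
    (I.cons t).subst σ = (I.subst σ).cons (t.subst σ) := by
  funext β M
  cases M <;> rfl

theorem RawTheory.DerivableInst.snoc {Ξ : MCtx S ν} {α : MArity} {BB : Bdry S ν α.cls α.bind 0}
    {Γ : Ctx S μ n} {I : Inst S (α :: ν) μ n}
    (h : T.DerivableInst Ξ Θ Γ (fun β M => I β M.there))
    (h' : T.Derives Θ Γ (.judg (BB.actC fun β M => I β M.there) (I α .here))) :
    T.DerivableInst (Ξ.snoc BB) Θ Γ I := by
  rintro β (_ | M)
  · rw [MCtx.get_here_actC]
    exact h'
  · rw [MCtx.get_there_actC]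
    exact h β M

/-- Going through `Φ` in order, the premises already treated make the boundary of the next one
derivable, and then `EqSound` yields the equation itself on generic instances. -/
theorem EqPrem.derivableInst_extend (Φ : EqPrem S ν ξ) {Ξ : MCtx S ν} (hΞ : T.WfMCtx (Φ.append Ξ))
    {Γ : Ctx S μ n} (hΓ : T.WfCtx Θ Γ) {I : Inst S ν μ n} (hI : T.DerivableInst Ξ Θ Γ I)
    (hE : T.EqSound (Φ.append Ξ) Θ (Φ.extend I)) :
    T.DerivableInst (Φ.append Ξ) Θ Γ (Φ.extend I) := by
  induction Φ with
  | nil => exact hI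
  | @snoc ξ α Φ hα BB ih =>
    cases hΞ with
    | snoc hΞ hBB =>
    have h := ih hΞ fun β N hβ l Δ τ ts e hΔ hb => by
      have := hE β N.there hβ l Δ τ ts e hΔ
      rw [EqPrem.append, MCtx.get_there_actC] at this
      exact this hb
    refine h.snoc (RawTheory.Derives.judg_of_instances hΓ (h.derives_bdry hΓ hBB)
      fun k Δ ρ ts hΔ _ _ hb => ?_)
    have := fun e => hE α .here hα k Δ (fun i => .var (ρ i)) ts e hΔ
    simp only [EqPrem.append, MCtx.get_here_actC] at this
    exact this _ hb

theorem Arg.mapp_actC_elim0 (M : MVar ν ⟨c, 0⟩) (I : Inst S ν μ n) :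
    (Arg.mapp M Fin.elim0 : Arg S ν c 0 0).actC I = I _ M := by
  rw [Arg.actC_eq_ms, Arg.mapp_ms]
  exact Arg.subst_var _

/-- The instantiation is built in three stages: `Ξ` by inverting the presupposed type `P`, then the
two given terms, then the equations `Φ`. -/
theorem RawTheory.IsExtensionalityRule.sound {R : ExtRule S} (hR : T.IsExtensionalityRule R)
    {Γ : Ctx S μ n} (hΓ : T.WfCtx Θ Γ) {I : Inst S R.ar μ n} {s t : Tm S μ n}
    (hE : T.EqSound R.premAll Θ (R.eqs.extend ((I.cons s).cons t)))
    (hs : T.Derives Θ Γ (.judg (.tm (R.type.actC I)) s))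
    (ht : T.Derives Θ Γ (.judg (.tm (R.type.actC I)) t)) :
    T.Derives Θ Γ (.judg (.eqTm s t (R.type.actC I)) .starTm) := by
  obtain ⟨h₁, ⟨hprem, -⟩, -, h₂⟩ := hR
  have hI : T.DerivableInst R.prem Θ Γ I := by
    refine h₂.derivableInst hΓ (hs.presup hΓ).bdryTm_inv fun α N hα l Δ τ ts e hΔ => ?_
    have := hE α (R.eqs.incl α N.there.there) hα l Δ τ ts e hΔ
    rw [ExtRule.premAll, EqPrem.append_get_incl, Bdry.mrename_actC,
      funext fun α => funext fun M => EqPrem.extend_incl R.eqs ((I.cons s).cons t) M,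
      MCtx.get_there_actC, MCtx.get_there_actC] at this
    exact this
  have hD := R.eqs.derivableInst_extend hprem hΓ (I := (I.cons s).cons t) ((hI.snoc hs).snoc (by
    change T.Derives Θ Γ (.judg (.tm ((R.type.mrename fun _ => MVar.there).actC (I.cons s))) t)
    rw [Arg.mrename_actC]
    exact ht)) hE
  have := hD.derives_judg hΓ h₁
  have hA : (R.type.mrename (fun α M => R.eqs.incl α (.there (.there M)))).actC
      (R.eqs.extend ((I.cons s).cons t)) = R.type.actC I := by
    rw [Arg.mrename_actC]
    congr 1
    funext α M
    exact EqPrem.extend_incl _ _ _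
  have hs' : (Arg.mapp (R.eqs.incl ⟨.tm, 0⟩ (.there .here)) Fin.elim0).actC
      (R.eqs.extend ((I.cons s).cons t)) = s :=
    (Arg.mapp_actC_elim0 _ _).trans (EqPrem.extend_incl _ _ _)
  have ht' : (Arg.mapp (R.eqs.incl ⟨.tm, 0⟩ .here) Fin.elim0).actC
      (R.eqs.extend ((I.cons s).cons t)) = t :=
    (Arg.mapp_actC_elim0 _ _).trans (EqPrem.extend_incl _ _ _)
  change T.Derives Θ Γ (.judg (.eqTm (Arg.actC _ _) (Arg.actC _ _) (Arg.actC _ _)) .starTm) at this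
  rwa [hs', ht', hA] at this

end Rules

/-! ### Soundness of the algorithm -/

section Soundness

variable {S : Signature.{u}} {T : RawTheory.{u, v} S} {μ ν ξ : List MArity} {c : Cls}
  {m n k l : ℕ} {Θ : MCtx S μ}

/-- The phases which compare two expressions presupposed to be derivable. -/
def Phase.IsCheck : Phase → Prop
  | .norm => False
  | .normP => False
  | .normC => False
  | .check => True
  | .checkE => True
  | .checkN => True

/-- All instances of `BB[e₁ ≡ e₂]` are derivable whenever those of `BB[e₁]` (and of `BB[e₂]`, if `b`
holds) are. -/
def RawTheory.SoundAt (T : RawTheory.{u, v} S) (Θ : MCtx S μ) (b : Prop) (BB : Bdry S μ c m n)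
    (e₁ e₂ : Arg S μ c m n) : Prop :=
  c.IsObj → ∀ (k : ℕ) (Δ : Ctx S μ k) (σ : Fin n → Tm S μ k) (ts : Fin m → Tm S μ k),
    T.WfCtx Θ Δ → T.Derives Θ Δ (.judg (BB.instAux σ ts) (e₁.instAux σ ts)) →
    (b → T.Derives Θ Δ (.judg (BB.instAux σ ts) (e₂.instAux σ ts))) →
    T.Derives Θ Δ (.eqn (BB.instAux σ ts) (e₁.instAux σ ts) (e₂.instAux σ ts))

/-- After substitution by `σ` an abstracted argument is compared through its instances; an instance
along `τ` is one of the unsubstituted argument along the composite, to which `SoundAt` applies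
without any typing condition. -/
theorem RawTheory.SoundAt.eqn_actC {b : Prop} {BB : Bdry S ν c m 0} {I : Inst S ν μ n}
    {e₁ e₂ : Arg S μ c m n} (h : T.SoundAt Θ b (BB.actC I) e₁ e₂) (hc : c.IsObj)
    {Δ : Ctx S μ k} (hΔ : T.WfCtx Θ Δ) (σ : Fin n → Tm S μ k)
    (h₁ : T.Derives Θ Δ (.judg (BB.actC (I.subst σ)) (e₁.subst σ)))
    (h₂ : b → T.Derives Θ Δ (.judg (BB.actC (I.subst σ)) (e₂.subst σ))) :
    T.Derives Θ Δ (.eqn (BB.actC (I.subst σ)) (e₁.subst σ) (e₂.subst σ)) := by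
  refine RawTheory.Derives.eqn_of_instances hc hΔ b h₁ h₂ fun l Δ' τ ts hΔ' => ?_
  simp only [Bdry.actC_subst_instAux, Arg.subst_instAux]
  exact h hc l Δ' _ ts hΔ'

theorem Bdry.exists_eqn {d : Cls} (hd : d.IsObj) (B : Bdry S ν d.eqn m n) :
    ∃ (BB : Bdry S ν d m n) (e₁ e₂ : Arg S ν d m n), B = BB.eqn e₁ e₂ := by
  rcases hd with rfl | rfl
  · induction m generalizing n with
    | zero =>
      cases B with
      | eqTy A A' => exact ⟨.ty, A, A', rfl⟩
    | succ m ih =>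
      cases B with
      | abs A B =>
        obtain ⟨BB, e₁, e₂, rfl⟩ := ih B
        exact ⟨.abs A BB, .abs e₁, .abs e₂, rfl⟩
  · induction m generalizing n with
    | zero =>
      cases B with
      | eqTm s t A => exact ⟨.tm A, s, t, rfl⟩
    | succ m ih =>
      cases B with
      | abs A B =>
        obtain ⟨BB, e₁, e₂, rfl⟩ := ih B
        exact ⟨.abs A BB, .abs e₁, .abs e₂, rfl⟩

/-- Derivability of an equation boundary contains derivability of both sides, which is what a sound
comparison asks for. -/
theorem eqSound_of_soundAt {Ξ : MCtx S ν} {I : Inst S ν μ n}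
    (h : ∀ (d : Cls) (m : ℕ) (M : MVar ν ⟨d.eqn, m⟩) (BB : Bdry S ν d m 0) (e₁ e₂ : Arg S ν d m 0),
      d.IsObj → Ξ.get M = BB.eqn e₁ e₂ →
      T.SoundAt Θ True (BB.actC I) (e₁.actC I) (e₂.actC I)) : T.EqSound Ξ Θ I := by
  have key : ∀ (d : Cls) (m : ℕ) (M : MVar ν ⟨d.eqn, m⟩), d.IsObj → ∀ (l : ℕ) (Δ : Ctx S μ l)
      (τ : Fin n → Tm S μ l) (ts : Fin m → Tm S μ l) (e : Arg S μ d.eqn 0 l), T.WfCtx Θ Δ →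
      T.Derives Θ Δ (.bdry (((Ξ.get M).actC I).instAux τ ts)) →
      T.Derives Θ Δ (.judg (((Ξ.get M).actC I).instAux τ ts) e) := by
    intro d m M hd l Δ τ ts e hΔ hb
    obtain ⟨BB, e₁, e₂, hM⟩ := (Ξ.get M).exists_eqn hd
    rw [hM, Bdry.eqn_actC, Bdry.eqn_instAux] at hb ⊢
    obtain ⟨h₁, h₂⟩ := hb.eqn_bdry_inv hd
    rw [Arg.eq_of_not_isObj d.eqn_not_isObj e (Arg.dummy d 0)]
    exact h d m M BB e₁ e₂ hd hM hd l Δ τ ts hΔ h₁ fun _ => h₂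
  rintro ⟨_ | _, m⟩ N hα
  · exact absurd (Or.inl rfl) hα
  · exact absurd (Or.inr rfl) hα
  · exact key .ty m N (Or.inl rfl)
  · exact key .tm m N (Or.inr rfl)

theorem Arg.actC_subst (e : Arg S ν c m 0) (I : Inst S ν μ n) (σ : Fin n → Tm S μ k) :
    (e.actC I).subst σ = e.actC (I.subst σ) := by
  rw [Arg.actC_eq_ms, Arg.subst_ms, Arg.actC_eq_ms]
  congr 1
  exact elim0_eq _ _

theorem Bdry.argTyAux_subst (BB : Bdry S μ c m n) (σ : Fin n → Tm S μ k) (ts : Fin m → Tm S μ k)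
    (τ : Fin k → Tm S μ l) (j : Fin m) :
    (BB.argTyAux σ ts j).subst τ =
      BB.argTyAux (fun i => (σ i).subst τ) (fun j => (ts j).subst τ) j := by
  induction BB with
  | abs A BB ih =>
    refine Fin.cases ?_ (fun j => ?_) j <;>
      simp [Bdry.argTyAux, Arg.subst_subst, cases_comp (Arg.subst τ), ih]
  | _ => exact j.elim0

theorem Bdry.argTy_subst (BB : Bdry S μ c m 0) (ts : Fin m → Tm S μ k) (τ : Fin k → Tm S μ l)
    (j : Fin m) : (BB.argTy ts j).subst τ = BB.argTy (fun j => (ts j).subst τ) j := by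
  rw [Bdry.argTy, Bdry.argTyAux_subst, elim0_eq (fun i => _) Fin.elim0]
  rfl

/-- Object metavariables behave like symbols with term arguments; well-formedness of `Θ` gives the
equality of the two result types in the term case. -/
theorem RawTheory.Derives.mvarCongr (hΘ : T.WfMCtx Θ) {Γ : Ctx S μ n} (hΓ : T.WfCtx Θ Γ)
    (hc : c.IsObj) (M : MVar μ ⟨c, m⟩) {ss ts : Fin m → Tm S μ n}
    (hss : ∀ j, T.Derives Θ Γ (.judg (.tm ((Θ.get M).argTy ss j)) (ss j)))
    (hst : ∀ j, (T.Derives Θ Γ (.judg (.tm ((Θ.get M).argTy ts j)) (ts j)) →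
        T.Derives Θ Γ (.judg (.tm ((Θ.get M).argTy ss j)) (ts j))) →
      T.Derives Θ Γ (.judg (.eqTm (ss j) (ts j) ((Θ.get M).argTy ss j)) .starTm)) :
    T.Derives Θ Γ (.eqn ((Θ.get M).inst ss) (.mvar hc M ss) (.mvar hc M ts)) := by
  have hσ : T.ESub Θ Ctx.nil Γ Fin.elim0 Fin.elim0 :=
    ⟨fun i => i.elim0, fun i => i.elim0, fun i => i.elim0⟩
  obtain ⟨hts, heq⟩ := RawTheory.Fits.of_eq (hΘ.get M) hΓ hσ hss hst
  rcases hc with rfl | rfl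
  · rw [Stmt.eqn_ty]
    exact .mvarCongrTy M ss ts hss hts heq
  · rw [Stmt.eqn_tm]
    exact .mvarCongrTm M ss ts hss hts heq ((hΘ.get M).inst_bdryConv hσ hss hts heq).type

/-- Nothing relates `Γ` or the boundary to a derivation beforehand: each case obtains what it needs
from the instantiated judgement, by inversion or presupposition. -/
theorem RawTheory.Algo.soundAt (hT : T.IsStandard) {ι : Cls → Type w}
    {C : ∀ c : Cls, ι c → Rewrite S c} (hC : ∀ (c : Cls) (i : ι c), T.IsComputationRule (C c i))
    {κ : Type x} {E : κ → ExtRule S} (hE : ∀ i : κ, T.IsExtensionalityRule (E i))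
    {P : Principal S μ} {ph : Phase} {Γ : Ctx S μ n} {BB : Bdry S μ c m n}
    {e₁ e₂ : Arg S μ c m n} (h : T.Algo C E P Θ ph Γ BB e₁ e₂) :
    T.SoundAt Θ ph.IsCheck BB e₁ e₂ := by
  induction h with
  | compute B i I s hs _ ih =>
    intro hc k Δ σ ts hΔ h₁ _
    subst hs
    simp only [Arg.instAux, Arg.actC_subst] at h₁ ⊢
    exact (hC _ i).sound hT hc hΔ ((eqSound_of_soundAt ih).subst σ) h₁
  | principalSym B f Ξ B₀ es ds hf _ hn ih =>
    intro hc k Δ σ ts hΔ h₁ _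
    obtain ⟨hes, hconv⟩ := h₁.appInv hT Ξ B₀ hf
    -- Congruence yields the equation at the natural boundary of the symbol, and inversion converts
    -- it to the boundary at hand.
    refine hconv.eqn_right hc (hf.congr hT hΔ (.of_eq (hf.finitary hT).1 hΔ hes ?_))
    intro α M hα _
    by_cases hP : P.sym f α M
    · exact (ih α M hP).eqn_actC hα hΔ σ (hes α M) fun h => h.elim
    · rw [← hn α M hP]
      exact (hes α M).eqn_refl hα
  | principalMVar B hc M ss ts _ hn ih =>
    intro _ k Δ σ us hΔ h₁ _
    obtain ⟨hss, hconv⟩ := h₁.appInv hT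
    refine hconv.eqn_right hc (.mvarCongr hΔ.wfMCtx hΔ hc M hss fun j _ => ?_)
    by_cases hP : P.mvar M j
    · have h := ih j hP (Or.inr rfl) k Δ σ Fin.elim0 hΔ
      simp only [Bdry.instAux, Arg.instAux, Bdry.argTy_subst] at h
      exact h (hss j) fun h => h.elim
    · rw [← hn j hP]
      exact .tmRefl (hss j)
  | normStep B e e₁ e₂ e₃ _ _ _ ih₁ ih₂ ih₃ =>
    intro hc k Δ σ ts hΔ h _
    have h₁ := ih₁ hc k Δ σ ts hΔ h fun h => h.elim
    have h₂ := ih₂ hc k Δ σ ts hΔ (h₁.eqn_right hc hΔ) fun h => h.elim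
    have h₃ := ih₃ hc k Δ σ ts hΔ (h₂.eqn_right hc hΔ) fun h => h.elim
    exact (h₁.eqn_trans hc h₂).eqn_trans hc h₃
  | normDone B e e₁ _ _ ih => exact ih
  -- Instances of an abstraction are by definition instances of its body with one more term in the
  -- substitution.
  | normAbs A BB e₁ e₂ _ ih => exact fun hc k Δ σ ts => ih hc k Δ _ _
  | normVar a A => exact fun hc k Δ σ ts _ h _ => h.eqn_refl hc
  | normStarTy => exact fun hc => absurd hc Cls.not_isObj_eqTy
  | normStarTm => exact fun hc => absurd hc Cls.not_isObj_eqTm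
  | checkTm A A₁ s t _ _ ih₁ ih₂ =>
    intro hc k Δ σ ts hΔ h₁ h₂
    have hA : T.Derives Θ Δ (.judg (.eqTy (A.subst σ) (A₁.subst σ)) .starTy) :=
      ih₁ (Or.inl rfl) k Δ σ ts hΔ (h₁.presup hΔ).bdryTm_inv fun h => h.elim
    -- Both terms move to the normalized type, and the equation found there is converted back.
    exact .convEq (ih₂ hc k Δ σ ts hΔ (.convTm h₁ hA) fun _ => .convTm (h₂ trivial) hA) hA.tySym
  | checkTy A A₁ B B₁ _ _ _ ih₁ ih₂ ih₃ =>
    intro hc k Δ σ ts hΔ h₁ h₂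
    have hA := ih₁ hc k Δ σ ts hΔ h₁ fun h => h.elim
    have hB := ih₂ hc k Δ σ ts hΔ (h₂ trivial) fun h => h.elim
    exact .tyTran (.tyTran hA (ih₃ hc k Δ σ ts hΔ (hA.eqn_right hc hΔ) fun _ =>
      hB.eqn_right hc hΔ)) (.tySym hB)
  | checkAbs A BB e₁ e₂ _ ih => exact fun hc k Δ σ ts => ih hc k Δ _ _
  | extApply i I A s t hA _ ih =>
    intro _ k Δ σ ts hΔ h₁ h₂
    subst hA
    have hEq := (eqSound_of_soundAt ih).subst σ
    rw [EqPrem.extend_subst, Inst.cons_subst, Inst.cons_subst] at hEq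
    simp only [Bdry.instAux, Arg.instAux, Arg.actC_subst] at h₁ h₂ ⊢
    exact (hE i).sound hΔ hEq h₁ (h₂ trivial)
  | extNone A s s₁ t t₁ _ _ _ _ ih₁ ih₂ ih₃ =>
    intro hc k Δ σ ts hΔ h₁ h₂
    have hs := ih₁ hc k Δ σ ts hΔ h₁ fun h => h.elim
    have ht := ih₂ hc k Δ σ ts hΔ (h₂ trivial) fun h => h.elim
    exact .tmTran (.tmTran hs (ih₃ hc k Δ σ ts hΔ (hs.eqn_right hc hΔ) fun _ =>
      ht.eqn_right hc hΔ)) (.tmSym ht)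
  | neutVar a A => exact fun hc k Δ σ ts _ h _ => h.eqn_refl hc
  | neutSym B f Ξ B₀ es ds hf _ _ ih₁ ih₂ =>
    intro hc k Δ σ ts hΔ h₁ h₂
    obtain ⟨hes, hconv⟩ := h₁.appInv hT Ξ B₀ hf
    -- Inversion types the arguments `ds` at boundaries instantiated by `ds`, but the comparison is
    -- made at those for `es`; the implication `hd` furnished by `EInst.of_eq` bridges the two.
    obtain ⟨hds, -⟩ := (h₂ trivial).appInv hT Ξ B₀ hf
    refine hconv.eqn_right hc (hf.congr hT hΔ (.of_eq (hf.finitary hT).1 hΔ hes ?_))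
    intro α M hα hd
    by_cases hP : P.sym f α M
    · exact (ih₁ α M hα hP).eqn_actC hα hΔ σ (hes α M) fun _ => hd (hds α M)
    · exact (ih₂ α M hα hP).eqn_actC hα hΔ σ (hes α M) fun _ => hd (hds α M)
  | neutMVar B hc M ss ts _ _ ih₁ ih₂ =>
    intro _ k Δ σ us hΔ h₁ h₂
    obtain ⟨hss, hconv⟩ := h₁.appInv hT
    obtain ⟨hts, -⟩ := (h₂ trivial).appInv hT
    refine hconv.eqn_right hc (.mvarCongr hΔ.wfMCtx hΔ hc M hss fun j hd => ?_)
    by_cases hP : P.mvar M j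
    · have h := ih₁ j hP (Or.inr rfl) k Δ σ Fin.elim0 hΔ
      simp only [Bdry.instAux, Arg.instAux, Bdry.argTy_subst] at h
      exact h (hss j) fun _ => hd (hts j)
    · have h := ih₂ j hP (Or.inr rfl) k Δ σ Fin.elim0 hΔ
      simp only [Bdry.instAux, Arg.instAux, Bdry.argTy_subst] at h
      exact h (hss j) fun _ => hd (hts j)
  | neutAbs A BB e₁ e₂ _ ih => exact fun hc k Δ σ ts => ih hc k Δ _ _

/-- For the normalizing phases the condition `b` is false, so only the left side is presupposed;
derivability of the result is the right presupposition of the equation. -/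
theorem RawTheory.SoundAt.derives {b : Prop} {BB : Bdry S μ c m n} {e₁ e₂ : Arg S μ c m n}
    (h : T.SoundAt Θ b BB e₁ e₂) (hb : ¬ b) (hc : c.IsObj) {Γ : Ctx S μ n} (hΓ : T.WfCtx Θ Γ)
    (h₁ : T.Derives Θ Γ (.judg BB e₁)) :
    T.Derives Θ Γ (.eqn BB e₁ e₂) ∧ T.Derives Θ Γ (.judg BB e₂) := by
  have := RawTheory.Derives.eqn_of_instances hc hΓ b h₁ (fun h => absurd h hb) (h hc)
  exact ⟨this, this.eqn_right hc hΓ⟩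

end Soundness

end FTT

theorem mainTheorem1 {S : FTT.Signature.{u}} (T : FTT.RawTheory.{u, v} S) (hT : T.IsStandard)
    {ι : FTT.Cls → Type w} (C : ∀ c : FTT.Cls, ι c → FTT.Rewrite S c)
    (hC : ∀ (c : FTT.Cls) (i : ι c), T.IsComputationRule (C c i))
    {κ : Type x} (E : κ → FTT.ExtRule S) (hE : ∀ i : κ, T.IsExtensionalityRule (E i))
    {μ : List FTT.MArity} (P : FTT.Principal S μ) (Θ : FTT.MCtx S μ)
    {n : ℕ} (Γ : FTT.Ctx S μ n) (hΓ : T.WfCtx Θ Γ) {c : FTT.Cls} (hc : c.IsObj) :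
    (∀ (m : ℕ) (BB : FTT.Bdry S μ c m n) (e₁ e₂ : FTT.Arg S μ c m n),
      T.Derives Θ Γ (.judg BB e₁) → T.Algo C E P Θ .norm Γ BB e₁ e₂ →
      T.Derives Θ Γ (.eqn BB e₁ e₂) ∧ T.Derives Θ Γ (.judg BB e₂)) ∧
    (∀ (B : FTT.Bdry S μ c 0 n) (e₁ e₂ : FTT.Arg S μ c 0 n),
      T.Derives Θ Γ (.judg B e₁) → T.Algo C E P Θ .normP Γ B e₁ e₂ →
      T.Derives Θ Γ (.eqn B e₁ e₂) ∧ T.Derives Θ Γ (.judg B e₂)) ∧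
    (∀ (B : FTT.Bdry S μ c 0 n) (e₁ e₂ : FTT.Arg S μ c 0 n),
      T.Derives Θ Γ (.judg B e₁) → T.Algo C E P Θ .normC Γ B e₁ e₂ →
      T.Derives Θ Γ (.eqn B e₁ e₂) ∧ T.Derives Θ Γ (.judg B e₂)) :=
  ⟨fun _ _ _ _ h₁ h₂ => (h₂.soundAt hT hC hE).derives (fun h => h) hc hΓ h₁,
    fun _ _ _ h₁ h₂ => (h₂.soundAt hT hC hE).derives (fun h => h) hc hΓ h₁,
    fun _ _ _ h₁ h₂ => (h₂.soundAt hT hC hE).derives (fun h => h) hc hΓ h₁⟩
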